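/- A $(k,g)$-graph is a finite simple graph, not necessarily connected, that is regular of degree $k$ and has girth (length of a shortest cycle) exactly $g$. For even $g$ the Moore bound is $M(k,g)=2\sum_{i=0}^{(g-2)/2}(k-1)^i$, and the excess of a $(k,g)$-graph of order $n$ is $e=n-M(k,g)$. (i) Let $k\ge 3$ and let $g\ge 6$ be even. Then there is no $(k,g)$-graph whose excess $e$ is odd and satisfies $e\le k-2$. (ii) Let $k\ge 3$ and let $g\ge 8$ be even. Then there is no $(k,g)$-graph of excess $2$. -/

import Mathlib

/-- A `(k, g)`-graph: a finite simple graph (not required to be connected) that is regular of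
degree `k` and whose girth, the length of a shortest cycle, is exactly `g`. -/
def IsKGGraph {V : Type*} [Fintype V] (G : SimpleGraph V) [DecidableRel G.Adj] (k g : ℕ) : Prop :=
  G.IsRegularOfDegree k ∧ G.egirth = (g : ℕ∞)

/-- The Moore bound `M(k, g)`, for `k ≥ 1` and `g ≥ 3`. For even `g` it is
`2 * ∑ (k - 1) ^ i` over `0 ≤ i ≤ (g - 2) / 2`; for odd `g` it is
`1 + ∑ k * (k - 1) ^ i` over `0 ≤ i ≤ (g - 3) / 2`. -/
def mooreBound (k g : ℕ) : ℕ :=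
  if Even g then 2 * ∑ i ∈ Finset.range (g / 2), (k - 1) ^ i
  else 1 + ∑ i ∈ Finset.range ((g - 1) / 2), k * (k - 1) ^ i

/-- The excess of a `(k, g)`-graph on the vertex set `V`: its order minus the Moore bound,
as an integer. -/
def excess (V : Type*) [Fintype V] (k g : ℕ) : ℤ :=
  (Fintype.card V : ℤ) - (mooreBound k g : ℤ)

/-! Write `g = 2(N+1)`, `k = q+1`, and let `A` be the adjacency matrix. Because of the girth, the
polynomials `G_j` of `kgPoly` satisfy: `G_j(A)` is, for `j ≤ N`, the 0/1 matrix of the relation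
`Near j`. For an edge `uv` the vertices near `u` and those near `v` at level `N` are disjoint sets,
each of half the Moore bound, so exactly `e` vertices are far from both. Nearness commutes with
adjacency since `G_N(A)` commutes with `A`. A count using only these facts and the absence of
triangles and 4-cycles (`IsNearRel`, `exists_sign`) shows that the graph is bipartite when `e ≤
k-2`, and also when `k = 3`, `e = 2`. A regular bipartite graph has even order and the Moore bound
is even, which settles odd excess.

For excess 2 each vertex `u` has exactly one vertex `σ u` of the colour prescribed by `N` that is
not near it. Hence `G_N(A) = K - P`, with `K` given by the colouring and `P` the permutation matrix
of `σ`; so `σ` is an involutive automorphism, and the eigenvalues other than `±k` are roots of `G_N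
± 1`. A trace computation expresses the multiplicity of each root through `G_{N-1}` and `G_N'`
(`exists_multiplicity`, `KGFeasible`).

When `q^N` is large the multiplicity almost determines the square of the root. Conjugate roots share
their multiplicity, so their squares differ by less than 1 and must be rational integers
(`exists_sq_eq_intCast`). But `G_N ± 1` has too many distinct roots for that (`not_of_big`). The
finitely many remaining pairs with `N ≥ 5` fall to rational bounds showing that some multiplicity is
not an integer, and `N = 3, 4` to arguments on cubic and quadratic equations. Only `q = 2`, `N = 4`
survives.

In that cubic case of girth ten, paths of length two behave like the flags of a map with three faces
at each vertex: every such path extends to a unique face, six steps along a face lead to the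
antipode, and eight steps along a zigzag lead to the antipode as well. The flag reflections then
satisfy relations forcing the antipodal map to be trivial (`pow_six_eq_one_of_relations`), a
contradiction. -/

/-! ### Girth and distances -/

namespace SimpleGraph

variable {V : Type*} {G : SimpleGraph V}

/-- Two distinct paths with the same ends bound the girth by the sum of their lengths. -/
theorem egirth_le_of_ne_of_isPath {u v : V} {p q : G.Walk u v} (hp : p.IsPath) (hq : q.IsPath)
    (hne : p ≠ q) : G.egirth ≤ ((p.length + q.length : ℕ) : ℕ∞) := by
  classical
  set H : SimpleGraph V := fromEdgeSet {e | e ∈ p.edges ∨ e ∈ q.edges} with hH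
  have hmem : ∀ e, (e ∈ p.edges ∨ e ∈ q.edges) → e ∈ H.edgeSet := by
    intro e he
    rw [hH, edgeSet_fromEdgeSet]
    refine ⟨he, ?_⟩
    have : e ∈ G.edgeSet := he.elim (fun h => p.edges_subset_edgeSet h)
      (fun h => q.edges_subset_edgeSet h)
    exact fun hd => G.not_isDiag_of_mem_edgeSet this hd
  have hmem' : ∀ e ∈ H.edgeSet, e ∈ p.edges ∨ e ∈ q.edges := by
    intro e he
    rw [hH, edgeSet_fromEdgeSet] at he
    exact he.1
  have hHG : H ≤ G := by
    intro a b hab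
    rcases hmem' s(a, b) hab with h | h
    · exact p.edges_subset_edgeSet h
    · exact q.edges_subset_edgeSet h
  -- In a forest the path between two vertices is unique, so the union of the two paths carries a
  -- cycle.
  have hcyc : ¬ H.IsAcyclic := by
    intro hac
    have h1 := (hac.subsingleton_path u v).elim ⟨p.transfer H fun e he => hmem e (Or.inl he), hp.transfer _⟩
      ⟨q.transfer H fun e he => hmem e (Or.inr he), hq.transfer _⟩
    have h2 : p.transfer H (fun e he => hmem e (Or.inl he)) =
        q.transfer H (fun e he => hmem e (Or.inr he)) := congrArg Subtype.val h1
    apply hne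
    apply Walk.ext_support
    have := congrArg Walk.support h2
    simpa using this
  rw [IsAcyclic] at hcyc
  push Not at hcyc
  obtain ⟨a, w, hw⟩ := hcyc
  -- The edges of the cycle are distinct and all lie on `p` or on `q`.
  have hlen : w.length ≤ p.length + q.length := by
    rw [← Walk.length_edges w, ← Walk.length_edges p, ← Walk.length_edges q, ← List.length_append]
    apply List.Subperm.length_le
    apply List.subperm_of_subset hw.edges_nodup
    intro e he
    rw [List.mem_append]
    exact hmem' e (w.edges_subset_edgeSet he)
  have := egirth_le_length (hw.mapLe hHG)
  refine this.trans ?_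
  simpa using (by exact_mod_cast hlen : (w.length : ℕ∞) ≤ ((p.length + q.length : ℕ) : ℕ∞))

theorem edist_le_edist_add_one {u v : V} (h : G.Adj u v) (x : V) :
    G.edist u x ≤ G.edist v x + 1 := by
  have h1 := G.edist_triangle (u := u) (v := v) (w := x)
  rw [edist_eq_one_iff_adj.2 h, add_comm] at h1
  exact h1

theorem exists_isPath_of_edist_eq {u v : V} {i : ℕ} (h : G.edist u v = i) :
    ∃ p : G.Walk u v, p.IsPath ∧ p.length = i := by
  obtain ⟨p, hp⟩ := exists_walk_of_edist_eq_coe h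
  refine ⟨p, p.isPath_of_length_eq_dist ?_, hp⟩
  rw [hp, SimpleGraph.dist, h, ENat.toNat_natCast]

/-- Adjacent vertices are not at the same small distance from a vertex. -/
theorem edist_ne_of_adj {m : ℕ} (hg : ((2 * m : ℕ) : ℕ∞) ≤ G.egirth) {u v x : V} (h : G.Adj u v)
    {i : ℕ} (hi : i < m) (hu : G.edist u x = i) : G.edist v x ≠ i := by
  intro hv
  obtain ⟨p, hp, hpl⟩ := exists_isPath_of_edist_eq hu
  obtain ⟨p', hp', hpl'⟩ := exists_isPath_of_edist_eq hv
  -- If `u` lay on the geodesic from `v`, the part after `u` would already have the full length `i`,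
  -- forcing `u = v`.
  have hnot : u ∉ p'.support := by
    classical
    intro hmem
    have h1 : G.edist u x ≤ (p'.dropUntil u hmem).length := edist_le _
    have h2 := congrArg Walk.length (p'.take_spec hmem)
    rw [Walk.length_append] at h2
    rw [hu] at h1
    have h1' : i ≤ (p'.dropUntil u hmem).length := by exact_mod_cast h1
    have h3 : (p'.takeUntil u hmem).length = 0 := by omega
    exact h.ne (Walk.eq_of_length_eq_zero h3).symm
  have hc : (Walk.cons h p').IsPath := by
    rw [Walk.cons_isPath_iff]
    exact ⟨hp', hnot⟩
  have hne : p ≠ Walk.cons h p' := by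
    intro he
    have := congrArg Walk.length he
    rw [Walk.length_cons] at this
    omega
  have h4 := hg.trans (egirth_le_of_ne_of_isPath hp hc hne)
  rw [Walk.length_cons] at h4
  have h5 : 2 * m ≤ p.length + (p'.length + 1) := by exact_mod_cast h4
  omega

/-- A vertex at positive distance has a neighbour one step closer. -/
theorem exists_adj_edist_eq {u x : V} {i : ℕ} (hu : G.edist u x = (i + 1 : ℕ)) :
    ∃ v, G.Adj u v ∧ G.edist v x = i := by
  obtain ⟨p, hpl⟩ := exists_walk_of_edist_eq_coe hu
  cases p with
  | nil => simp at hpl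
  | @cons _ v _ h p' =>
    refine ⟨v, h, le_antisymm ?_ ?_⟩
    · refine (edist_le p').trans ?_
      rw [Walk.length_cons] at hpl
      exact_mod_cast (by omega : p'.length ≤ i)
    · have := edist_le_edist_add_one h x
      rw [hu] at this
      push_cast at this
      exact (ENat.add_le_add_iff_right (by simp)).1 this

/-- At small distance, the neighbour one step closer is unique. -/
theorem eq_of_adj_of_edist_eq {m : ℕ} (hg : ((2 * m : ℕ) : ℕ∞) ≤ G.egirth) {u v w x : V}
    (hv : G.Adj u v) (hw : G.Adj u w) {i : ℕ} (hi : i + 1 < m) (hu : G.edist u x = (i + 1 : ℕ))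
    (hvx : G.edist v x = i) (hwx : G.edist w x = i) : v = w := by
  by_contra hne
  have key : ∀ {v : V} (hv : G.Adj u v), G.edist v x = i →
      ∃ p : G.Walk u x, p.IsPath ∧ p.length = i + 1 ∧ p.snd = v := by
    intro v hv hvx
    obtain ⟨p, hp, hpl⟩ := exists_isPath_of_edist_eq hvx
    refine ⟨Walk.cons hv p, ?_, by simp [hpl], by simp⟩
    apply Walk.isPath_of_length_eq_dist
    rw [SimpleGraph.dist, hu, ENat.toNat_natCast, Walk.length_cons, hpl]
  obtain ⟨p, hp, hpl, hps⟩ := key hv hvx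
  obtain ⟨p', hp', hpl', hps'⟩ := key hw hwx
  have h4 := hg.trans (egirth_le_of_ne_of_isPath hp hp' (by
    rintro rfl
    exact hne (hps.symm.trans hps')))
  have h5 : 2 * m ≤ p.length + p'.length := by exact_mod_cast h4
  omega

/-- `Near j u x` says that the distance from `u` to `x` is at most `j` and congruent to `j`
modulo `2`. -/
def Near (G : SimpleGraph V) (j : ℕ) (u x : V) : Prop :=
  ∃ i l : ℕ, i + 2 * l = j ∧ G.edist u x = i

theorem Near.symm {j : ℕ} {u x : V} (h : G.Near j u x) : G.Near j x u := by
  obtain ⟨i, l, h1, h2⟩ := h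
  exact ⟨i, l, h1, by rw [edist_comm, h2]⟩

theorem near_comm {j : ℕ} {u x : V} : G.Near j u x ↔ G.Near j x u :=
  ⟨Near.symm, Near.symm⟩

theorem near_zero_iff {u x : V} : G.Near 0 u x ↔ u = x := by
  constructor
  · rintro ⟨i, l, h1, h2⟩
    have : i = 0 := by omega
    subst this
    exact edist_eq_zero_iff.1 h2
  · rintro rfl
    exact ⟨0, 0, rfl, by simp⟩

theorem near_one_iff {u x : V} : G.Near 1 u x ↔ G.Adj u x := by
  constructor
  · rintro ⟨i, l, h1, h2⟩
    have : i = 1 := by omega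
    subst this
    exact edist_eq_one_iff_adj.1 h2
  · intro h
    exact ⟨1, 0, rfl, by rw [edist_eq_one_iff_adj.2 h]; rfl⟩

theorem Near.add_two {j : ℕ} {u x : V} (h : G.Near j u x) : G.Near (j + 2) u x := by
  obtain ⟨i, l, h1, h2⟩ := h
  exact ⟨i, l + 1, by omega, h2⟩

/-- Adjacent vertices at finite distance from `x` have consecutive distances, if one of these is
small. -/
theorem edist_adj_cases {m : ℕ} (hg : ((2 * m : ℕ) : ℕ∞) ≤ G.egirth) {u v x : V} (h : G.Adj u v)
    {i : ℕ} (hi : i < m) (hu : G.edist u x = i) :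
    G.edist v x = (i + 1 : ℕ) ∨ ∃ i', i = i' + 1 ∧ G.edist v x = i' := by
  have h1 := edist_le_edist_add_one h x
  have h2 := edist_le_edist_add_one h.symm x
  have h3 := edist_ne_of_adj hg h hi hu
  rw [hu] at h1 h2
  have hfin : G.edist v x ≠ ⊤ := by
    intro ht
    rw [ht] at h2
    exact absurd h2 (by exact_mod_cast not_le_of_gt (ENat.natCast_lt_top (i + 1)))
  obtain ⟨j, hj⟩ := ENat.ne_top_iff_exists.1 hfin
  rw [← hj] at h1 h2 h3 ⊢
  have h1' : i ≤ j + 1 := by exact_mod_cast h1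
  have h2' : j ≤ i + 1 := by exact_mod_cast h2
  have h3' : j ≠ i := by exact_mod_cast h3
  rcases (by omega : j = i + 1 ∨ i = j + 1) with h | h
  · left; rw [h]
  · right; exact ⟨j, h, rfl⟩

theorem not_near_of_adj {m j : ℕ} (hg : ((2 * m : ℕ) : ℕ∞) ≤ G.egirth) (hj : j < m) {u v x : V}
    (h : G.Adj u v) (hu : G.Near j u x) : ¬ G.Near j v x := by
  rintro ⟨i', l', h1', h2'⟩
  obtain ⟨i, l, h1, h2⟩ := hu
  rcases edist_adj_cases hg h (by omega) h2 with h3 | ⟨a, ha, h3⟩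
  · rw [h2'] at h3
    have : i' = i + 1 := by exact_mod_cast h3
    omega
  · rw [h2'] at h3
    have : i' = a := by exact_mod_cast h3
    omega

theorem near_succ_of_adj_of_near {m j : ℕ} (hg : ((2 * m : ℕ) : ℕ∞) ≤ G.egirth) (hj : j < m)
    {u v x : V} (h : G.Adj u v) (hv : G.Near j v x) : G.Near (j + 1) u x := by
  obtain ⟨i, l, h1, h2⟩ := hv
  rcases edist_adj_cases hg h.symm (by omega) h2 with h3 | ⟨a, ha, h3⟩
  · exact ⟨i + 1, l, by omega, h3⟩
  · exact ⟨a, l + 1, by omega, h3⟩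

theorem near_succ_of_near_pred {m j : ℕ} (hg : ((2 * m : ℕ) : ℕ∞) ≤ G.egirth) (hj : j < m)
    {u v x : V} (h : G.Adj u v) (hu : G.Near j u x) : G.Near (j + 1) v x :=
  near_succ_of_adj_of_near hg hj h.symm hu

/-- If `u` is at distance exactly `j + 1` from `x`, then exactly one neighbour is near. -/
theorem existsUnique_adj_near {m j : ℕ} (hg : ((2 * m : ℕ) : ℕ∞) ≤ G.egirth) (hj : j + 1 < m)
    {u x : V} (hu : G.Near (j + 1) u x) (hu' : ∀ j', j = j' + 1 → ¬ G.Near j' u x) :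
    ∃! v, G.Adj u v ∧ G.Near j v x := by
  obtain ⟨i, l, h1, h2⟩ := hu
  -- The hypothesis `hu'` excludes nearness at level `j - 1` and is vacuous for `j = 0`; hence the
  -- distance is exactly `j + 1`.
  have hl : l = 0 := by
    rcases Nat.eq_zero_or_pos l with h | h
    · exact h
    · exfalso
      rcases j with _ | j'
      · omega
      · exact hu' j' rfl ⟨i, l - 1, by omega, h2⟩
  have hi : i = j + 1 := by omega
  subst hi
  obtain ⟨v, hv, hvx⟩ := exists_adj_edist_eq h2
  refine ⟨v, ⟨hv, j, 0, by omega, hvx⟩, ?_⟩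
  rintro w ⟨hw, a, b, hab, hwx⟩
  rcases edist_adj_cases hg hw (by omega) h2 with h3 | ⟨c, hc, h3⟩
  · rw [hwx] at h3
    have : a = j + 1 + 1 := by exact_mod_cast h3
    omega
  · have : c = j := by omega
    subst this
    exact eq_of_adj_of_edist_eq hg hw hv hj h2 h3 hvx

end SimpleGraph

/-! ### The recursive polynomials and the adjacency matrix -/

/-- The polynomials `G₀ = 1`, `G₁ = x`, `Gⱼ₊₂ = x Gⱼ₊₁ - q Gⱼ`, evaluated in a ring. -/
def kgPoly {R : Type*} [Ring R] (q : ℕ) (x : R) : ℕ → R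
  | 0 => 1
  | 1 => x
  | (j + 2) => x * kgPoly q x (j + 1) - (q : R) * kgPoly q x j

section kgPoly

variable {R S : Type*} [Ring R] [Ring S] (q : ℕ)

@[simp] theorem kgPoly_zero (x : R) : kgPoly q x 0 = 1 := rfl

@[simp] theorem kgPoly_one (x : R) : kgPoly q x 1 = x := rfl

theorem kgPoly_add_two (x : R) (j : ℕ) :
    kgPoly q x (j + 2) = x * kgPoly q x (j + 1) - (q : R) * kgPoly q x j := rfl

/-- Two-step induction with both hypotheses available. -/
theorem kgPoly_induction {P : ℕ → Prop} (h0 : P 0) (h1 : P 1)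
    (h2 : ∀ j, P j → P (j + 1) → P (j + 2)) (j : ℕ) : P j := by
  have : P j ∧ P (j + 1) := by
    induction j with
    | zero => exact ⟨h0, h1⟩
    | succ j ih => exact ⟨ih.2, h2 j ih.1 ih.2⟩
  exact this.1

theorem map_kgPoly (f : R →+* S) (x : R) (j : ℕ) : f (kgPoly q x j) = kgPoly q (f x) j := by
  induction j using kgPoly_induction with
  | h0 => simp
  | h1 => simp
  | h2 j h h' => simp [kgPoly_add_two, h, h']

theorem commute_kgPoly {x y : R} (h : Commute y x) (j : ℕ) : Commute y (kgPoly q x j) := by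
  induction j using kgPoly_induction with
  | h0 => exact Commute.one_right y
  | h1 => exact h
  | h2 j h1 h2 =>
    exact (h.mul_right h2).sub_right ((Nat.cast_commute q y).symm.mul_right h1)

end kgPoly

namespace SimpleGraph

open Matrix

variable {V : Type*} [Fintype V] [DecidableEq V] {G : SimpleGraph V} [DecidableRel G.Adj]

theorem natCast_mul_apply_entry {R : Type*} [Ring R] (q : ℕ) (M : Matrix V V R) (u x : V) :
    ((q : Matrix V V R) * M) u x = (q : R) * M u x := by
  rw [← Matrix.diagonal_natCast' q, diagonal_mul]; rfl

-- In the recurrence, count the neighbours of `u` that are near `x` at level `j + 1`. If `u` is near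
-- `x` at level `j`, all `q + 1` of them are, and subtracting `q` leaves 1. If the distance is
-- exactly `j + 2` there is one, and otherwise none.
open Classical in
theorem kgPoly_adjMatrix_apply {m q : ℕ} (hg : ((2 * m : ℕ) : ℕ∞) ≤ G.egirth)
    (hd : G.IsRegularOfDegree (q + 1)) (j : ℕ) (hj : j < m) :
    ∀ u x : V, kgPoly q (G.adjMatrix ℤ) j u x = if G.Near j u x then 1 else 0 := by
  induction j using kgPoly_induction with
  | h0 =>
    intro u x
    rw [kgPoly_zero, Matrix.one_apply]
    simp only [near_zero_iff]
  | h1 =>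
    intro u x
    rw [kgPoly_one, adjMatrix_apply]
    simp only [near_one_iff]
  | h2 j h h' =>
    intro u x
    have e1 : kgPoly q (G.adjMatrix ℤ) (j + 2) u x =
        (((G.neighborFinset u).filter fun v => G.Near (j + 1) v x).card : ℤ) -
          q * (if G.Near j u x then 1 else 0) := by
      rw [kgPoly_add_two, Matrix.sub_apply, adjMatrix_mul_apply, natCast_mul_apply_entry,
        h (by omega) u x, Finset.card_filter]
      push_cast
      congr 1
      exact Finset.sum_congr rfl fun v _ => h' (by omega) v x
    rw [e1]
    by_cases hn : G.Near j u x
    · have hall : (G.neighborFinset u).filter (fun v => G.Near (j + 1) v x) =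
          G.neighborFinset u := by
        rw [Finset.filter_eq_self]
        intro v hv
        rw [mem_neighborFinset] at hv
        exact near_succ_of_near_pred hg (by omega) hv hn
      rw [hall, card_neighborFinset_eq_degree, hd u, if_pos hn, if_pos hn.add_two]
      push_cast; ring
    · rw [if_neg hn]
      by_cases hn2 : G.Near (j + 2) u x
      · rw [if_pos hn2]
        obtain ⟨v, ⟨hv, hvx⟩, huniq⟩ := existsUnique_adj_near hg (j := j + 1) (by omega) hn2
          (by rintro j' hj'; obtain rfl : j = j' := by omega
              exact hn)
        have : (G.neighborFinset u).filter (fun v => G.Near (j + 1) v x) = {v} := by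
          ext w
          rw [Finset.mem_filter, mem_neighborFinset, Finset.mem_singleton]
          constructor
          · exact fun hw => huniq w hw
          · rintro rfl; exact ⟨hv, hvx⟩
        rw [this]; simp
      · rw [if_neg hn2]
        have : (G.neighborFinset u).filter (fun v => G.Near (j + 1) v x) = ∅ := by
          rw [Finset.filter_eq_empty_iff]
          intro v hv hvx
          rw [mem_neighborFinset] at hv
          exact hn2 (near_succ_of_adj_of_near hg (by omega) hv hvx)
        rw [this]; simp

/-- The row sums of `Gⱼ(A)`. -/
theorem kgPoly_adjMatrix_mulVec_one {q : ℕ} (hd : G.IsRegularOfDegree (q + 1)) (j : ℕ) :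
    kgPoly q (G.adjMatrix ℤ) j *ᵥ (fun _ => 1) =
      fun _ => ((∑ i ∈ Finset.range (j + 1), q ^ i : ℕ) : ℤ) := by
  have hA : ∀ c : ℤ, G.adjMatrix ℤ *ᵥ (fun _ => c) = fun _ => ((q : ℤ) + 1) * c := by
    intro c
    funext u
    rw [adjMatrix_mulVec_apply]
    simp [hd u]
  induction j using kgPoly_induction with
  | h0 => funext u; simp
  | h1 =>
    rw [kgPoly_one, hA]
    funext u
    simp [Finset.sum_range_succ]; ring
  | h2 j h h' =>
    rw [kgPoly_add_two, sub_mulVec, ← mulVec_mulVec, h', hA, ← mulVec_mulVec, h]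
    funext u
    have : ((q : Matrix V V ℤ) *ᵥ fun _ => ((∑ i ∈ Finset.range (j + 1), q ^ i : ℕ) : ℤ)) u =
        q * ((∑ i ∈ Finset.range (j + 1), q ^ i : ℕ) : ℤ) := by
      rw [← Matrix.diagonal_natCast' q, mulVec_diagonal]; rfl
    rw [Pi.sub_apply, this]
    have e : ∑ i ∈ Finset.range (j + 1 + 1), q ^ i = 1 + q * ∑ i ∈ Finset.range (j + 1), q ^ i := by
      rw [Finset.sum_range_succ', Finset.mul_sum]
      simp only [pow_succ']
      ring
    have e' : ∑ i ∈ Finset.range (j + 2 + 1), q ^ i =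
        1 + q * ∑ i ∈ Finset.range (j + 1 + 1), q ^ i := by
      rw [Finset.sum_range_succ', Finset.mul_sum]
      simp only [pow_succ']
      ring
    rw [e', e]
    push_cast
    ring

open Classical in
/-- Each vertex is near to exactly `1 + q + ⋯ + q ^ j` vertices. -/
theorem card_near {m q : ℕ} (hg : ((2 * m : ℕ) : ℕ∞) ≤ G.egirth)
    (hd : G.IsRegularOfDegree (q + 1)) (j : ℕ) (hj : j < m) (u : V) :
    (Finset.univ.filter fun x => G.Near j u x).card = ∑ i ∈ Finset.range (j + 1), q ^ i := by
  have h := congrFun (kgPoly_adjMatrix_mulVec_one hd j) u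
  simp only [mulVec, dotProduct, mul_one, kgPoly_adjMatrix_apply hg hd j hj] at h
  rw [Finset.card_filter]
  exact_mod_cast h

open Classical in
/-- Nearness commutes with adjacency. -/
theorem card_adj_near_comm {m q : ℕ} (hg : ((2 * m : ℕ) : ℕ∞) ≤ G.egirth)
    (hd : G.IsRegularOfDegree (q + 1)) (j : ℕ) (hj : j < m) (u x : V) :
    ((G.neighborFinset u).filter fun v => G.Near j v x).card =
      ((G.neighborFinset x).filter fun y => G.Near j u y).card := by
  have h := congrFun (congrFun
    (commute_kgPoly q (Commute.refl (G.adjMatrix ℤ)) j).eq u) x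
  rw [adjMatrix_mul_apply, mul_adjMatrix_apply] at h
  simp only [kgPoly_adjMatrix_apply hg hd j hj] at h
  rw [Finset.card_filter, Finset.card_filter]
  exact_mod_cast h

end SimpleGraph

/-! ### Graphs of small excess are bipartite -/

namespace SimpleGraph

section NearRel

open Classical Finset

variable {V : Type*} [Fintype V] {G : SimpleGraph V} [DecidableRel G.Adj]

/-- The combinatorial properties of the relation "`c u x` if `x` is at distance at most `m - 1` and
congruent to `m - 1` modulo `2` from `u`" in a `k`-regular graph of girth at least `2 m ≥ 6`, where
`e` is the excess. -/
structure IsNearRel (G : SimpleGraph V) [DecidableRel G.Adj] (c : V → V → Prop) (k e : ℕ) :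
    Prop where
  degree_eq : ∀ u, (G.neighborFinset u).card = k
  symm : ∀ u x, c u x → c x u
  comm : ∀ u x, ((G.neighborFinset u).filter fun v => c v x).card =
    ((G.neighborFinset x).filter fun y => c u y).card
  disj : ∀ u v x, G.Adj u v → c u x → ¬ c v x
  triangle : ∀ u v w, G.Adj u v → G.Adj v w → ¬ G.Adj u w
  square : ∀ u w v v', G.Adj u v → G.Adj u v' → G.Adj w v → G.Adj w v' → v ≠ v' → u = w
  card_far : ∀ u v, G.Adj u v → (univ.filter fun x => ¬ c u x ∧ ¬ c v x).card = e

namespace IsNearRel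

variable {c : V → V → Prop} {k e : ℕ}

theorem disj' (h : G.IsNearRel c k e) {u v x : V} (huv : G.Adj u v) (hu : c x u) : ¬ c x v :=
  fun hv => h.disj u v x huv (h.symm _ _ hu) (h.symm _ _ hv)

/-- By `comm`, `u` has as many neighbours related to `w` as `w` has neighbours related to `u`. This
is the exchange that drives all the counts below. -/
theorem card_filter_not (h : G.IsNearRel c k e) (u w : V) :
    ((G.neighborFinset w).filter fun y => ¬ c u y).card +
      ((G.neighborFinset u).filter fun v => c v w).card = k := by
  rw [h.comm, add_comm, card_filter_add_card_filter_not, h.degree_eq]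

theorem card_add_card_le (h : G.IsNearRel c k e) (u : V) {w y : V} (hwy : G.Adj w y) :
    ((G.neighborFinset u).filter fun v => c v w).card +
      ((G.neighborFinset u).filter fun v => c v y).card ≤ k := by
  rw [← card_union_of_disjoint, ← h.degree_eq u]
  · exact card_le_card (union_subset (filter_subset _ _) (filter_subset _ _))
  · rw [disjoint_filter]
    intro v _ h1 h2
    exact h.disj' hwy h1 h2

/-- No neighbour of `y` is related to `v`, because `y` is. So these neighbours of `y` belong to the
set counted by `card_far`, of size `e` when `uv` is an edge. -/
theorem filter_not_subset (h : G.IsNearRel c k e) {u v y : V} (hvy : c v y) :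
    ((G.neighborFinset y).filter fun z => ¬ c u z) ⊆
      univ.filter fun x => ¬ c u x ∧ ¬ c v x := by
  intro z hz
  rw [mem_filter, mem_neighborFinset] at hz
  rw [mem_filter]
  exact ⟨mem_univ _, hz.2, h.disj' hz.1 hvy⟩

/-- Let `d(w)` and `d(y)` count the neighbours of `w` and of `y` unrelated to `u`. By
`card_filter_not` and `card_add_card_le`, `d(w) + d(y) ≥ k`. The `d(y)` neighbours of `y` lie in the
far set `X` of the edge `u v₂`; each of the other `d(w) - 1` neighbours of `w`, unrelated to `u`,
yields a further element of `X`, itself or one of its neighbours. All are distinct, so `k - 1 ≤ e`.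
-/
theorem not_both_of_excess_le (h : G.IsNearRel c k e) (he : e + 2 ≤ k) {u w y v₁ v₂ : V}
    (hwy : G.Adj w y) (h₁ : G.Adj u v₁) (h₁w : c v₁ w) (h₂ : G.Adj u v₂) (h₂y : c v₂ y) :
    False := by
  set X := univ.filter fun x => ¬ c u x ∧ ¬ c v₂ x with hX
  have hXc : X.card = e := h.card_far u v₂ h₂
  have huy : ¬ c u y := h.disj _ _ _ h₂.symm h₂y
  have hw1 := h.card_filter_not u w
  have hy1 := h.card_filter_not u y
  have hw2 := card_le_card (h.filter_not_subset (u := u) h₁w)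
  rw [h.card_far u v₁ h₁] at hw2
  have hwy2 := h.card_add_card_le u hwy
  have hymem : y ∈ (G.neighborFinset w).filter fun z => ¬ c u z := by
    rw [mem_filter, mem_neighborFinset]; exact ⟨hwy, huy⟩
  have hf : ∀ y' ∈ ((G.neighborFinset w).filter fun z => ¬ c u z).erase y,
      ∃ z ∈ X, z = y' ∨ (G.Adj y' z ∧ z ≠ w) := by
    intro y' hy'
    rw [mem_erase, mem_filter, mem_neighborFinset] at hy'
    obtain ⟨_, hwy', huy'⟩ := hy'
    by_cases hc : c v₂ y'
    · have hy3 := h.card_filter_not u y'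
      have hy4 := h.card_add_card_le u hwy'
      -- At least `k - d(w) ≥ k - e ≥ 2` neighbours of `y'` are unrelated to `u`, so one of them is
      -- not `w`.
      have hlt : 1 < ((G.neighborFinset y').filter fun z => ¬ c u z).card := by omega
      obtain ⟨z, hz, hzw⟩ := exists_mem_ne hlt w
      refine ⟨z, h.filter_not_subset hc hz, Or.inr ⟨?_, hzw⟩⟩
      rw [mem_filter, mem_neighborFinset] at hz
      exact hz.1
    · exact ⟨y', by rw [hX, mem_filter]; exact ⟨mem_univ _, huy', hc⟩, Or.inl rfl⟩
  choose! f hfX hf' using hf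
  -- A coincidence of two values would create a triangle or a 4-cycle through `w`.
  have hinj : Set.InjOn f (((G.neighborFinset w).filter fun z => ¬ c u z).erase y) := by
    intro a ha b hb hab
    have ha' := hf' a ha
    have hb' := hf' b hb
    rw [← hab] at hb'
    have hwa : G.Adj w a := by
      have := ha
      rw [mem_coe, mem_erase, mem_filter, mem_neighborFinset] at this
      exact this.2.1
    have hwb : G.Adj w b := by
      have := hb
      rw [mem_coe, mem_erase, mem_filter, mem_neighborFinset] at this
      exact this.2.1
    by_contra hne
    rcases ha' with ha1 | ⟨ha1, ha2⟩ <;> rcases hb' with hb1 | ⟨hb1, hb2⟩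
    · exact hne (ha1.symm.trans hb1)
    · rw [ha1] at hb1
      exact h.triangle w b a hwb hb1 hwa
    · rw [hb1] at ha1
      exact h.triangle w a b hwa ha1 hwb
    · exact ha2 (h.square w (f a) a b hwa hwb ha1.symm hb1.symm hne).symm
  have hdis : Disjoint ((((G.neighborFinset w).filter fun z => ¬ c u z).erase y).image f)
      ((G.neighborFinset y).filter fun z => ¬ c u z) := by
    rw [Finset.disjoint_left]
    intro z hz hz'
    rw [mem_image] at hz
    obtain ⟨a, ha, rfl⟩ := hz
    rw [mem_filter, mem_neighborFinset] at hz'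
    have ha' := hf' a ha
    rw [mem_erase, mem_filter, mem_neighborFinset] at ha
    rcases ha' with ha1 | ⟨ha1, ha2⟩
    · rw [ha1] at hz'
      exact h.triangle w y a hwy hz'.1 ha.2.1
    · exact ha2 (h.square w (f a) a y ha.2.1 hwy ha1.symm hz'.1.symm ha.1).symm
  have hsub : ((((G.neighborFinset w).filter fun z => ¬ c u z).erase y).image f) ∪
      ((G.neighborFinset y).filter fun z => ¬ c u z) ⊆ X := by
    apply union_subset
    · intro z hz
      rw [mem_image] at hz
      obtain ⟨a, ha, rfl⟩ := hz
      exact hfX a ha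
    · exact h.filter_not_subset h₂y
  have hcard := card_le_card hsub
  rw [card_union_of_disjoint hdis, card_image_of_injOn hinj, card_erase_of_mem hymem, hXc] at hcard
  omega

/-- The two neighbours of `b` unrelated to `u` fill the whole far set of the edge `uv`, so every far
vertex is adjacent to `b`. Let `d₀` be the neighbour of `d` related to `u`. To avoid a triangle or a
4-cycle with `b`, at least two neighbours of `d` and at least two of `d₀` are related to `v`; as `d`
and `d₀` are adjacent, this exceeds the degree 3. -/
theorem not_both_one_of_cubic (h : G.IsNearRel c 3 2) {u b d v : V} (hbd : G.Adj b d)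
    (hv : (G.neighborFinset u).filter (fun v => c v b) = {v})
    (hd : ((G.neighborFinset u).filter fun v => c v d).card = 1) : False := by
  have hvm : v ∈ (G.neighborFinset u).filter (fun v => c v b) := by rw [hv]; simp
  rw [mem_filter, mem_neighborFinset] at hvm
  obtain ⟨huv, hvb⟩ := hvm
  have hub : ¬ c u b := h.disj _ _ _ huv.symm hvb
  have hb1 := h.card_filter_not u b
  have hd1 := h.card_filter_not u d
  rw [hv, card_singleton] at hb1
  have hX : ((G.neighborFinset b).filter fun z => ¬ c u z) =
      univ.filter fun x => ¬ c u x ∧ ¬ c v x := by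
    apply eq_of_subset_of_card_le (h.filter_not_subset hvb)
    rw [h.card_far u v huv]; omega
  have hadj : ∀ p, ¬ c u p → ¬ c v p → G.Adj b p := by
    intro p h1 h2
    have : p ∈ univ.filter fun x => ¬ c u x ∧ ¬ c v x := by
      rw [mem_filter]; exact ⟨mem_univ _, h1, h2⟩
    rw [← hX, mem_filter, mem_neighborFinset] at this
    exact this.1
  have hc := h.comm u d
  rw [hd] at hc
  obtain ⟨d₀, hd₀⟩ := card_eq_one.1 hc.symm
  have hd₀m : d₀ ∈ (G.neighborFinset d).filter (fun y => c u y) := by rw [hd₀]; simp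
  rw [mem_filter, mem_neighborFinset] at hd₀m
  obtain ⟨hdd₀, hud₀⟩ := hd₀m
  have h2 : 2 ≤ ((G.neighborFinset v).filter fun t => c t d).card := by
    rw [h.comm]
    have : ((G.neighborFinset d).filter fun z => ¬ c u z) ⊆
        (G.neighborFinset d).filter fun y => c v y := by
      intro p hp
      rw [mem_filter, mem_neighborFinset] at hp ⊢
      refine ⟨hp.1, ?_⟩
      by_contra hvp
      exact h.triangle b d p hbd hp.1 (hadj p hp.2 hvp)
    have := card_le_card this
    omega
  have h3 : 2 ≤ ((G.neighborFinset v).filter fun t => c t d₀).card := by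
    rw [h.comm]
    have : (G.neighborFinset d₀).erase d ⊆ (G.neighborFinset d₀).filter fun y => c v y := by
      intro p hp
      rw [mem_erase, mem_neighborFinset] at hp
      rw [mem_filter, mem_neighborFinset]
      refine ⟨hp.2, ?_⟩
      by_contra hvp
      have hup : ¬ c u p := h.disj' hp.2 hud₀
      have := h.square b d₀ p d (hadj p hup hvp) hbd hp.2 hdd₀.symm hp.1
      rw [this] at hub
      exact hub hud₀
    have h4 := card_le_card this
    rw [card_erase_of_mem (by rw [mem_neighborFinset]; exact hdd₀.symm), h.degree_eq] at h4
    omega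
  have := h.card_add_card_le v hdd₀
  omega

/-- With `v` the only neighbour of `u` related to `b`, the far set of `uv` is `{a, d}`, the
neighbours of `b` unrelated to `u`. The number of neighbours of `u` related to `d` is 0, 1 or 2, and
each value is impossible. -/
theorem not_one_two_of_cubic (h : G.IsNearRel c 3 2) {u b a : V} (hba : G.Adj b a)
    (hb : ((G.neighborFinset u).filter fun v => c v b).card = 1)
    (ha : ((G.neighborFinset u).filter fun v => c v a).card = 2) : False := by
  obtain ⟨v, hv⟩ := card_eq_one.1 hb
  have hvm : v ∈ (G.neighborFinset u).filter (fun v => c v b) := by rw [hv]; simp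
  rw [mem_filter, mem_neighborFinset] at hvm
  obtain ⟨huv, hvb⟩ := hvm
  have hub : ¬ c u b := h.disj _ _ _ huv.symm hvb
  have hb1 := h.card_filter_not u b
  have ha1 := h.card_filter_not u a
  have hX : ((G.neighborFinset b).filter fun z => ¬ c u z) =
      univ.filter fun x => ¬ c u x ∧ ¬ c v x := by
    apply eq_of_subset_of_card_le (h.filter_not_subset hvb)
    rw [h.card_far u v huv]; omega
  have hua : ¬ c u a := by
    obtain ⟨x, hx⟩ : ((G.neighborFinset u).filter fun v => c v a).Nonempty := by
      rw [← card_pos]; omega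
    rw [mem_filter, mem_neighborFinset] at hx
    exact h.disj _ _ _ hx.1.symm hx.2
  have hlt : 1 < ((G.neighborFinset b).filter fun z => ¬ c u z).card := by omega
  obtain ⟨d, hd, hda⟩ := exists_mem_ne hlt a
  have hNb : ((G.neighborFinset b).filter fun z => ¬ c u z) = {a, d} := by
    symm
    apply eq_of_subset_of_card_le
    · intro x hx
      rw [mem_insert, mem_singleton] at hx
      rcases hx with rfl | rfl
      · rw [mem_filter, mem_neighborFinset]; exact ⟨hba, hua⟩
      · exact hd
    · rw [card_pair hda.symm]; omega
  rw [mem_filter, mem_neighborFinset] at hd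
  obtain ⟨hbd, hud⟩ := hd
  have hbd1 := h.card_add_card_le u hbd
  have hd1 := h.card_filter_not u d
  have hJ : ∀ x, G.Adj b x → ((G.neighborFinset u).filter fun v => c v x) ⊆
      (G.neighborFinset u).erase v := by
    intro x hx t ht
    rw [mem_filter] at ht
    rw [mem_erase]
    refine ⟨?_, ht.1⟩
    rintro rfl
    exact h.disj' hx hvb ht.2
  have hJe : ((G.neighborFinset u).erase v).card = 2 := by
    rw [card_erase_of_mem (by rw [mem_neighborFinset]; exact huv), h.degree_eq]
  have hJa : ((G.neighborFinset u).filter fun v => c v a) = (G.neighborFinset u).erase v :=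
    eq_of_subset_of_card_le (hJ a hba) (by omega)
  have hXb : ∀ t, G.Adj u t → t ≠ v → ¬ c t b := by
    intro t ht htv hc
    have : t ∈ (G.neighborFinset u).filter (fun v => c v b) := by
      rw [mem_filter, mem_neighborFinset]; exact ⟨ht, hc⟩
    rw [hv, mem_singleton] at this
    exact htv this
  rcases (by omega : ((G.neighborFinset u).filter fun v => c v d).card = 0 ∨
      ((G.neighborFinset u).filter fun v => c v d).card = 1 ∨
      ((G.neighborFinset u).filter fun v => c v d).card = 2) with h0 | h0 | h0
  -- Value 0: another neighbour `t` of `d` is far from some edge `us`. If `s = v`, then `t` is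
  -- adjacent to `b`, making a triangle; otherwise the far set of `us` is `{b, d}`, which does not
  -- contain `t`.
  · have hdt : ∀ t, G.Adj u t → ¬ c t d := by
      intro t ht hc
      rw [card_eq_zero] at h0
      have : t ∈ (G.neighborFinset u).filter (fun v => c v d) := by
        rw [mem_filter, mem_neighborFinset]; exact ⟨ht, hc⟩
      rw [h0] at this
      exact absurd this (notMem_empty t)
    have hlt : 1 < ((G.neighborFinset d).filter fun z => ¬ c u z).card := by omega
    obtain ⟨t, ht, htb⟩ := exists_mem_ne hlt b
    rw [mem_filter, mem_neighborFinset] at ht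
    have ht1 := h.card_filter_not u t
    have ht2 : 0 < ((G.neighborFinset t).filter fun z => ¬ c u z).card := by
      rw [card_pos]
      exact ⟨d, by rw [mem_filter, mem_neighborFinset]; exact ⟨ht.1.symm, hud⟩⟩
    have : ∃ s ∈ G.neighborFinset u, ¬ c s t := by
      by_contra hcon
      push Not at hcon
      rw [filter_true_of_mem hcon, h.degree_eq] at ht1
      omega
    obtain ⟨s, hs, hst⟩ := this
    rw [mem_neighborFinset] at hs
    by_cases hsv : s = v
    · subst hsv
      have : t ∈ univ.filter fun x => ¬ c u x ∧ ¬ c s x := by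
        rw [mem_filter]; exact ⟨mem_univ _, ht.2, hst⟩
      rw [← hX, mem_filter, mem_neighborFinset] at this
      exact h.triangle b d t hbd ht.1 this.1
    · have hXs : ({b, d} : Finset V) = univ.filter fun x => ¬ c u x ∧ ¬ c s x := by
        apply eq_of_subset_of_card_le
        · intro x hx
          rw [mem_insert, mem_singleton] at hx
          rw [mem_filter]
          rcases hx with rfl | rfl
          · exact ⟨mem_univ _, hub, hXb s hs hsv⟩
          · exact ⟨mem_univ _, hud, hdt s hs⟩
        · rw [h.card_far u s hs, card_pair hbd.ne]
      have : t ∈ univ.filter fun x => ¬ c u x ∧ ¬ c s x := by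
        rw [mem_filter]; exact ⟨mem_univ _, ht.2, hst⟩
      rw [← hXs, mem_insert, mem_singleton] at this
      rcases this with h1 | h1
      · exact htb h1
      · exact ht.1.ne h1.symm
  · exact h.not_both_one_of_cubic hbd hv h0
  -- Value 2: for `v₁ ≠ v` next to `u`, take `z ≠ b` far from `u v₁` and a neighbour `t` of `z`
  -- unrelated to `u`. Then `t` is adjacent to `b`, so only one neighbour of `t` may be unrelated to
  -- `u`, but both `b` and `z` are.
  · have hJd : ((G.neighborFinset u).filter fun v => c v d) = (G.neighborFinset u).erase v :=
      eq_of_subset_of_card_le (hJ d hbd) (by omega)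
    obtain ⟨v₁, hv₁⟩ : ((G.neighborFinset u).erase v).Nonempty := by
      rw [← card_pos]; omega
    have hv₁' := hv₁
    rw [mem_erase, mem_neighborFinset] at hv₁'
    have hall : ∀ x, G.Adj b x → ¬ c u x →
        c v₁ x ∧ ((G.neighborFinset u).filter fun v => c v x).card = 2 := by
      intro x hx hx'
      have : x ∈ (G.neighborFinset b).filter fun z => ¬ c u z := by
        rw [mem_filter, mem_neighborFinset]; exact ⟨hx, hx'⟩
      rw [hNb, mem_insert, mem_singleton] at this
      rcases this with rfl | rfl
      · rw [← hJa, mem_filter] at hv₁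
        exact ⟨hv₁.2, ha⟩
      · rw [← hJd, mem_filter] at hv₁
        exact ⟨hv₁.2, h0⟩
    have hlt : 1 < (univ.filter fun x => ¬ c u x ∧ ¬ c v₁ x).card := by
      rw [h.card_far u v₁ hv₁'.2]; omega
    obtain ⟨z, hz, hzb⟩ := exists_mem_ne hlt b
    rw [mem_filter] at hz
    have hz1 := h.card_filter_not u z
    have hz2 : ((G.neighborFinset u).filter fun v => c v z).card < 3 := by
      rw [← h.degree_eq u]
      apply card_lt_card
      rw [ssubset_iff_of_subset (filter_subset _ _)]
      exact ⟨v₁, by rw [mem_neighborFinset]; exact hv₁'.2, by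
        rw [mem_filter]; exact fun hh => hz.2.2 hh.2⟩
    obtain ⟨t, ht⟩ : ((G.neighborFinset z).filter fun y => ¬ c u y).Nonempty := by
      rw [← card_pos]; omega
    rw [mem_filter, mem_neighborFinset] at ht
    have hbz : ¬ G.Adj b z := fun hbz => hz.2.2 (hall z hbz hz.2.1).1
    have hvz : c v z := by
      by_contra hvz
      have : z ∈ univ.filter fun x => ¬ c u x ∧ ¬ c v x := by
        rw [mem_filter]; exact ⟨mem_univ _, hz.2.1, hvz⟩
      rw [← hX, mem_filter, mem_neighborFinset] at this
      exact hbz this.1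
    have hbt : G.Adj b t := by
      have : t ∈ univ.filter fun x => ¬ c u x ∧ ¬ c v x := by
        rw [mem_filter]; exact ⟨mem_univ _, ht.2, h.disj' ht.1 hvz⟩
      rw [← hX, mem_filter, mem_neighborFinset] at this
      exact this.1
    have ht1 := h.card_filter_not u t
    rw [(hall t hbt ht.2).2] at ht1
    have : ({b, z} : Finset V) ⊆ (G.neighborFinset t).filter fun y => ¬ c u y := by
      intro x hx
      rw [mem_insert, mem_singleton] at hx
      rw [mem_filter, mem_neighborFinset]
      rcases hx with rfl | rfl
      · exact ⟨hbt.symm, hub⟩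
      · exact ⟨ht.1.symm, hz.2.1⟩
    have := card_le_card this
    rw [card_pair hzb.symm] at this
    omega

theorem not_both_of_cubic (h : G.IsNearRel c 3 2) {u w y v₁ v₂ : V} (hwy : G.Adj w y)
    (h₁ : G.Adj u v₁) (h₁w : c v₁ w) (h₂ : G.Adj u v₂) (h₂y : c v₂ y) : False := by
  have hw : 0 < ((G.neighborFinset u).filter fun v => c v w).card := by
    rw [card_pos]
    exact ⟨v₁, by rw [mem_filter, mem_neighborFinset]; exact ⟨h₁, h₁w⟩⟩
  have hy : 0 < ((G.neighborFinset u).filter fun v => c v y).card := by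
    rw [card_pos]
    exact ⟨v₂, by rw [mem_filter, mem_neighborFinset]; exact ⟨h₂, h₂y⟩⟩
  have hwy2 := h.card_add_card_le u hwy
  rcases (by omega : ((G.neighborFinset u).filter fun v => c v w).card = 1 ∨
      ((G.neighborFinset u).filter fun v => c v y).card = 1) with hw1 | hy1
  · rcases (by omega : ((G.neighborFinset u).filter fun v => c v y).card = 1 ∨
      ((G.neighborFinset u).filter fun v => c v y).card = 2) with hy1 | hy2
    · obtain ⟨v, hv⟩ := card_eq_one.1 hw1
      exact h.not_both_one_of_cubic hwy hv hy1
    · exact h.not_one_two_of_cubic hwy hw1 hy2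
  · rcases (by omega : ((G.neighborFinset u).filter fun v => c v w).card = 1 ∨
      ((G.neighborFinset u).filter fun v => c v w).card = 2) with hw1 | hw2
    · obtain ⟨v, hv⟩ := card_eq_one.1 hw1
      exact h.not_both_one_of_cubic hwy hv hy1
    · exact h.not_one_two_of_cubic hwy.symm hy1 hw2

/-- The colouring by the parity of the distance to a fixed vertex is proper. -/
theorem exists_sign (h : G.IsNearRel c k e) (he : e + 2 ≤ k ∨ (k = 3 ∧ e = 2)) :
    ∃ χ : V → ℤ, (∀ x, χ x = 1 ∨ χ x = -1) ∧ ∀ x y, G.Adj x y → χ y = -χ x := by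
  have hek : e < k := by omega
  have hnot : ∀ u w y v₁ v₂, G.Adj w y → G.Adj u v₁ → c v₁ w → G.Adj u v₂ → c v₂ y → False := by
    intro u w y v₁ v₂ hwy h₁ h₁w h₂ h₂y
    rcases he with he | ⟨rfl, rfl⟩
    · exact h.not_both_of_excess_le he hwy h₁ h₁w h₂ h₂y
    · exact h.not_both_of_cubic hwy h₁ h₁w h₂ h₂y
  have hor : ∀ u w y, G.Adj w y → (∃ v, G.Adj u v ∧ c v w) ∨ (∃ v, G.Adj u v ∧ c v y) := by
    have key : ∀ u w y, G.Adj w y → c u w → ∃ v, G.Adj u v ∧ c v y := by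
      intro u w y hwy huw
      have : 0 < ((G.neighborFinset u).filter fun v => c v y).card := by
        rw [h.comm, card_pos]
        exact ⟨w, by rw [mem_filter, mem_neighborFinset]; exact ⟨hwy.symm, huw⟩⟩
      rw [card_pos] at this
      obtain ⟨v, hv⟩ := this
      rw [mem_filter, mem_neighborFinset] at hv
      exact ⟨v, hv⟩
    intro u w y hwy
    by_cases huw : c u w
    · exact Or.inr (key u w y hwy huw)
    by_cases huy : c u y
    · exact Or.inl (key u y w hwy.symm huy)
    -- Otherwise all `k` neighbours of `u` would be far from the edge `wy`, although only `e < k`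
    -- vertices are.
    by_contra hcon
    push Not at hcon
    have : G.neighborFinset u ⊆ univ.filter fun x => ¬ c w x ∧ ¬ c y x := by
      intro v hv
      rw [mem_neighborFinset] at hv
      rw [mem_filter]
      exact ⟨mem_univ _, fun hc => hcon.1 v hv (h.symm _ _ hc),
        fun hc => hcon.2 v hv (h.symm _ _ hc)⟩
    have := card_le_card this
    rw [h.degree_eq, h.card_far w y hwy] at this
    omega
  rcases isEmpty_or_nonempty V with hV | ⟨⟨u⟩⟩
  · exact ⟨fun _ => 1, fun x => Or.inl rfl, fun x => (hV.false x).elim⟩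
  · refine ⟨fun x => if ∃ v, G.Adj u v ∧ c v x then 1 else -1, fun x => ?_, fun x y hxy => ?_⟩
    · by_cases hx : ∃ v, G.Adj u v ∧ c v x
      · left; simp only [if_pos hx]
      · right; simp only [if_neg hx]
    · by_cases hx : ∃ v, G.Adj u v ∧ c v x
      · have hy : ¬ ∃ v, G.Adj u v ∧ c v y := by
          rintro ⟨v₂, h₂, h₂y⟩
          obtain ⟨v₁, h₁, h₁x⟩ := hx
          exact hnot u x y v₁ v₂ hxy h₁ h₁x h₂ h₂y
        simp only [if_pos hx, if_neg hy]
      · have hy := (hor u x y hxy).resolve_left hx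
        simp only [if_neg hx, if_pos hy, neg_neg]

end IsNearRel

/-- The bound `2 ≤ N`, that is girth at least 6, is what excludes triangles and 4-cycles. The near
sets of the two ends of an edge are disjoint and together account for the Moore bound, leaving `e`
vertices. -/
theorem isNearRel_near {N q e : ℕ} (hN : 2 ≤ N)
    (hg : ((2 * (N + 1) : ℕ) : ℕ∞) ≤ G.egirth) (hd : G.IsRegularOfDegree (q + 1))
    (hn : Fintype.card V = 2 * ∑ i ∈ range (N + 1), q ^ i + e) :
    G.IsNearRel (G.Near N) (q + 1) e where
  degree_eq u := by rw [card_neighborFinset_eq_degree, hd u]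
  symm u x h := h.symm
  comm u x := by
    convert card_adj_near_comm hg hd N (Nat.lt_succ_self N) u x
  disj u v x huv hu := not_near_of_adj hg (Nat.lt_succ_self N) huv hu
  triangle u v w huv hvw huw :=
    not_near_of_adj hg (j := 1) (by omega) hvw (near_one_iff.2 huv.symm) (near_one_iff.2 huw.symm)
  square u w v v' h1 h2 h3 h4 hne := by
    by_contra huw
    have h2' : G.Near 2 u w := near_succ_of_adj_of_near hg (by omega) h1 (near_one_iff.2 h3.symm)
    obtain ⟨x, -, hx⟩ := existsUnique_adj_near hg (j := 1) (by omega) h2' (by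
      rintro j' hj' hc
      obtain rfl : j' = 0 := by omega
      exact huw (near_zero_iff.1 hc))
    exact hne ((hx v ⟨h1, near_one_iff.2 h3.symm⟩).trans
      (hx v' ⟨h2, near_one_iff.2 h4.symm⟩).symm)
  card_far u v huv := by
    have h1 := card_near hg hd N (Nat.lt_succ_self N) u
    have h2 := card_near hg hd N (Nat.lt_succ_self N) v
    have h3 : (univ.filter fun x => G.Near N u x ∨ G.Near N v x).card =
        2 * ∑ i ∈ range (N + 1), q ^ i := by
      rw [filter_or, card_union_of_disjoint]
      · have e1 : (univ.filter fun x => G.Near N u x).card = ∑ i ∈ range (N + 1), q ^ i := by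
          convert h1
        have e2 : (univ.filter fun x => G.Near N v x).card = ∑ i ∈ range (N + 1), q ^ i := by
          convert h2
        rw [e1, e2]; ring
      · rw [disjoint_filter]
        intro x _ hu
        exact not_near_of_adj hg (Nat.lt_succ_self N) huv hu
    have h4 := card_filter_add_card_filter_not (s := (univ : Finset V))
      (fun x => G.Near N u x ∨ G.Near N v x)
    rw [h3, card_univ, hn] at h4
    have h5 : (univ.filter fun x => ¬ G.Near N u x ∧ ¬ G.Near N v x) =
        univ.filter fun x => ¬ (G.Near N u x ∨ G.Near N v x) := by
      ext x; simp only [mem_filter, not_or]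
    rw [h5]
    omega

end NearRel

/-! ### Parity of the order of a regular bipartite graph. -/

section Sign

variable {V : Type*} [Fintype V] {G : SimpleGraph V} [DecidableRel G.Adj]

/-- Summing `χ` over all ordered pairs of adjacent vertices gives `k ∑ χ` in one order of summation
and `-k ∑ χ` in the other. -/
theorem sum_sign_eq_zero {k : ℕ} (hk : 0 < k) (hd : G.IsRegularOfDegree k) {χ : V → ℤ}
    (hχ : ∀ x y, G.Adj x y → χ y = -χ x) : ∑ x, χ x = 0 := by
  have h1 : ∑ x, ∑ y ∈ G.neighborFinset x, χ y = -(k * ∑ x, χ x) := by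
    rw [Finset.mul_sum, ← Finset.sum_neg_distrib]
    refine Finset.sum_congr rfl fun x _ => ?_
    rw [Finset.sum_congr rfl (g := fun _ => -χ x), Finset.sum_const, card_neighborFinset_eq_degree,
      hd x]
    · simp
    · intro y hy
      rw [mem_neighborFinset] at hy
      exact hχ x y hy
  have h2 : ∑ x, ∑ y ∈ G.neighborFinset x, χ y = k * ∑ x, χ x := by
    have : ∑ x, ∑ y ∈ G.neighborFinset x, χ y = ∑ y, ∑ x ∈ G.neighborFinset y, χ y := by
      apply Finset.sum_comm'
      intro x y
      simp [adj_comm]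
    rw [this, Finset.mul_sum]
    refine Finset.sum_congr rfl fun x _ => ?_
    rw [Finset.sum_const, card_neighborFinset_eq_degree, hd x]
    simp
  have h3 : (k : ℤ) * ∑ x, χ x = 0 := by linarith
  rcases mul_eq_zero.1 h3 with h | h
  · exact absurd (by exact_mod_cast h) hk.ne'
  · exact h

theorem even_card_of_sign {k : ℕ} (hk : 0 < k) (hd : G.IsRegularOfDegree k) {χ : V → ℤ}
    (h1 : ∀ x, χ x = 1 ∨ χ x = -1) (hχ : ∀ x y, G.Adj x y → χ y = -χ x) :
    Even (Fintype.card V) := by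
  have h0 := sum_sign_eq_zero hk hd hχ
  have h2 : (2 : ℤ) ∣ ∑ x, (1 - χ x) := by
    apply Finset.dvd_sum
    intro x _
    rcases h1 x with h | h <;> rw [h] <;> norm_num
  rw [Finset.sum_sub_distrib, h0] at h2
  simp only [Finset.sum_const, Finset.card_univ, nsmul_eq_mul, mul_one, sub_zero] at h2
  rw [even_iff_two_dvd]
  exact_mod_cast h2

end Sign

end SimpleGraph

/-! ### Graphs of excess two: the antipodal map -/

namespace SimpleGraph

section Sign

variable {V : Type*} {G : SimpleGraph V}

theorem sign_mul_of_edist {χ : V → ℤ} (h1 : ∀ x, χ x = 1 ∨ χ x = -1)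
    (hχ : ∀ x y, G.Adj x y → χ y = -χ x) (i : ℕ) :
    ∀ u x, G.edist u x = i → χ u * χ x = (-1) ^ i := by
  induction i with
  | zero =>
    intro u x h
    have hux : u = x := edist_eq_zero_iff.1 (h.trans Nat.cast_zero)
    subst hux
    rcases h1 u with h | h <;> rw [h] <;> norm_num
  | succ i ih =>
    intro u x h
    obtain ⟨v, hv, hvx⟩ := exists_adj_edist_eq h
    have := ih v x hvx
    rw [hχ u v hv] at this
    rw [pow_succ]
    linarith

theorem sign_mul_of_near {χ : V → ℤ} (h1 : ∀ x, χ x = 1 ∨ χ x = -1)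
    (hχ : ∀ x y, G.Adj x y → χ y = -χ x) {j : ℕ} {u x : V} (h : G.Near j u x) :
    χ u * χ x = (-1) ^ j := by
  obtain ⟨i, l, rfl, h2⟩ := h
  rw [sign_mul_of_edist h1 hχ i u x h2, pow_add, pow_mul]
  norm_num

/-- The matrix recording the pairs of vertices whose colours differ by `N`. -/
def signMatrix (N : ℕ) (χ : V → ℤ) : Matrix V V ℤ :=
  Matrix.of fun u x => if χ u * χ x = (-1) ^ N then 1 else 0

theorem signMatrix_add_two (χ : V → ℤ) (M : ℕ) : signMatrix (M + 2) χ = signMatrix M χ := by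
  ext u x
  rw [signMatrix, signMatrix, Matrix.of_apply, Matrix.of_apply, pow_add]
  norm_num

end Sign

variable {V : Type*} [Fintype V] {G : SimpleGraph V} [DecidableRel G.Adj]

/-- A bipartite regular graph of girth at least `2 (N + 1)` in which every vertex `u` has a unique
vertex `σ u`, of the colour prescribed by `N`, at distance greater than `N`. -/
structure IsAntipodal (G : SimpleGraph V) [DecidableRel G.Adj] (N q : ℕ) (χ : V → ℤ)
    (σ : V → V) : Prop where
  girth : ((2 * (N + 1) : ℕ) : ℕ∞) ≤ G.egirth
  regular : G.IsRegularOfDegree (q + 1)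
  sign : ∀ x, χ x = 1 ∨ χ x = -1
  sign_adj : ∀ x y, G.Adj x y → χ y = -χ x
  eq_iff : ∀ u x, x = σ u ↔ χ u * χ x = (-1) ^ N ∧ ¬ G.Near N u x

-- Both colour classes have `n / 2` vertices, one more than the number of vertices near `u` at level
-- `N`. The latter all have the colour `χ u * (-1) ^ N`, so exactly one vertex of that colour is
-- left over.
open Classical in
theorem exists_isAntipodal {N q : ℕ} (hg : ((2 * (N + 1) : ℕ) : ℕ∞) ≤ G.egirth)
    (hd : G.IsRegularOfDegree (q + 1)) {χ : V → ℤ} (h1 : ∀ x, χ x = 1 ∨ χ x = -1)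
    (hχ : ∀ x y, G.Adj x y → χ y = -χ x)
    (hn : Fintype.card V = 2 * ∑ i ∈ Finset.range (N + 1), q ^ i + 2) :
    ∃ σ : V → V, G.IsAntipodal N q χ σ := by
  have h0 := sum_sign_eq_zero (Nat.succ_pos q) hd hχ
  have hcol : ∀ t : ℤ, (t = 1 ∨ t = -1) →
      2 * (Finset.univ.filter fun x => χ x = t).card = Fintype.card V := by
    intro t ht
    have h2 : ∀ x, (1 + t * χ x : ℤ) = if χ x = t then 2 else 0 := by
      intro x
      rcases h1 x with h | h <;> rcases ht with rfl | rfl <;> rw [h] <;> norm_num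
    have h3 : ∑ x, (1 + t * χ x : ℤ) = Fintype.card V := by
      rw [Finset.sum_add_distrib, ← Finset.mul_sum, h0]; simp
    rw [Finset.sum_congr rfl fun x _ => h2 x, ← Finset.sum_filter, Finset.sum_const] at h3
    have h4 : ((2 * (Finset.univ.filter fun x => χ x = t).card : ℕ) : ℤ) = Fintype.card V := by
      rw [← h3]; push_cast; rw [nsmul_eq_mul]; ring
    exact_mod_cast h4
  have hex : ∀ u, ∃ y, ∀ x, x = y ↔ χ u * χ x = (-1) ^ N ∧ ¬ G.Near N u x := by
    intro u
    have hu2 : χ u * χ u = 1 := by rcases h1 u with h | h <;> rw [h] <;> norm_num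
    have e1 : ∀ x, χ u * χ x = (-1) ^ N ↔ χ x = χ u * (-1) ^ N := by
      intro x
      constructor
      · intro h; rw [← h, ← mul_assoc, hu2, one_mul]
      · intro h; rw [h, ← mul_assoc, hu2, one_mul]
    have hc := hcol (χ u * (-1) ^ N) (by
      rcases h1 u with h | h <;> rcases neg_one_pow_eq_or ℤ N with h' | h' <;> rw [h, h'] <;>
        norm_num)
    have hnear := card_near hg hd N (Nat.lt_succ_self N) u
    have hsplit := Finset.card_filter_add_card_filter_not
      (s := Finset.univ.filter fun x => χ x = χ u * (-1) ^ N) (fun x => G.Near N u x)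
    rw [Finset.filter_filter, Finset.filter_filter] at hsplit
    have e2 : (Finset.univ.filter fun x => χ x = χ u * (-1) ^ N ∧ G.Near N u x) =
        Finset.univ.filter fun x => G.Near N u x := by
      ext x
      simp only [Finset.mem_filter, Finset.mem_univ, true_and, and_iff_right_iff_imp]
      intro hx
      exact (e1 x).1 (sign_mul_of_near h1 hχ hx)
    rw [e2, hnear] at hsplit
    have hone : (Finset.univ.filter fun x => χ x = χ u * (-1) ^ N ∧ ¬ G.Near N u x).card = 1 := by
      omega
    obtain ⟨y, hy⟩ := Finset.card_eq_one.1 hone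
    refine ⟨y, fun x => ?_⟩
    rw [← Finset.mem_singleton, ← hy, Finset.mem_filter, e1]
    simp
  choose σ hσ using hex
  exact ⟨σ, hg, hd, h1, hχ, hσ⟩

namespace IsAntipodal

variable {N q : ℕ} {χ : V → ℤ} {σ : V → V}

theorem involutive (h : G.IsAntipodal N q χ σ) (u : V) : σ (σ u) = u := by
  have h1 := (h.eq_iff u (σ u)).1 rfl
  symm
  rw [h.eq_iff, near_comm, mul_comm]
  exact h1

theorem eq_comm_iff (h : G.IsAntipodal N q χ σ) {u x : V} : x = σ u ↔ u = σ x := by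
  constructor
  · rintro rfl; exact (h.involutive u).symm
  · rintro rfl; exact (h.involutive x).symm

/-- Nearness at level `j` fixes the colour, so `j` has the parity of `N`; this excludes `j = N + 1`.
For `j ≤ N` of the right parity, nearness passes up to level `N`. -/
theorem not_near (h : G.IsAntipodal N q χ σ) {j : ℕ} (hj : j ≤ N + 1) (u : V) :
    ¬ G.Near j u (σ u) := by
  intro hn
  obtain ⟨h1, h2⟩ := (h.eq_iff u (σ u)).1 rfl
  rw [sign_mul_of_near h.sign h.sign_adj hn] at h1
  have hpar : Even (N - j) ∧ j ≤ N := by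
    rcases Nat.even_or_odd j with h3 | h3 <;> rcases Nat.even_or_odd N with h4 | h4 <;>
      simp only [h3.neg_one_pow, h4.neg_one_pow] at h1
    · have : j ≤ N := by
        rcases h3 with ⟨a, ha⟩; rcases h4 with ⟨b, hb⟩; omega
      exact ⟨(Nat.even_sub this).2 (by simp [h3, h4]), this⟩
    · norm_num at h1
    · norm_num at h1
    · have : j ≤ N := by
        rcases h3 with ⟨a, ha⟩; rcases h4 with ⟨b, hb⟩; omega
      refine ⟨(Nat.even_sub this).2 ?_, this⟩
      simp [← Nat.not_odd_iff_even, h3, h4]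
  obtain ⟨⟨a, ha⟩, hjN⟩ := hpar
  obtain ⟨i, l, h3, h4⟩ := hn
  exact h2 ⟨i, l + a, by omega, h4⟩

theorem near_or_eq (h : G.IsAntipodal N q χ σ) {u x : V} (hux : χ u * χ x = (-1) ^ N) :
    G.Near N u x ∨ x = σ u := by
  rw [h.eq_iff]
  by_cases hn : G.Near N u x
  · exact Or.inl hn
  · exact Or.inr ⟨hux, hn⟩

/-! ### Matrix identities for the antipodal map. -/

section Matrix

open Matrix

variable [DecidableEq V]

/-- Only `i = 0` contributes to the traces behind the multiplicity formula. For `i > 0` one factor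
`A` is absorbed by the recurrence, so that all entries are read off at levels at most `N`; the
closed walks counted by the two terms then cancel. -/
theorem mul_mul_kgPoly_apply_self (h : G.IsAntipodal N q χ σ) {i : ℕ} (hi : i < N) (u : V) :
    ((((q + 1 : ℕ) ^ 2 : ℕ) : Matrix V V ℤ) * kgPoly q (G.adjMatrix ℤ) i -
      G.adjMatrix ℤ * (G.adjMatrix ℤ * kgPoly q (G.adjMatrix ℤ) i)) u u =
      if i = 0 then ((q + 1) * q : ℤ) else 0 := by
  classical
  have hdiag : ∀ j, j ≤ N → kgPoly q (G.adjMatrix ℤ) j u u = if Even j then 1 else 0 := by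
    intro j hj
    rw [kgPoly_adjMatrix_apply h.girth h.regular j (by omega)]
    congr 1
    rw [eq_iff_iff]
    constructor
    · rintro ⟨a, l, h1, h2⟩
      rw [edist_self] at h2
      have : a = 0 := by exact_mod_cast h2.symm
      exact ⟨l, by omega⟩
    · rintro ⟨l, rfl⟩
      exact ⟨0, l, by omega, by simp⟩
  have hA : ∀ j, j ≤ N → (G.adjMatrix ℤ * kgPoly q (G.adjMatrix ℤ) j) u u =
      if Even j then 0 else (q + 1 : ℤ) := by
    intro j hj
    rw [adjMatrix_mul_apply]
    have : ∀ v ∈ G.neighborFinset u, kgPoly q (G.adjMatrix ℤ) j v u = if Even j then 0 else 1 := by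
      intro v hv
      rw [mem_neighborFinset] at hv
      rw [kgPoly_adjMatrix_apply h.girth h.regular j (by omega)]
      by_cases he : Even j
      · rw [if_pos he, if_neg]
        intro hn
        have := sign_mul_of_near h.sign h.sign_adj hn
        rw [h.sign_adj u v hv, he.neg_one_pow] at this
        rcases h.sign u with h' | h' <;> rw [h'] at this <;> norm_num at this
      · rw [if_neg he, if_pos]
        rw [Nat.not_even_iff_odd] at he
        obtain ⟨l, rfl⟩ := he
        exact ⟨1, l, by omega, by rw [edist_eq_one_iff_adj.2 hv.symm]; rfl⟩
    rw [Finset.sum_congr rfl this, Finset.sum_const, card_neighborFinset_eq_degree, h.regular u]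
    split_ifs <;> simp
  rw [Matrix.sub_apply, natCast_mul_apply_entry, hdiag i hi.le]
  rcases i with _ | i
  · rw [kgPoly_zero, mul_one]
    have := hA 1 (by omega)
    rw [kgPoly_one] at this
    rw [this]
    simp; ring
  · have e1 : G.adjMatrix ℤ * kgPoly q (G.adjMatrix ℤ) (i + 1) =
        kgPoly q (G.adjMatrix ℤ) (i + 2) + (q : Matrix V V ℤ) * kgPoly q (G.adjMatrix ℤ) i := by
      rw [kgPoly_add_two]; abel
    have e2 : G.adjMatrix ℤ * ((q : Matrix V V ℤ) * kgPoly q (G.adjMatrix ℤ) i) =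
        (q : Matrix V V ℤ) * (G.adjMatrix ℤ * kgPoly q (G.adjMatrix ℤ) i) := by
      rw [← mul_assoc, ← mul_assoc, (Nat.cast_commute q _).eq]
    rw [e1, mul_add, e2, Matrix.add_apply, natCast_mul_apply_entry, hA (i + 2) (by omega),
      hA i (by omega)]
    by_cases he : Even i
    · have h1 : ¬ Even (i + 1) := by rw [Nat.even_add_one]; exact fun h => h he
      have h2 : Even (i + 2) := by rw [Nat.even_add_one]; exact h1
      simp [he, h1, h2]
    · have h1 : Even (i + 1) := by rw [Nat.even_add_one]; exact he
      have h2 : ¬ Even (i + 2) := by rw [Nat.even_add_one]; exact fun h => h h1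
      simp [he, h1, h2]; ring

/-- The antipode is not near `u` even at level `N + 1`, so every entry involved vanishes, and the
permutation part of `1 + εP` adds nothing to the trace. -/
theorem mul_mul_kgPoly_apply_antipode (h : G.IsAntipodal N q χ σ) {i : ℕ} (hi : i < N) (u : V) :
    ((((q + 1 : ℕ) ^ 2 : ℕ) : Matrix V V ℤ) * kgPoly q (G.adjMatrix ℤ) i -
      G.adjMatrix ℤ * (G.adjMatrix ℤ * kgPoly q (G.adjMatrix ℤ) i)) u (σ u) = 0 := by
  classical
  have hdiag : ∀ j, j ≤ N → kgPoly q (G.adjMatrix ℤ) j u (σ u) = 0 := by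
    intro j hj
    rw [kgPoly_adjMatrix_apply h.girth h.regular j (by omega), if_neg (h.not_near (by omega) u)]
  have hA : ∀ j, j ≤ N → (G.adjMatrix ℤ * kgPoly q (G.adjMatrix ℤ) j) u (σ u) = 0 := by
    intro j hj
    rw [adjMatrix_mul_apply]
    apply Finset.sum_eq_zero
    intro v hv
    rw [mem_neighborFinset] at hv
    rw [kgPoly_adjMatrix_apply h.girth h.regular j (by omega), if_neg]
    intro hn
    exact h.not_near (j := j + 1) (by omega) u
      (near_succ_of_adj_of_near h.girth (by omega) hv hn)
  rw [Matrix.sub_apply, natCast_mul_apply_entry, hdiag i hi.le]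
  rcases i with _ | i
  · rw [kgPoly_zero, mul_one]
    have := hA 1 (by omega)
    rw [kgPoly_one] at this
    rw [this]
    simp
  · have e1 : G.adjMatrix ℤ * kgPoly q (G.adjMatrix ℤ) (i + 1) =
        kgPoly q (G.adjMatrix ℤ) (i + 2) + (q : Matrix V V ℤ) * kgPoly q (G.adjMatrix ℤ) i := by
      rw [kgPoly_add_two]; abel
    have e2 : G.adjMatrix ℤ * ((q : Matrix V V ℤ) * kgPoly q (G.adjMatrix ℤ) i) =
        (q : Matrix V V ℤ) * (G.adjMatrix ℤ * kgPoly q (G.adjMatrix ℤ) i) := by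
      rw [← mul_assoc, ← mul_assoc, (Nat.cast_commute q _).eq]
    rw [e1, mul_add, e2, Matrix.add_apply, natCast_mul_apply_entry, hA (i + 2) (by omega),
      hA i (by omega)]
    simp

/-- The matrix of the antipodal map. -/
def antipodeMatrix (σ : V → V) : Matrix V V ℤ :=
  Matrix.of fun u x => if x = σ u then 1 else 0

/-- The vertices near `u` at level `N` are all those of the prescribed colour except the antipode.
-/
theorem kgPoly_adjMatrix_eq (h : G.IsAntipodal N q χ σ) :
    kgPoly q (G.adjMatrix ℤ) N = signMatrix N χ - antipodeMatrix σ := by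
  classical
  ext u x
  rw [kgPoly_adjMatrix_apply h.girth h.regular N (Nat.lt_succ_self N), Matrix.sub_apply,
    signMatrix, antipodeMatrix, Matrix.of_apply, Matrix.of_apply]
  by_cases hx : x = σ u
  · obtain ⟨h1, h2⟩ := (h.eq_iff u x).1 hx
    rw [if_pos hx, if_pos h1, if_neg h2]; rfl
  · rw [if_neg hx]
    by_cases hn : G.Near N u x
    · rw [if_pos hn, if_pos (sign_mul_of_near h.sign h.sign_adj hn)]; rfl
    · rw [if_neg hn, if_neg]
      · rfl
      · intro h1
        exact hx ((h.eq_iff u x).2 ⟨h1, hn⟩)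

theorem adjMatrix_mul_signMatrix (h : G.IsAntipodal N q χ σ) (M : ℕ) :
    G.adjMatrix ℤ * signMatrix M χ = ((q + 1 : ℕ) : Matrix V V ℤ) * signMatrix (M + 1) χ := by
  ext u x
  rw [adjMatrix_mul_apply, natCast_mul_apply_entry]
  have : ∀ v ∈ G.neighborFinset u, signMatrix M χ v x = signMatrix (M + 1) χ u x := by
    intro v hv
    rw [mem_neighborFinset] at hv
    rw [signMatrix, signMatrix, Matrix.of_apply, Matrix.of_apply, h.sign_adj u v hv, pow_succ]
    congr 1
    rw [eq_iff_iff]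
    constructor <;> intro h <;> linarith
  rw [Finset.sum_congr rfl this, Finset.sum_const, card_neighborFinset_eq_degree, h.regular u,
    nsmul_eq_mul]

theorem signMatrix_mul_adjMatrix (h : G.IsAntipodal N q χ σ) (M : ℕ) :
    signMatrix M χ * G.adjMatrix ℤ = ((q + 1 : ℕ) : Matrix V V ℤ) * signMatrix (M + 1) χ := by
  ext u x
  rw [mul_adjMatrix_apply, natCast_mul_apply_entry]
  have : ∀ v ∈ G.neighborFinset x, signMatrix M χ u v = signMatrix (M + 1) χ u x := by
    intro v hv
    rw [mem_neighborFinset] at hv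
    rw [signMatrix, signMatrix, Matrix.of_apply, Matrix.of_apply, h.sign_adj x v hv, pow_succ]
    congr 1
    rw [eq_iff_iff]
    constructor <;> intro h <;> linarith
  rw [Finset.sum_congr rfl this, Finset.sum_const, card_neighborFinset_eq_degree, h.regular x,
    nsmul_eq_mul]

/-- `P` is the colour matrix minus a polynomial in `A`, and multiplying the colour matrix by `A` on
either side gives `q + 1` times the colour matrix of opposite parity. -/
theorem commute_antipodeMatrix (h : G.IsAntipodal N q χ σ) :
    Commute (G.adjMatrix ℤ) (antipodeMatrix σ) := by
  have h1 : antipodeMatrix σ = signMatrix N χ - kgPoly q (G.adjMatrix ℤ) N := by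
    rw [h.kgPoly_adjMatrix_eq, sub_sub_cancel]
  rw [h1]
  refine Commute.sub_right ?_ (commute_kgPoly q (Commute.refl _) N)
  rw [Commute, SemiconjBy, h.adjMatrix_mul_signMatrix, h.signMatrix_mul_adjMatrix]

theorem antipodeMatrix_mul_apply (σ : V → V) (M : Matrix V V ℤ) (u x : V) :
    (antipodeMatrix σ * M) u x = M (σ u) x := by
  rw [Matrix.mul_apply]
  simp only [antipodeMatrix, Matrix.of_apply, ite_mul, one_mul, zero_mul]
  simp

theorem mul_antipodeMatrix_apply (h : G.IsAntipodal N q χ σ) (M : Matrix V V ℤ) (u x : V) :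
    (M * antipodeMatrix σ) u x = M u (σ x) := by
  rw [Matrix.mul_apply]
  rw [Finset.sum_eq_single (σ x)]
  · rw [antipodeMatrix, Matrix.of_apply, if_pos (h.involutive x).symm, mul_one]
  · intro y _ hy
    rw [antipodeMatrix, Matrix.of_apply, if_neg, mul_zero]
    exact fun hxy => hy (h.eq_comm_iff.1 hxy)
  · exact fun hc => absurd (Finset.mem_univ _) hc

theorem antipodeMatrix_mul_self (h : G.IsAntipodal N q χ σ) :
    antipodeMatrix σ * antipodeMatrix σ = 1 := by
  ext u x
  rw [antipodeMatrix_mul_apply, antipodeMatrix, Matrix.of_apply, h.involutive, Matrix.one_apply]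
  simp only [eq_comm]

/-- The antipodal map is an automorphism. -/
theorem adj_antipode (h : G.IsAntipodal N q χ σ) {u v : V} (huv : G.Adj u v) :
    G.Adj (σ u) (σ v) := by
  have h1 := congrFun (congrFun h.commute_antipodeMatrix.eq (σ u)) v
  rw [antipodeMatrix_mul_apply, h.mul_antipodeMatrix_apply, h.involutive, adjMatrix_apply,
    adjMatrix_apply, if_pos huv] at h1
  by_contra hc
  rw [if_neg hc] at h1
  exact zero_ne_one h1

end Matrix

end IsAntipodal

end SimpleGraph

/-! ### Multiplicities of eigenvalues -/

section kgDiff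

variable {K S : Type*} [CommRing K] [Ring S] [Algebra K S] (q : ℕ)

/-- The difference quotient of `Gₙ` at `x` and `y`. -/
def kgDiff (y : K) (x : S) (n : ℕ) : S :=
  ∑ i ∈ Finset.range n, kgPoly q y (n - 1 - i) • kgPoly q x i

theorem kgDiff_add_two (y : K) (x : S) (n : ℕ) :
    kgDiff q y x (n + 2) =
      x * kgDiff q y x (n + 1) - (q : S) * kgDiff q y x n + kgPoly q y (n + 1) • (1 : S) := by
  rw [kgDiff, kgDiff, kgDiff, Finset.sum_range_succ' _ (n + 1), Finset.sum_range_succ' _ n,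
    Finset.sum_range_succ' _ n]
  simp only [kgPoly_zero, kgPoly_one, zero_add, Nat.sub_zero]
  have e : ∑ i ∈ Finset.range n, kgPoly q y (n + 2 - 1 - (i + 1 + 1)) • kgPoly q x (i + 1 + 1) =
      x * (∑ i ∈ Finset.range n, kgPoly q y (n + 1 - 1 - (i + 1)) • kgPoly q x (i + 1)) -
      q * ∑ i ∈ Finset.range n, kgPoly q y (n - 1 - i) • kgPoly q x i := by
    rw [Finset.mul_sum, Finset.mul_sum, ← Finset.sum_sub_distrib]
    refine Finset.sum_congr rfl fun i hi => ?_
    rw [show n + 2 - 1 - (i + 1 + 1) = n - 1 - i by omega,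
      show n + 1 - 1 - (i + 1) = n - 1 - i by omega, kgPoly_add_two, smul_sub, mul_smul_comm,
      mul_smul_comm]
  rw [e, mul_add, mul_smul_comm, mul_one]
  simp only [Nat.add_sub_cancel, show n + 2 - 1 = n + 1 by omega]
  abel

@[simp] theorem kgDiff_zero (y : K) (x : S) : kgDiff q y x 0 = 0 := by simp [kgDiff]

@[simp] theorem kgDiff_one (y : K) (x : S) : kgDiff q y x 1 = 1 := by simp [kgDiff]

theorem sub_mul_kgDiff (y : K) (x : S) (n : ℕ) :
    (x - algebraMap K S y) * kgDiff q y x n = kgPoly q x n - algebraMap K S (kgPoly q y n) := by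
  induction n using kgPoly_induction with
  | h0 => simp
  | h1 => simp
  | h2 n h h' =>
    have hc : Commute (x - algebraMap K S y) x :=
      (Commute.refl x).sub_left (Algebra.commutes y x)
    have hq : (x - algebraMap K S y) * ((q : S) * kgDiff q y x n) =
        (q : S) * ((x - algebraMap K S y) * kgDiff q y x n) := by
      rw [← mul_assoc, ← mul_assoc, (Nat.cast_commute q _).eq]
    rw [kgDiff_add_two, mul_add, mul_sub, ← mul_assoc, hc.eq, mul_assoc, h', hq, h, kgPoly_add_two,
      kgPoly_add_two, Algebra.smul_def, mul_one, map_sub, map_mul, map_mul, map_natCast]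
    have := (Algebra.commutes (kgPoly q y (n + 1)) x)
    rw [mul_sub, mul_sub, sub_mul, ← this]
    abel

/-- On the diagonal `kgDiff` is the derivative. This identity replaces it by `G_{n+1}` and `G_n`, so
that at a root of `G_N ± 1` only `G_{N-1}` remains unknown. -/
theorem sq_sub_mul_kgDiff (y : K) (n : ℕ) :
    (y ^ 2 - 4 * q) * kgDiff q y y (n + 1) =
      (n + 1) * y * kgPoly q y (n + 1) - 2 * (n + 2) * q * kgPoly q y n := by
  induction n using kgPoly_induction with
  | h0 => simp; ring
  | h1 =>
    rw [kgDiff_add_two, kgPoly_add_two]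
    simp; ring
  | h2 n h h' =>
    rw [kgDiff_add_two q y y (n + 1), smul_eq_mul]
    have e : (y ^ 2 - 4 * (q : K)) * (y * kgDiff q y y (n + 1 + 1) - q * kgDiff q y y (n + 1) +
        kgPoly q y (n + 1 + 1) * 1) = y * ((y ^ 2 - 4 * q) * kgDiff q y y (n + 1 + 1)) -
        q * ((y ^ 2 - 4 * q) * kgDiff q y y (n + 1)) + (y ^ 2 - 4 * q) * kgPoly q y (n + 2) := by
      ring
    rw [e, h, h', kgPoly_add_two q y (n + 1), kgPoly_add_two q y n]
    push_cast
    ring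

/-- The recurrence multiplies this quadratic form by `q` at each step. Where `G_N = ±1`, it shows
that `G_{N-1}` does not vanish and ties it to the root by a quadratic equation. -/
theorem kgPoly_quadratic (y : K) (n : ℕ) :
    kgPoly q y (n + 1) ^ 2 - y * kgPoly q y (n + 1) * kgPoly q y n + q * kgPoly q y n ^ 2 =
      (q : K) ^ (n + 1) := by
  induction n with
  | zero => simp; ring
  | succ n ih =>
    rw [pow_succ (q : K) (n + 1), ← ih, kgPoly_add_two]
    ring

end kgDiff

theorem natCast_mul_eq_smul {K S : Type*} [CommRing K] [Ring S] [Algebra K S] (n : ℕ) (x : S) :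
    (n : S) * x = (n : K) • x := by
  rw [← nsmul_eq_mul, Nat.cast_smul_eq_nsmul]

open Matrix ComplexOrder in
/-- An eigenvalue of a Hermitian matrix is real. -/
theorem conj_eq_of_isHermitian {V : Type*} [Fintype V] {A W : Matrix V V ℂ}
    (hA : A.IsHermitian) (hW : W ≠ 0) {z : ℂ} (h : A * W = z • W) : (starRingEnd ℂ) z = z := by
  have : ∃ x, (fun u => W u x) ≠ 0 := by
    by_contra hc
    push Not at hc
    exact hW (by ext u x; exact congrFun (hc x) u)
  obtain ⟨x, hx⟩ := this
  set w : V → ℂ := fun u => W u x with hw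
  have hAw : A *ᵥ w = z • w := by
    funext u
    exact congrFun (congrFun h u) x
  have h1 : star w ⬝ᵥ (A *ᵥ w) = z * (star w ⬝ᵥ w) := by
    rw [hAw, dotProduct_smul, smul_eq_mul]
  have h2 : star w ⬝ᵥ (A *ᵥ w) = star z * (star w ⬝ᵥ w) := by
    have h4 : star w ᵥ* A = star (A *ᵥ w) := by rw [star_mulVec, hA.eq]
    rw [dotProduct_mulVec, h4, hAw, star_smul, smul_dotProduct, smul_eq_mul]
  have h3 : star w ⬝ᵥ w ≠ 0 := by
    rwa [Ne, dotProduct_star_self_eq_zero]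
  exact (mul_right_cancel₀ h3 (h1.symm.trans h2)).symm

open Matrix in
/-- A nonzero multiple of an idempotent has trace a natural multiple of the factor. -/
theorem exists_nat_trace_eq {V K : Type*} [Fintype V] [DecidableEq V] [Field K] [CharZero K]
    {W : Matrix V V K} {c : K} (hW : W * W = c • W) (ht : W.trace ≠ 0) :
    ∃ μ : ℕ, 0 < μ ∧ W.trace = μ * c := by
  have hc : c ≠ 0 := by
    rintro rfl
    rw [zero_smul] at hW
    have : IsNilpotent W := ⟨2, by rw [pow_two, hW]⟩
    exact ht (Matrix.isNilpotent_trace_of_isNilpotent this).eq_zero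
  have hid : IsIdempotentElem (Matrix.toLin' (c⁻¹ • W)) := by
    rw [IsIdempotentElem, Module.End.mul_eq_comp, ← Matrix.toLin'_mul, smul_mul_smul_comm, hW,
      smul_smul]
    congr 2
    field_simp
  have htr := (LinearMap.IsIdempotentElem.isProj_range _ hid).trace
  rw [Matrix.trace_toLin'_eq, trace_smul, smul_eq_mul] at htr
  have htr' : W.trace = (Module.finrank K (Matrix.toLin' (c⁻¹ • W)).range : K) * c := by
    rw [← htr]; field_simp
  refine ⟨_, ?_, htr'⟩
  rw [Nat.pos_iff_ne_zero]
  intro h0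
  rw [h0, Nat.cast_zero, zero_mul] at htr'
  exact ht htr'

namespace SimpleGraph.IsAntipodal

open Matrix

variable {V : Type*} [Fintype V] {G : SimpleGraph V} [DecidableRel G.Adj] {N q : ℕ} {χ : V → ℤ}
  {σ : V → V}

/-- Each root `z` of `G_N + ε` is a real number, and its multiplicity as an eigenvalue is a
positive integer. -/
theorem exists_multiplicity [Nonempty V] (h : G.IsAntipodal N q χ σ) (hN : 1 ≤ N) (hq : 2 ≤ q)
    {ε : ℤ} (hε : ε = 1 ∨ ε = -1) {z : ℂ} (hz : kgPoly q z N = -ε) :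
    (starRingEnd ℂ) z = z ∧ ∃ μ : ℕ, 0 < μ ∧
      (Fintype.card V * ((q + 1) * q) : ℂ) * kgPoly q z (N - 1) =
        μ * (2 * ((q + 1) ^ 2 - z ^ 2) * kgDiff q z z N) := by
  classical
  obtain ⟨M, rfl⟩ : ∃ M, N = M + 1 := ⟨N - 1, by omega⟩
  set φ : Matrix V V ℤ →+* Matrix V V ℂ := (Int.castRingHom ℂ).mapMatrix with hφ
  set A : Matrix V V ℂ := φ (G.adjMatrix ℤ) with hA
  set B : Matrix V V ℂ := φ (antipodeMatrix σ) with hB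
  set K : Matrix V V ℂ := φ (signMatrix (M + 1) χ) with hK
  set e : Matrix V V ℂ := ((ε : ℤ) : Matrix V V ℂ) with he
  set T : Matrix V V ℂ := (((q + 1 : ℕ) ^ 2 : ℕ) : Matrix V V ℂ) - A * A with hT
  set E : Matrix V V ℂ := 1 + e * B with hE
  set Q : Matrix V V ℂ := kgDiff q z A (M + 1) with hQ
  -- `W` will be a multiple of the projection onto the `z`-eigenvectors with `P = ε`: `T` kills the
  -- eigenvalues `±k`, `E` selects `P = ε`, and `Q` kills the other roots of `G_N + ε`.
  set W : Matrix V V ℂ := Q * T * E with hW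
  have hAB : Commute A B := h.commute_antipodeMatrix.map φ
  have hBB : B * B = 1 := by rw [hB, ← map_mul, h.antipodeMatrix_mul_self, map_one]
  have hee : e * e = 1 := by
    rw [he, ← Int.cast_mul]
    rcases hε with rfl | rfl <;> norm_num
  have heX : ∀ X : Matrix V V ℂ, Commute e X := fun X => Int.cast_commute ε X
  have hGK : kgPoly q A (M + 1) = K - B := by
    rw [hA, ← map_kgPoly, h.kgPoly_adjMatrix_eq, map_sub]
  have hAAK : A * A * K = (((q + 1 : ℕ) ^ 2 : ℕ) : Matrix V V ℂ) * K := by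
    have : G.adjMatrix ℤ * (G.adjMatrix ℤ * signMatrix (M + 1) χ) =
        (((q + 1 : ℕ) ^ 2 : ℕ) : Matrix V V ℤ) * signMatrix (M + 1) χ := by
      rw [h.adjMatrix_mul_signMatrix, ← mul_assoc, ← (Nat.cast_commute (q + 1) _).eq, mul_assoc,
        h.adjMatrix_mul_signMatrix, signMatrix_add_two, ← mul_assoc, Nat.cast_pow, pow_two]
    rw [hA, hK, mul_assoc, ← map_mul, ← map_mul, this, map_mul, map_natCast]
  have hTA : Commute T A :=
    (Nat.cast_commute _ A).sub_left ((Commute.refl A).mul_left (Commute.refl A))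
  have hEA : Commute E A :=
    (Commute.one_left A).add_left ((heX A).mul_left hAB.symm)
  have hET : Commute E T :=
    (Nat.cast_commute _ E).symm.sub_right (hEA.mul_right hEA)
  have hEQ : Commute E Q := by
    rw [hQ, kgDiff]
    refine Commute.sum_right _ _ _ fun i _ => ?_
    exact (commute_kgPoly q hEA i).smul_right _
  have hEE : E * E = (2 : ℂ) • E := by
    have : e * B * (e * B) = 1 := by
      rw [mul_assoc, ← mul_assoc B e B, ← (heX B).eq, mul_assoc e B B, hBB, mul_one, hee]
    rw [hE, add_mul, mul_add, mul_add, this, two_smul]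
    simp only [one_mul, mul_one]
    abel
  -- Here `G_N(A) + ε = K + (ε - P)`, where `T` annihilates `K` and `E` annihilates `ε - P`.
  have hkill : (kgPoly q A (M + 1) + e) * T * E = 0 := by
    have h1 : Commute (kgPoly q A (M + 1) + e) T :=
      (commute_kgPoly q hTA (M + 1)).symm.add_left (heX T)
    have h2 : T * K = 0 := by rw [hT, sub_mul, hAAK, sub_self]
    have h3 : (e - B) * E = 0 := by
      rw [hE, sub_mul, mul_add, mul_add, mul_one, mul_one, ← mul_assoc, hee, one_mul,
        ← mul_assoc, ← (heX B).eq, mul_assoc, hBB, mul_one]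
      abel
    rw [h1.eq, hGK, show K - B + e = K + (e - B) by abel, mul_add T, h2, zero_add, mul_assoc, h3,
      mul_zero]
  have hAW : A * W = z • W := by
    have h1 := sub_mul_kgDiff q z A (M + 1)
    rw [hz] at h1
    have h2 : (A - algebraMap ℂ (Matrix V V ℂ) z) * W = 0 := by
      rw [hW, ← mul_assoc, ← mul_assoc, ← hQ] at *
      rw [h1, map_neg, sub_neg_eq_add, map_intCast]
      exact hkill
    rw [sub_mul, sub_eq_zero] at h2
    rw [h2, Algebra.smul_def]
  have hGW : ∀ i, kgPoly q A i * W = kgPoly q z i • W := by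
    intro i
    induction i using kgPoly_induction with
    | h0 => simp
    | h1 => simpa using hAW
    | h2 i h1 h2 =>
      rw [kgPoly_add_two, kgPoly_add_two, sub_mul, mul_assoc, mul_assoc, h1, h2, mul_smul_comm,
        hAW, natCast_mul_eq_smul (K := ℂ), sub_smul, smul_smul, smul_smul, mul_comm z]
  have hQW : Q * W = kgDiff q z z (M + 1) • W := by
    rw [hQ, kgDiff, kgDiff, Finset.sum_mul, Finset.sum_smul]
    refine Finset.sum_congr rfl fun i _ => ?_
    rw [smul_mul_assoc, hGW, smul_smul, smul_eq_mul]
  have hTW : T * W = (((q + 1) ^ 2 - z ^ 2 : ℂ)) • W := by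
    rw [hT, sub_mul, mul_assoc, hAW, mul_smul_comm, hAW, smul_smul, sub_smul, pow_two z]
    congr 1
    rw [natCast_mul_eq_smul (K := ℂ)]
    push_cast
    rfl
  have hEW : E * W = (2 : ℂ) • W := by
    rw [hW, ← mul_assoc, (hEQ.mul_right hET).eq, mul_assoc, hEE, mul_smul_comm]
  have hWW : W * W = (2 * ((q + 1) ^ 2 - z ^ 2) * kgDiff q z z (M + 1)) • W := by
    conv_lhs => rw [hW]
    rw [← hW, mul_assoc, mul_assoc, hEW, mul_smul_comm, hTW, mul_smul_comm, mul_smul_comm, hQW,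
      smul_smul, smul_smul, mul_assoc]
  have htri : ∀ i ∈ Finset.range (M + 1), (kgPoly q A i * T * E).trace =
      if i = 0 then (Fintype.card V * ((q + 1) * q) : ℂ) else 0 := by
    intro i hi
    rw [Finset.mem_range] at hi
    set Mi : Matrix V V ℤ := (((q + 1 : ℕ) ^ 2 : ℕ) : Matrix V V ℤ) * kgPoly q (G.adjMatrix ℤ) i -
      G.adjMatrix ℤ * (G.adjMatrix ℤ * kgPoly q (G.adjMatrix ℤ) i) with hMi
    have h1 : kgPoly q A i * T * E = φ (Mi * (1 + (ε : Matrix V V ℤ) * antipodeMatrix σ)) := by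
      rw [← (commute_kgPoly q hTA i).eq, hT, hE, he, hB, hMi, map_mul, map_sub, map_mul, map_mul,
        map_mul, map_add, map_mul, map_kgPoly, map_one, map_natCast, map_intCast, sub_mul, mul_assoc]
    have h2 : (Mi * (1 + (ε : Matrix V V ℤ) * antipodeMatrix σ)).trace =
        if i = 0 then (Fintype.card V * ((q + 1) * q) : ℤ) else 0 := by
      have h3 : ∀ u, (Mi * (1 + (ε : Matrix V V ℤ) * antipodeMatrix σ)) u u =
          if i = 0 then ((q + 1) * q : ℤ) else 0 := by
        intro u
        rw [mul_add, mul_one, Matrix.add_apply, ← mul_assoc, ← (Int.cast_commute ε Mi).eq,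
          mul_assoc, ← zsmul_eq_mul, Matrix.smul_apply, h.mul_antipodeMatrix_apply, hMi,
          h.mul_mul_kgPoly_apply_antipode hi, h.mul_mul_kgPoly_apply_self hi, smul_zero, add_zero]
      simp only [Matrix.trace, Matrix.diag_apply, h3]
      simp
    have h4 : (φ (Mi * (1 + (ε : Matrix V V ℤ) * antipodeMatrix σ))).trace =
        ((Mi * (1 + (ε : Matrix V V ℤ) * antipodeMatrix σ)).trace : ℤ) := by
      rw [Matrix.trace, Matrix.trace, Int.cast_sum]
      rfl
    rw [h1, h4, h2]
    split_ifs <;> simp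
  -- Only the term `i = 0` of `Q` has nonzero trace, and its coefficient is `G_{N-1}(z)`.
  have htr : W.trace = (Fintype.card V * ((q + 1) * q) : ℂ) * kgPoly q z M := by
    rw [hW, hQ, kgDiff, Finset.sum_mul, Finset.sum_mul, trace_sum]
    rw [Finset.sum_congr rfl (g := fun i => kgPoly q z (M + 1 - 1 - i) *
      if i = 0 then (Fintype.card V * ((q + 1) * q) : ℂ) else 0)]
    · rw [Finset.sum_eq_single_of_mem 0 (by simp) (by intro b _ hb; rw [if_neg hb, mul_zero]),
        if_pos rfl, mul_comm]
      rfl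
    · intro i hi
      rw [smul_mul_assoc, smul_mul_assoc, trace_smul, htri i hi, smul_eq_mul]
  have hg : kgPoly q z M ≠ 0 := by
    intro h0
    have := kgPoly_quadratic q z M
    rw [h0, hz] at this
    have h2 : ((ε : ℂ)) ^ 2 = 1 := by rcases hε with rfl | rfl <;> norm_num
    have h3 : ((q : ℂ)) ^ (M + 1) = 1 := by
      rw [← this]; linear_combination h2
    have h4 : q ^ (M + 1) = 1 := by exact_mod_cast h3
    exact absurd h4 (Nat.one_lt_pow (Nat.succ_ne_zero M) (by omega : 1 < q)).ne'
  have ht0 : W.trace ≠ 0 := by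
    rw [htr]
    refine mul_ne_zero (mul_ne_zero ?_ (mul_ne_zero ?_ ?_)) hg
    · exact_mod_cast Fintype.card_ne_zero
    · exact_mod_cast Nat.succ_ne_zero q
    · exact_mod_cast (by omega : q ≠ 0)
  constructor
  · refine conj_eq_of_isHermitian (A := A) ?_ ?_ hAW
    · rw [Matrix.IsHermitian]
      ext u x
      rw [conjTranspose_apply, hA, hφ]
      simp [adj_comm]
    · intro h0
      exact ht0 (by rw [h0, trace_zero])
  · obtain ⟨μ, hμ, hμ'⟩ := exists_nat_trace_eq hWW ht0
    exact ⟨μ, hμ, by rw [Nat.add_sub_cancel, ← htr, hμ']⟩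

end SimpleGraph.IsAntipodal

/-! ### Feasible parameters -/

section Real

variable {q : ℕ}

theorem map_kgDiff {K L : Type*} [CommRing K] [CommRing L] (f : K →+* L) (q : ℕ) (y : K) (n : ℕ) :
    f (kgDiff q y y n) = kgDiff q (f y) (f y) n := by
  simp only [kgDiff, smul_eq_mul, map_sum, map_mul, map_kgPoly]

theorem kgPoly_neg {K : Type*} [CommRing K] (q : ℕ) (x : K) (j : ℕ) :
    kgPoly q (-x) j = (-1) ^ j * kgPoly q x j := by
  induction j using kgPoly_induction with
  | h0 => simp
  | h1 => simp
  | h2 j h h' => rw [kgPoly_add_two, kgPoly_add_two, h, h']; ring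

/-- Beyond `2√q` the recurrence no longer oscillates: each step multiplies by at least `x / 2`. -/
theorem kgPoly_growth {x : ℝ} (hx : 0 < x) (hq : 4 * (q : ℝ) ≤ x ^ 2) (j : ℕ) :
    0 < kgPoly q x j ∧ x * kgPoly q x j ≤ 2 * kgPoly q x (j + 1) := by
  induction j with
  | zero => simp; linarith
  | succ j ih =>
    have h1 : 0 < kgPoly q x (j + 1) := by nlinarith [mul_pos hx ih.1]
    refine ⟨h1, ?_⟩
    rw [kgPoly_add_two]
    have h2 : 4 * (q : ℝ) * kgPoly q x j ≤ x ^ 2 * kgPoly q x j :=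
      mul_le_mul_of_nonneg_right hq ih.1.le
    have h3 : x * (x * kgPoly q x j) ≤ x * (2 * kgPoly q x (j + 1)) :=
      mul_le_mul_of_nonneg_left ih.2 hx.le
    nlinarith

theorem one_lt_kgPoly {x : ℝ} (hx : 2 < x) (hq : 4 * (q : ℝ) ≤ x ^ 2) (j : ℕ) :
    1 < kgPoly q x (j + 1) := by
  induction j with
  | zero => simp; linarith
  | succ j ih =>
    have := (kgPoly_growth (by linarith) hq (j + 1)).2
    nlinarith

/-- The roots of `G_N ± 1` lie in the open interval `(-2√q, 2√q)`. -/
theorem sq_lt_of_kgPoly_eq (hq : 2 ≤ q) {N : ℕ} (hN : 1 ≤ N) {ε : ℤ} (hε : ε = 1 ∨ ε = -1) {x : ℝ}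
    (hx : kgPoly q x N = -ε) : x ^ 2 < 4 * q := by
  by_contra hc
  push Not at hc
  have hq' : (2 : ℝ) ≤ q := by exact_mod_cast hq
  obtain ⟨M, rfl⟩ : ∃ M, N = M + 1 := ⟨N - 1, by omega⟩
  have h2 : 2 < |x| := by
    by_contra h
    push Not at h
    have : x ^ 2 ≤ 2 ^ 2 := by rw [← sq_abs]; gcongr
    linarith
  have h3 := one_lt_kgPoly (q := q) h2 (by rw [sq_abs]; exact hc) M
  have h4 : |kgPoly q x (M + 1)| = 1 := by
    rw [hx]; rcases hε with rfl | rfl <;> norm_num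
  have h5 : |kgPoly q |x| (M + 1)| = 1 := by
    rcases abs_choice x with h | h
    · rw [h, h4]
    · rw [h, kgPoly_neg, abs_mul, abs_pow, abs_neg, abs_one, one_pow, one_mul, h4]
  rw [abs_of_pos (by linarith)] at h5
  linarith

/-- The real number `ρ = ε x / g` attached to a root `x` of `G_N + ε` and `g = G_{N-1}(x)`: it
satisfies a quadratic equation and determines the multiplicity `μ` of `x`. -/
theorem exists_ratio (hq : 2 ≤ q) {N n μ : ℕ} (hN : 1 ≤ N) {ε : ℤ} (hε : ε = 1 ∨ ε = -1) {x : ℝ}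
    (hx : kgPoly q x N = -ε)
    (hμ : (n * ((q + 1) * q) : ℝ) * kgPoly q x (N - 1) =
      μ * (2 * ((q + 1) ^ 2 - x ^ 2) * kgDiff q x x N)) :
    ∃ ρ : ℝ, ρ ^ 2 * ((q : ℝ) ^ N - 1) = x ^ 2 * (q + ρ) ∧
      (n * ((q + 1) * q) : ℝ) * (4 * q - x ^ 2) =
        2 * μ * ((q + 1) ^ 2 - x ^ 2) * (N * ρ + 2 * (N + 1) * q) := by
  obtain ⟨M, rfl⟩ : ∃ M, N = M + 1 := ⟨N - 1, by omega⟩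
  have hq' : (2 : ℝ) ≤ q := by exact_mod_cast hq
  have hε2 : (ε : ℝ) ^ 2 = 1 := by rcases hε with rfl | rfl <;> norm_num
  have hquad := kgPoly_quadratic q x M
  have hder := sq_sub_mul_kgDiff q x M
  rw [hx] at hquad hder
  rw [Nat.add_sub_cancel] at hμ
  set g := kgPoly q x M with hg
  have hpow : (1 : ℝ) < (q : ℝ) ^ (M + 1) := one_lt_pow₀ (by linarith) (by omega)
  have hg0 : g ≠ 0 := by
    intro h0
    rw [h0] at hquad
    nlinarith
  -- The first equation is `kgPoly_quadratic` at `G_N = -ε`, divided by `g²`; the second is the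
  -- multiplicity formula with the derivative eliminated by `sq_sub_mul_kgDiff`.
  refine ⟨ε * x / g, ?_, ?_⟩
  · have key : (ε * x) ^ 2 * ((q : ℝ) ^ (M + 1) - 1) = x ^ 2 * (q * g + ε * x) * g := by
      rw [← hquad]
      linear_combination (x ^ 2 * (ε ^ 2 + ε * x * g + q * g ^ 2)) * hε2
    rw [div_pow, div_mul_eq_mul_div, key]
    field_simp
  · have h1 : (n * ((q + 1) * q) : ℝ) * (4 * q - x ^ 2) * g =
        2 * μ * ((q + 1) ^ 2 - x ^ 2) * ((M + 1 : ℕ) * (ε * x) + 2 * ((M + 1 : ℕ) + 1) * q * g) := by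
      push_cast
      linear_combination (4 * q - x ^ 2) * hμ - 2 * μ * ((q + 1) ^ 2 - x ^ 2) * hder
    field_simp
    linear_combination h1

/-- A bootstrap: first `|ρ| < Q`, hence `ρ² D ≤ 8 Q²`; then `D > 76 Q²` gives `|ρ| < 0.36 ≤ 0.18 Q`,
and reinserting this yields the constant `4 * 1.18 = 4.72`. -/
theorem ratio_sq_le {Q D y ρ : ℝ} (hQ : 2 ≤ Q) (hD : 76 * Q ^ 2 < D) (hy : 0 ≤ y)
    (hy4 : y < 4 * Q) (h : ρ ^ 2 * D = y * (Q + ρ)) : ρ ^ 2 * D ≤ 4.72 * Q ^ 2 := by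
  have hQ0 : 0 < Q := by linarith
  have hD0 : 0 < D := by nlinarith
  have h3 : ρ ^ 2 * D ≤ 4 * Q * (Q + |ρ|) := by
    rw [h]
    have : y * (Q + ρ) ≤ y * (Q + |ρ|) :=
      mul_le_mul_of_nonneg_left (by linarith [le_abs_self ρ]) hy
    refine this.trans (mul_le_mul_of_nonneg_right hy4.le ?_)
    positivity
  have h4 : |ρ| < Q := by
    by_contra hc
    push Not at hc
    have h8 : 0 < |ρ| := by linarith
    have h5 : |ρ| * (|ρ| * D) ≤ |ρ| * (8 * Q) := by
      rw [← sq_abs] at h3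
      have : 4 * Q * (Q + |ρ|) ≤ 4 * Q * (|ρ| + |ρ|) :=
        mul_le_mul_of_nonneg_left (by linarith) (by linarith)
      linarith
    have h6 : |ρ| * D ≤ 8 * Q := le_of_mul_le_mul_left h5 h8
    have h7 : Q * D ≤ |ρ| * D := mul_le_mul_of_nonneg_right hc hD0.le
    have h9 : D ≤ 8 := by
      apply le_of_mul_le_mul_left _ hQ0
      linarith
    nlinarith
  have h5 : ρ ^ 2 * D ≤ 8 * Q ^ 2 := by
    have : 4 * Q * (Q + |ρ|) ≤ 4 * Q * (Q + Q) :=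
      mul_le_mul_of_nonneg_left (by linarith) (by linarith)
    linarith
  have h6 : |ρ| < 0.36 := by
    by_contra hc
    push Not at hc
    have h7 : (0.36 : ℝ) ^ 2 ≤ ρ ^ 2 := by
      rw [← sq_abs ρ]; exact pow_le_pow_left₀ (by norm_num) hc 2
    have h8 := mul_le_mul_of_nonneg_right h7 hD0.le
    have h9 : 0 < Q ^ 2 := by positivity
    linarith
  have h7 : 4 * Q * (Q + |ρ|) ≤ 4 * Q * (Q + 0.18 * Q) :=
    mul_le_mul_of_nonneg_left (by linarith) (by linarith)
  linarith

/-- The constant 76 comes from here: the square of `4 Q K ρ` is at most `16 * 4.72 / 76 < 1` times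
that of `Q X`. In the application `K = (q+1)²`, `X = (q-1)²` and `D = q^N - 1`. -/
theorem ratio_term_lt {D Q X K : ℝ} (hQ : 2 ≤ Q) (hX0 : 0 < X) (hX4 : K - 4 * Q = X)
    (hbig : 76 * K ^ 2 * Q ^ 2 < X ^ 2 * D) {y y' ρ : ℝ} (hy : 0 ≤ y) (hy' : 0 ≤ y')
    (h4 : y < 4 * Q) (h4' : y' < 4 * Q) (hρ : ρ ^ 2 * D ≤ 4.72 * Q ^ 2) :
    |(4 * Q - y') * (K - y) * ρ| < Q * X := by
  have hQ0 : 0 < Q := by linarith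
  have hK0 : 0 < K := by linarith
  have hsq : (4 * Q * K * ρ) ^ 2 < (Q * X) ^ 2 := by
    have h3 : (X ^ 2 * D) * ρ ^ 2 ≤ X ^ 2 * (4.72 * Q ^ 2) := by
      have := mul_le_mul_of_nonneg_left hρ (sq_nonneg X)
      linarith
    have h4 : 76 * K ^ 2 * Q ^ 2 * ρ ^ 2 ≤ X ^ 2 * (4.72 * Q ^ 2) :=
      (mul_le_mul_of_nonneg_right hbig.le (sq_nonneg ρ)).trans h3
    have h5 : 0 < X ^ 2 * Q ^ 2 := by positivity
    have e1 : (4 * Q * K * ρ) ^ 2 = 16 * (K ^ 2 * Q ^ 2 * ρ ^ 2) := by ring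
    have e2 : (Q * X) ^ 2 = X ^ 2 * Q ^ 2 := by ring
    rw [e1, e2]
    linarith
  have hlt := abs_lt_of_sq_lt_sq hsq (by positivity)
  rw [abs_mul, abs_of_pos (by positivity)] at hlt
  refine lt_of_le_of_lt ?_ hlt
  have h3 : 0 ≤ K - y := by linarith
  rw [abs_mul, abs_mul, abs_of_nonneg (by linarith : 0 ≤ 4 * Q - y'), abs_of_nonneg h3]
  apply mul_le_mul_of_nonneg_right _ (abs_nonneg _)
  apply mul_le_mul (by linarith) (by linarith) h3 (by positivity)

/-- Eliminating `C` and the common multiplicity `μ` leaves `2(N+1) Q X (y' - y)` equal to `N` times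
a difference of two terms, each below `Q X` in absolute value. Hence `|y - y'| ≤ N / (N + 1)`. -/
theorem abs_sub_lt_one_of_ratio {D Q X K C N μ : ℝ} (hQ : 2 ≤ Q) (hX0 : 0 < X)
    (hX4 : K - 4 * Q = X) (hbig : 76 * K ^ 2 * Q ^ 2 < X ^ 2 * D) (hC : 0 < C) (hN : 0 ≤ N)
    {y y' ρ ρ' : ℝ} (hy : 0 ≤ y) (hy' : 0 ≤ y') (h4 : y < 4 * Q) (h4' : y' < 4 * Q)
    (h1 : ρ ^ 2 * D = y * (Q + ρ))
    (h2 : C * (4 * Q - y) = 2 * μ * (K - y) * (N * ρ + 2 * (N + 1) * Q))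
    (h1' : ρ' ^ 2 * D = y' * (Q + ρ'))
    (h2' : C * (4 * Q - y') = 2 * μ * (K - y') * (N * ρ' + 2 * (N + 1) * Q)) :
    |y - y'| < 1 := by
  have hQ0 : 0 < Q := by linarith
  have hD76 : 76 * Q ^ 2 < D := by
    have h3 : X ^ 2 ≤ K ^ 2 := pow_le_pow_left₀ hX0.le (by linarith) 2
    have h4 : X ^ 2 * (76 * Q ^ 2) ≤ K ^ 2 * (76 * Q ^ 2) :=
      mul_le_mul_of_nonneg_right h3 (by positivity)
    have h5 : X ^ 2 * (76 * Q ^ 2) < X ^ 2 * D := by linarith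
    exact lt_of_mul_lt_mul_left h5 (by positivity)
  have t1 := ratio_term_lt hQ hX0 hX4 hbig hy hy' h4 h4' (ratio_sq_le hQ hD76 hy h4 h1)
  have t2 := ratio_term_lt hQ hX0 hX4 hbig hy' hy h4' h4 (ratio_sq_le hQ hD76 hy' h4' h1')
  have hμ : μ ≠ 0 := by
    rintro rfl
    have : 0 < C * (4 * Q - y) := mul_pos hC (by linarith)
    linarith
  have hcross : (4 * Q - y) * (K - y') * (N * ρ' + 2 * (N + 1) * Q) =
      (4 * Q - y') * (K - y) * (N * ρ + 2 * (N + 1) * Q) := by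
    have h3 : C * (2 * μ) * ((4 * Q - y) * (K - y') * (N * ρ' + 2 * (N + 1) * Q)) =
        C * (2 * μ) * ((4 * Q - y') * (K - y) * (N * ρ + 2 * (N + 1) * Q)) := by
      linear_combination (2 * μ * (K - y') * (N * ρ' + 2 * (N + 1) * Q)) * h2 -
        (2 * μ * (K - y) * (N * ρ + 2 * (N + 1) * Q)) * h2'
    exact mul_left_cancel₀ (mul_ne_zero hC.ne' (mul_ne_zero two_ne_zero hμ)) h3
  have hdiff : 2 * (N + 1) * Q * X * (y' - y) =
      N * ((4 * Q - y') * (K - y) * ρ - (4 * Q - y) * (K - y') * ρ') := by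
    rw [← hX4]
    linear_combination hcross
  have hfin : 2 * (N + 1) * Q * X * |y - y'| ≤ N * (2 * (Q * X)) := by
    have h3 : 2 * (N + 1) * Q * X * |y - y'| = |2 * (N + 1) * Q * X * (y' - y)| := by
      rw [abs_mul, abs_sub_comm, abs_of_nonneg (by positivity : 0 ≤ 2 * (N + 1) * Q * X)]
    rw [h3, hdiff, abs_mul, abs_of_nonneg hN]
    apply mul_le_mul_of_nonneg_left _ hN
    exact (abs_sub _ _).trans (by linarith)
  by_contra hc
  push Not at hc
  have h3 : 2 * (N + 1) * Q * X * 1 ≤ 2 * (N + 1) * Q * X * |y - y'| :=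
    mul_le_mul_of_nonneg_left hc (by positivity)
  have : 0 < Q * X := by positivity
  linarith

end Real

/-! ### The feasibility condition and the simplicity of the roots of `G_N ± 1`. -/

section

open Polynomial

/-- The necessary condition on the parameters given by the multiplicities of the eigenvalues. -/
def KGFeasible (n q N : ℕ) : Prop :=
  ∀ ε : ℤ, (ε = 1 ∨ ε = -1) → ∀ z : ℂ, kgPoly q z N = -ε → (starRingEnd ℂ) z = z ∧
    ∃ μ : ℕ, 0 < μ ∧ (n * ((q + 1) * q) : ℂ) * kgPoly q z (N - 1) =
      μ * (2 * ((q + 1) ^ 2 - z ^ 2) * kgDiff q z z N)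

theorem kgPoly_monic_natDegree {R : Type*} [CommRing R] [Nontrivial R] (q : ℕ) (j : ℕ) :
    (kgPoly q (X : R[X]) j).Monic ∧ (kgPoly q (X : R[X]) j).natDegree = j := by
  induction j using kgPoly_induction with
  | h0 => simp [monic_one]
  | h1 => simp [monic_X]
  | h2 j h h' =>
    have h1 : (X * kgPoly q (X : R[X]) (j + 1)).natDegree = j + 2 := by
      rw [natDegree_X_mul h'.1.ne_zero, h'.2]
    have h2 : ((q : R[X]) * kgPoly q (X : R[X]) j).natDegree ≤ j := by
      refine natDegree_mul_le.trans ?_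
      rw [natDegree_natCast, h.2, zero_add]
    have h3 : ((q : R[X]) * kgPoly q (X : R[X]) j).degree <
        (X * kgPoly q (X : R[X]) (j + 1)).degree := by
      apply degree_lt_degree
      omega
    rw [kgPoly_add_two]
    refine ⟨(monic_X.mul h'.1).sub_of_left h3, ?_⟩
    rw [natDegree_sub_eq_left_of_natDegree_lt (by omega), h1]

theorem monic_kgPoly_add_C {R : Type*} [CommRing R] [Nontrivial R] (q : ℕ) {N : ℕ} (hN : 1 ≤ N)
    (c : R) : (kgPoly q (X : R[X]) N + C c).Monic ∧
      (kgPoly q (X : R[X]) N + C c).natDegree = N := by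
  obtain ⟨h1, h2⟩ := kgPoly_monic_natDegree (R := R) q N
  refine ⟨h1.add_of_left ?_, ?_⟩
  · apply degree_lt_degree
    rw [natDegree_C, h2]; omega
  · rw [natDegree_add_C, h2]

theorem eval_kgPoly_X {R : Type*} [CommRing R] (q : ℕ) (x : R) (j : ℕ) :
    (kgPoly q (X : R[X]) j).eval x = kgPoly q x j := by
  have := map_kgPoly q (evalRingHom x) (X : R[X]) j
  simpa using this

theorem derivative_kgPoly {R : Type*} [CommRing R] (q : ℕ) (j : ℕ) :
    derivative (kgPoly q (X : R[X]) j) = kgDiff q (X : R[X]) (X : R[X]) j := by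
  induction j using kgPoly_induction with
  | h0 => simp
  | h1 => simp
  | h2 j h h' =>
    rw [kgPoly_add_two, kgDiff_add_two]
    simp only [derivative_sub, derivative_mul, derivative_X, derivative_natCast, h, h']
    simp only [smul_eq_mul]
    ring

namespace KGFeasible

variable {n q N : ℕ}

theorem exists_real (h : KGFeasible n q N) {ε : ℤ} (hε : ε = 1 ∨ ε = -1) {x : ℝ}
    (hx : kgPoly q x N = -ε) : ∃ μ : ℕ, 0 < μ ∧ (n * ((q + 1) * q) : ℝ) * kgPoly q x (N - 1) =
      μ * (2 * ((q + 1) ^ 2 - x ^ 2) * kgDiff q x x N) := by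
  have hz : kgPoly q (x : ℂ) N = -ε := by
    have := map_kgPoly q Complex.ofRealHom x N
    rw [hx] at this
    simpa using this.symm
  obtain ⟨-, μ, hμ, h1⟩ := h ε hε x hz
  refine ⟨μ, hμ, ?_⟩
  have h2 := map_kgPoly q Complex.ofRealHom x (N - 1)
  have h3 := map_kgDiff Complex.ofRealHom q x N
  simp only [Complex.ofRealHom_eq_coe] at h2 h3
  rw [← h2, ← h3] at h1
  exact_mod_cast h1

/-- A multiple root would make the right side of the multiplicity formula zero, hence `G_{N-1}(z) =
0`, and `kgPoly_quadratic` would give `q^N = 1`. -/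
theorem kgDiff_ne_zero (h : KGFeasible n q N) (hn : 0 < n) (hq : 2 ≤ q) (hN : 1 ≤ N) {ε : ℤ}
    (hε : ε = 1 ∨ ε = -1) {z : ℂ} (hz : kgPoly q z N = -ε) : kgDiff q z z N ≠ 0 := by
  obtain ⟨-, μ, hμ, h1⟩ := h ε hε z hz
  intro h0
  rw [h0, mul_zero, mul_zero] at h1
  have hn' : (n : ℂ) ≠ 0 := by exact_mod_cast hn.ne'
  have hq0 : (q : ℂ) ≠ 0 := by exact_mod_cast (by omega : q ≠ 0)
  have hq1 : (q : ℂ) + 1 ≠ 0 := by exact_mod_cast (by omega : q + 1 ≠ 0)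
  have hg : kgPoly q z (N - 1) = 0 := by
    rcases mul_eq_zero.1 h1 with h2 | h2
    · exact absurd h2 (mul_ne_zero hn' (mul_ne_zero hq1 hq0))
    · exact h2
  obtain ⟨M, rfl⟩ : ∃ M, N = M + 1 := ⟨N - 1, by omega⟩
  have h2 := kgPoly_quadratic q z M
  rw [Nat.add_sub_cancel] at hg
  rw [hz, hg] at h2
  have h3 : (1 : ℂ) = (q : ℂ) ^ (M + 1) := by
    rw [← h2]
    rcases hε with rfl | rfl <;> norm_num
  have h4 : (1 : ℕ) = q ^ (M + 1) := by exact_mod_cast h3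
  have := Nat.one_lt_pow (n := M + 1) (by omega) (by omega : 1 < q)
  omega

theorem card_roots (h : KGFeasible n q N) (hn : 0 < n) (hq : 2 ≤ q) (hN : 1 ≤ N) {ε : ℤ}
    (hε : ε = 1 ∨ ε = -1) :
    ∃ s : Finset ℂ, s.card = N ∧ ∀ z ∈ s, kgPoly q z N = -ε := by
  set P : ℂ[X] := kgPoly q X N + C (ε : ℂ) with hP
  obtain ⟨hm, hd⟩ := monic_kgPoly_add_C (R := ℂ) q hN (ε : ℂ)
  have hroot : ∀ z, P.IsRoot z ↔ kgPoly q z N = -ε := by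
    intro z
    rw [IsRoot, hP, eval_add, eval_kgPoly_X, eval_C, add_eq_zero_iff_eq_neg]
  have hnd : P.roots.Nodup := by
    rw [Multiset.nodup_iff_count_le_one]
    intro z
    rw [count_roots]
    by_contra hc
    push Not at hc
    obtain ⟨h1, h2⟩ := (one_lt_rootMultiplicity_iff_isRoot hm.ne_zero).1 hc
    refine h.kgDiff_ne_zero hn hq hN hε ((hroot z).1 h1) ?_
    rw [IsRoot, derivative_add, derivative_C, add_zero, derivative_kgPoly] at h2
    have h3 := map_kgDiff (evalRingHom z) q (X : ℂ[X]) N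
    rw [coe_evalRingHom, h2, eval_X] at h3
    exact h3.symm
  refine ⟨P.roots.toFinset, ?_, ?_⟩
  · rw [Multiset.toFinset_card_of_nodup hnd, ← hd]
    exact (splits_iff_card_roots.1 (IsAlgClosed.splits P))
  · intro z hz
    rw [Multiset.mem_toFinset, mem_roots hm.ne_zero] at hz
    exact (hroot z).1 hz

end KGFeasible

end

/-! ### Integrality of the squares of the roots when `q^N` is large. -/

section

open Polynomial

/-- The norm is a rational integer and a product of conjugates of modulus below 1, so it vanishes.
-/
theorem eq_zero_of_forall_embedding_norm_lt_one {L : Type*} [Field L] [NumberField L] {γ : L}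
    (hint : IsIntegral ℤ γ) (h : ∀ ψ : L →+* ℂ, ‖ψ γ‖ < 1) : γ = 0 := by
  by_contra h0
  have h1 : IsIntegral ℤ (Algebra.norm ℚ γ) := Algebra.isIntegral_norm ℚ hint
  obtain ⟨m, hm⟩ := IsIntegrallyClosed.isIntegral_iff.1 h1
  have h2 := Algebra.norm_eq_prod_embeddings ℚ ℂ γ
  rw [← hm] at h2
  have h3 : ‖∏ σ : L →ₐ[ℚ] ℂ, σ γ‖ < 1 := by
    rw [norm_prod]
    have : ∏ σ : L →ₐ[ℚ] ℂ, ‖σ γ‖ < ∏ σ : L →ₐ[ℚ] ℂ, (1 : ℝ) := by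
      apply Finset.prod_lt_prod_of_nonempty
      · intro σ _
        exact norm_pos_iff.2 ((map_ne_zero σ).2 h0)
      · intro σ _
        exact h σ.toRingHom
      · have : Nonempty (L →ₐ[ℚ] ℂ) := ⟨IsAlgClosed.lift⟩
        exact Finset.univ_nonempty
    simpa using this
  rw [← h2] at h3
  have h4 : |m| < 1 := by
    have : ‖((m : ℤ) : ℂ)‖ < 1 := by simpa using h3
    rw [Complex.norm_intCast] at this
    exact_mod_cast this
  have h5 : m = 0 := by
    rw [abs_lt] at h4; omega
  rw [h5, map_zero] at hm
  exact h0 (Algebra.norm_eq_zero_iff.1 hm.symm)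

theorem exists_isGalois_splits {F : Type} [Field F] [CharZero F] (f : F[X]) :
    ∃ (L : Type) (_ : Field L) (_ : Algebra F L) (_ : FiniteDimensional F L) (_ : IsGalois F L),
      (f.map (algebraMap F L)).Splits :=
  ⟨f.SplittingField, inferInstance, inferInstance, inferInstance, ⟨⟩, SplittingField.splits f⟩

theorem exists_numberField_splits (f : ℚ[X]) : ∃ (L : Type) (_ : Field L) (_ : NumberField L)
    (_ : IsGalois ℚ L), (f.map (algebraMap ℚ L)).Splits := by
  obtain ⟨L, _, _, _, _, h⟩ := exists_isGalois_splits f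
  have : CharZero L := charZero_of_injective_algebraMap (algebraMap ℚ L).injective
  obtain rfl : ‹Algebra ℚ L› = DivisionRing.toRatAlgebra := Subsingleton.elim _ _
  exact ⟨L, inferInstance, ⟨⟩, inferInstance, h⟩

namespace KGFeasible

variable {n q N : ℕ}

/-- The multiplicity formula has rational coefficients, so all conjugates of the root satisfy it
with the same `μ`. By `abs_sub_lt_one_of_ratio` every conjugate of `τ(a²) - a²` has modulus below 1,
so this algebraic integer is zero for each automorphism `τ`. Thus `a²` is rational and integral. -/
theorem exists_sq_eq_intCast (h : KGFeasible n q N) (hn : 0 < n) (hq : 2 ≤ q) (hN : 1 ≤ N)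
    (hbig : 76 * ((q : ℝ) + 1) ^ 4 * q ^ 2 < (q - 1) ^ 4 * ((q : ℝ) ^ N - 1)) {ε : ℤ}
    (hε : ε = 1 ∨ ε = -1) {z : ℂ} (hz : kgPoly q z N = -ε) : ∃ m : ℤ, z ^ 2 = m := by
  set f : ℚ[X] := kgPoly q X N + C (ε : ℚ) with hf
  obtain ⟨hm, hd⟩ := monic_kgPoly_add_C (R := ℚ) q hN (ε : ℚ)
  have hroot : ∀ {K : Type} [Field K] [Algebra ℚ K] (a : K), aeval a f = kgPoly q a N + ε := by
    intro K _ _ a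
    have := map_kgPoly q (aeval (R := ℚ) a).toRingHom X N
    simp only [AlgHom.toRingHom_eq_coe, RingHom.coe_coe, aeval_X] at this
    rw [hf, map_add, this]
    simp
  obtain ⟨L, _, _, _, hsp⟩ := exists_numberField_splits f
  let φ : L →ₐ[ℚ] ℂ := IsAlgClosed.lift
  obtain ⟨a, ha⟩ : ∃ a : L, φ a = z := by
    have h1 : z ∈ f.rootSet ℂ := by
      rw [mem_rootSet]
      refine ⟨hm.ne_zero, ?_⟩
      rw [hroot, hz]; simp
    rw [← hsp.image_rootSet φ] at h1
    obtain ⟨a, -, ha⟩ := h1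
    exact ⟨a, ha⟩
  obtain ⟨-, μ, hμ, h1⟩ := h ε hε z hz
  have ha0 : kgPoly q a N = -ε := by
    apply φ.toRingHom.injective
    rw [map_kgPoly, map_neg, map_intCast]
    exact (congrArg (fun w => kgPoly q w N) ha).trans hz
  have haμ : (n * ((q + 1) * q) : L) * kgPoly q a (N - 1) =
      μ * (2 * ((q + 1) ^ 2 - a ^ 2) * kgDiff q a a N) := by
    have ha' : φ.toRingHom a = z := ha
    apply φ.toRingHom.injective
    simp only [map_mul, map_sub, map_pow, map_add, map_natCast, map_one, map_kgPoly, map_kgDiff,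
      map_ofNat, ha']
    exact h1
  have hreal : ∀ ψ : L →+* ℂ, ∃ x ρ : ℝ, ψ a = x ∧ x ^ 2 < 4 * q ∧
      ρ ^ 2 * ((q : ℝ) ^ N - 1) = x ^ 2 * (q + ρ) ∧
      (n * ((q + 1) * q) : ℝ) * (4 * q - x ^ 2) =
        2 * μ * ((q + 1) ^ 2 - x ^ 2) * (N * ρ + 2 * (N + 1) * q) := by
    intro ψ
    have h2 : kgPoly q (ψ a) N = -ε := by
      rw [← map_kgPoly, ha0, map_neg, map_intCast]
    obtain ⟨x, hx⟩ := Complex.conj_eq_iff_real.1 (h ε hε _ h2).1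
    have h3 : kgPoly q x N = -ε := by
      have := map_kgPoly q Complex.ofRealHom x N
      rw [Complex.ofRealHom_eq_coe, Complex.ofRealHom_eq_coe, ← hx, h2] at this
      have h4 : ((kgPoly q x N : ℝ) : ℂ) = ((-ε : ℝ) : ℂ) := by simpa using this
      exact_mod_cast h4
    have h5 : (n * ((q + 1) * q) : ℝ) * kgPoly q x (N - 1) =
        μ * (2 * ((q + 1) ^ 2 - x ^ 2) * kgDiff q x x N) := by
      have h6 := congrArg ψ haμ
      simp only [map_mul, map_sub, map_pow, map_add, map_natCast, map_one, map_kgPoly, map_kgDiff,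
        map_ofNat, hx] at h6
      have h7 := map_kgPoly q Complex.ofRealHom x (N - 1)
      have h8 := map_kgDiff Complex.ofRealHom q x N
      simp only [Complex.ofRealHom_eq_coe] at h7 h8
      rw [← h7, ← h8] at h6
      exact_mod_cast h6
    obtain ⟨ρ, h6, h7⟩ := exists_ratio hq hN hε h3 h5
    exact ⟨x, ρ, hx, sq_lt_of_kgPoly_eq hq hN hε h3, h6, h7⟩
  have hq' : (2 : ℝ) ≤ q := by exact_mod_cast hq
  have hn' : (0 : ℝ) < n := by exact_mod_cast hn
  have hclose : ∀ ψ ψ' : L →+* ℂ, ‖ψ a ^ 2 - ψ' a ^ 2‖ < 1 := by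
    intro ψ ψ'
    obtain ⟨x, ρ, e1, e2, e3, e4⟩ := hreal ψ
    obtain ⟨x', ρ', e1', e2', e3', e4'⟩ := hreal ψ'
    have h2 : |x ^ 2 - x' ^ 2| < 1 := by
      refine abs_sub_lt_one_of_ratio (X := ((q : ℝ) - 1) ^ 2) (K := ((q : ℝ) + 1) ^ 2) hq' ?_
        (by ring) ?_ (by positivity : (0 : ℝ) < n * ((q + 1) * q)) (Nat.cast_nonneg N)
        (sq_nonneg x) (sq_nonneg x') e2 e2' e3 e4 e3' e4'
      · have : (0 : ℝ) < q - 1 := by linarith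
        positivity
      · rw [← pow_mul, ← pow_mul]
        exact hbig
    rw [e1, e1']
    have h3 : (x : ℂ) ^ 2 - (x' : ℂ) ^ 2 = ((x ^ 2 - x' ^ 2 : ℝ) : ℂ) := by push_cast; rfl
    rw [h3, Complex.norm_real]
    exact h2
  have haint : IsIntegral ℤ a := by
    obtain ⟨hm', -⟩ := monic_kgPoly_add_C (R := ℤ) q hN ε
    refine ⟨_, hm', ?_⟩
    have h2 := map_kgPoly q (eval₂RingHom (algebraMap ℤ L) a) X N
    simp only [coe_eval₂RingHom, eval₂_X] at h2
    rw [eval₂_add, h2, ha0, eval₂_C]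
    simp
  have hfix : ∀ τ : Gal(L/ℚ), τ (a ^ 2) = a ^ 2 := by
    intro τ
    rw [← sub_eq_zero]
    apply eq_zero_of_forall_embedding_norm_lt_one
    · have h2 : IsIntegral ℤ (a ^ 2) := haint.pow 2
      refine IsIntegral.sub ?_ h2
      exact h2.map (τ.toAlgHom.restrictScalars ℤ)
    · intro ψ
      have := hclose (ψ.comp τ.toRingEquiv.toRingHom) ψ
      simpa using this
  obtain ⟨r, hr⟩ := (IsGalois.mem_range_algebraMap_iff_fixed (F := ℚ) (a ^ 2)).2 hfix
  have hrint : IsIntegral ℤ r := by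
    have h2 : IsIntegral ℤ (a ^ 2) := haint.pow 2
    rw [← hr] at h2
    exact (isIntegral_algebraMap_iff (algebraMap ℚ L).injective).1 h2
  obtain ⟨m, hm⟩ := IsIntegrallyClosed.isIntegral_iff.1 hrint
  refine ⟨m, ?_⟩
  rw [← ha, ← map_pow, ← hr, ← hm]
  simp

/-- `G_j` is, up to a factor `x` for odd `j`, a polynomial in `x²`. -/
theorem _root_.exists_kgPoly_eq_aeval_sq (q M : ℕ) : ∃ E O : ℤ[X], ∀ z : ℂ,
    kgPoly q z (2 * M) = aeval (z ^ 2) E ∧ kgPoly q z (2 * M + 1) = z * aeval (z ^ 2) O := by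
  induction M with
  | zero => exact ⟨1, 1, fun z => by simp⟩
  | succ M ih =>
    obtain ⟨E, O, hEO⟩ := ih
    refine ⟨X * O - C (q : ℤ) * E, X * O - C (q : ℤ) * E - C (q : ℤ) * O, fun z => ?_⟩
    obtain ⟨h1, h2⟩ := hEO z
    have h3 : kgPoly q z (2 * (M + 1)) = aeval (z ^ 2) (X * O - C (q : ℤ) * E) := by
      rw [show 2 * (M + 1) = 2 * M + 2 by ring, kgPoly_add_two, h1, h2]
      simp; ring
    refine ⟨h3, ?_⟩
    rw [show 2 * (M + 1) + 1 = 2 * M + 1 + 2 by ring, kgPoly_add_two, h2,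
      show 2 * M + 1 + 1 = 2 * (M + 1) by ring, h3]
    simp; ring

/-- For even `N`, `G_N` is an integer polynomial `E` in `x²`, and since the roots are distinct, `E`
takes each of the values `1` and `-1` at three or more integers; but points with different values
differ by a divisor of 2. For odd `N`, a root of `G_N + 1` has an integer square `m` with `m O(m)² =
1`, so `G_N + 1` has at most the roots `±1`. -/
theorem not_of_big (h : KGFeasible n q N) (hn : 0 < n) (hq : 2 ≤ q) (hN : 5 ≤ N)
    (hbig : 76 * ((q : ℝ) + 1) ^ 4 * q ^ 2 < (q - 1) ^ 4 * ((q : ℝ) ^ N - 1)) : False := by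
  have hsq := fun {ε : ℤ} (hε : ε = 1 ∨ ε = -1) {z : ℂ} (hz : kgPoly q z N = -ε) =>
    h.exists_sq_eq_intCast hn hq (by omega) hbig hε hz
  have hcast : ∀ (P : ℤ[X]) (m : ℤ), aeval (m : ℂ) P = ((P.eval m : ℤ) : ℂ) := by
    intro P m
    have := aeval_algebraMap_apply ℂ m P
    simpa using this
  rcases Nat.even_or_odd' N with ⟨M, rfl | rfl⟩
  · obtain ⟨E, _, hE⟩ := exists_kgPoly_eq_aeval_sq q M
    have hset : ∀ {ε : ℤ}, (ε = 1 ∨ ε = -1) → ∃ t : Finset ℤ, 3 ≤ t.card ∧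
        ∀ m ∈ t, E.eval m = -ε := by
      intro ε hε
      obtain ⟨s, hs, hs'⟩ := h.card_roots hn hq (by omega) hε
      choose! r hr using fun z (hz : z ∈ s) => hsq hε (hs' z hz)
      refine ⟨s.image r, ?_, ?_⟩
      · by_contra hc
        have h1 : s.card ≤ 2 * (s.image r).card := by
          apply Finset.card_le_mul_card_image
          intro m hm
          by_contra hc2
          push Not at hc2
          obtain ⟨z₁, m1, z₂, m2, z₃, m3, n12, n13, n23⟩ := Finset.two_lt_card.1 hc2
          simp only [Finset.mem_filter] at m1 m2 m3
          have e1 := hr z₁ m1.1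
          have e2 := hr z₂ m2.1
          have e3 := hr z₃ m3.1
          rw [m1.2] at e1
          rw [m2.2, ← e1, sq_eq_sq_iff_eq_or_eq_neg] at e2
          rw [m3.2, ← e1, sq_eq_sq_iff_eq_or_eq_neg] at e3
          grind
        omega
      · intro m hm
        obtain ⟨z, hz, rfl⟩ := Finset.mem_image.1 hm
        have h1 := (hE z).1
        rw [hs' z hz, hr z hz, hcast] at h1
        exact_mod_cast h1.symm
    obtain ⟨s, hs, hs'⟩ := hset (Or.inl rfl)
    obtain ⟨t, ht, ht'⟩ := hset (Or.inr rfl)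
    have key : ∀ u ∈ s, ∀ v ∈ t, u - v = 1 ∨ u - v = -1 ∨ u - v = 2 ∨ u - v = -2 := by
      intro u hu v hv
      have h1 : u - v ∣ E.eval u - E.eval v := sub_dvd_eval_sub u v E
      rw [hs' u hu, ht' v hv] at h1
      have h2 : u - v ∣ 2 := by
        rw [← dvd_neg]; simpa using h1
      have h3 := Int.le_of_dvd (by norm_num) h2
      have h4 := Int.le_of_dvd (by norm_num) ((neg_dvd).2 h2)
      have h5 : u - v ≠ 0 := by
        intro h0; rw [h0] at h2; norm_num at h2
      omega
    have hs0 : s.Nonempty := Finset.card_pos.1 (by omega)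
    have hmin := s.min'_mem hs0
    have hmax := s.max'_mem hs0
    have h1 : s ⊆ Finset.Icc (s.min' hs0) (s.max' hs0) := fun u hu =>
      Finset.mem_Icc.2 ⟨s.min'_le u hu, s.le_max' u hu⟩
    have h2 := Finset.card_le_card h1
    rw [Int.card_Icc] at h2
    -- The extreme points of `s` are at least 2 apart, and a point of `t` is at distance 1 or 2 from
    -- both.
    have h3 : t ⊆ {s.min' hs0 + 1, s.min' hs0 + 2} := by
      intro v hv
      have h4 := key _ hmin v hv
      have h5 := key _ hmax v hv
      simp only [Finset.mem_insert, Finset.mem_singleton]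
      omega
    have := (Finset.card_le_card h3).trans Finset.card_le_two
    omega
  · obtain ⟨_, O, hO⟩ := exists_kgPoly_eq_aeval_sq q M
    obtain ⟨s, hs, hs'⟩ := h.card_roots hn hq (by omega) (Or.inl rfl)
    have hsub : s ⊆ {1, -1} := by
      intro z hz
      obtain ⟨m, hm⟩ := hsq (Or.inl rfl) (hs' z hz)
      have h1 := (hO z).2
      rw [hs' z hz, hm, hcast] at h1
      have h2 : (m : ℂ) * ((O.eval m : ℤ) : ℂ) ^ 2 = 1 := by
        rw [← hm, ← mul_pow, ← h1]; norm_num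
      have h3 : m * (O.eval m) ^ 2 = 1 := by exact_mod_cast h2
      have h4 : m = 1 := by
        rcases Int.eq_one_or_neg_one_of_mul_eq_one h3 with h4 | h4
        · exact h4
        · rw [h4] at h3
          nlinarith [sq_nonneg (O.eval (-1))]
      rw [h4, Int.cast_one, ← one_pow 2, sq_eq_sq_iff_eq_or_eq_neg] at hm
      simpa using hm
    have := (Finset.card_le_card hsub).trans Finset.card_le_two
    omega

end KGFeasible

end

/-! ### Rational certificates for the small parameters. -/

section

open Polynomial

theorem continuous_kgPoly (q j : ℕ) : Continuous fun x : ℝ => kgPoly q x j := by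
  induction j using kgPoly_induction with
  | h0 => simpa using continuous_const
  | h1 => exact continuous_id
  | h2 j h h' =>
    simp only [kgPoly_add_two]
    fun_prop

/-- The function `ρ² / (Q + ρ)` increases for `ρ > 0`, so an enclosure of `x²` gives one of `ρ`. -/
theorem ratio_mem_Ioo_of_pos {Q D a b x ρ r₁ r₂ : ℝ} (hQ : 0 < Q) (hD : 0 < D) (ha : 0 < a)
    (hax : a ≤ x) (hxb : x ≤ b) (hρ : ρ ^ 2 * D = x ^ 2 * (Q + ρ)) (h0 : 0 < ρ) (hr₁ : 0 < r₁)
    (hr₂ : 0 < r₂) (h₁ : D * r₁ ^ 2 < a ^ 2 * (Q + r₁)) (h₂ : b ^ 2 * (Q + r₂) < D * r₂ ^ 2) :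
    r₁ < ρ ∧ ρ < r₂ := by
  have hx2 : a ^ 2 ≤ x ^ 2 := pow_le_pow_left₀ ha.le hax 2
  have hx3 : x ^ 2 ≤ b ^ 2 := pow_le_pow_left₀ (by linarith) hxb 2
  have hx0 : 0 < x ^ 2 := by have : 0 < x := by linarith
                             positivity
  constructor
  · by_contra hc
    push Not at hc
    have e1 : D * r₁ ^ 2 < x ^ 2 * (Q + r₁) :=
      h₁.trans_le (mul_le_mul_of_nonneg_right hx2 (by linarith))
    have e2 : D * r₁ ^ 2 * (Q + ρ) < D * ρ ^ 2 * (Q + r₁) := by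
      have := mul_lt_mul_of_pos_right e1 (by linarith : 0 < Q + ρ)
      calc _ < _ := this
        _ = x ^ 2 * (Q + ρ) * (Q + r₁) := by ring
        _ = _ := by rw [← hρ]; ring
    have e3 : r₁ ^ 2 * (Q + ρ) < ρ ^ 2 * (Q + r₁) := by
      apply lt_of_mul_lt_mul_left _ hD.le
      linarith
    have e4 : 0 ≤ (r₁ - ρ) * (Q * (r₁ + ρ) + r₁ * ρ) :=
      mul_nonneg (by linarith) (by positivity)
    nlinarith
  · by_contra hc
    push Not at hc
    have e1 : x ^ 2 * (Q + r₂) < D * r₂ ^ 2 :=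
      (mul_le_mul_of_nonneg_right hx3 (by linarith)).trans_lt h₂
    have e2 : D * ρ ^ 2 * (Q + r₂) < D * r₂ ^ 2 * (Q + ρ) := by
      have := mul_lt_mul_of_pos_right e1 (by linarith : 0 < Q + ρ)
      calc _ = x ^ 2 * (Q + ρ) * (Q + r₂) := by rw [← hρ]; ring
        _ = x ^ 2 * (Q + r₂) * (Q + ρ) := by ring
        _ < _ := this
    have e3 : ρ ^ 2 * (Q + r₂) < r₂ ^ 2 * (Q + ρ) := by
      apply lt_of_mul_lt_mul_left _ hD.le
      linarith
    have e4 : 0 ≤ (ρ - r₂) * (Q * (r₂ + ρ) + r₂ * ρ) :=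
      mul_nonneg (by linarith) (by positivity)
    nlinarith

/-- The counterpart for a negative ratio, with `s = -ρ`: as `s` grows up to `Q`, `s²` increases and
`Q - s` decreases. -/
theorem ratio_mem_Ioo_of_neg {Q D a b x s s₁ s₂ : ℝ} (hD : 0 < D) (ha : 0 < a)
    (hax : a ≤ x) (hxb : x ≤ b) (hs : s ^ 2 * D = x ^ 2 * (Q - s)) (h0 : 0 < s) (hs₂ : 0 < s₂)
    (hs₁ : s₁ < Q) (h₁ : D * s₁ ^ 2 < a ^ 2 * (Q - s₁)) (h₂ : b ^ 2 * (Q - s₂) < D * s₂ ^ 2) :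
    s₁ < s ∧ s < s₂ := by
  have hx2 : a ^ 2 ≤ x ^ 2 := pow_le_pow_left₀ ha.le hax 2
  have hx3 : x ^ 2 ≤ b ^ 2 := pow_le_pow_left₀ (by linarith) hxb 2
  have hx0 : 0 < x ^ 2 := by have : 0 < x := by linarith
                             positivity
  have hQs : 0 < Q - s := by
    have : 0 < x ^ 2 * (Q - s) := by rw [← hs]; positivity
    exact (mul_pos_iff_of_pos_left hx0).1 this
  constructor
  · by_contra hc
    push Not at hc
    have e1 : a ^ 2 * (Q - s₁) ≤ x ^ 2 * (Q - s) :=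
      mul_le_mul hx2 (by linarith) (by linarith) hx0.le
    have e2 : D * s ^ 2 ≤ D * s₁ ^ 2 :=
      mul_le_mul_of_nonneg_left (pow_le_pow_left₀ h0.le hc 2) hD.le
    linarith
  · by_contra hc
    push Not at hc
    have e1 : x ^ 2 * (Q - s) ≤ b ^ 2 * (Q - s₂) :=
      mul_le_mul hx3 (by linarith) hQs.le (by positivity)
    have e2 : D * s₂ ^ 2 ≤ D * s ^ 2 :=
      mul_le_mul_of_nonneg_left (pow_le_pow_left₀ hs₂.le hc 2) hD.le
    linarith

/-- The enclosures of `x` and `ρ` place `μ` strictly between `m` and `m + 1`. -/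
theorem not_natCast_of_bounds {C Q K N a b x ρ r₁ r₂ : ℝ} {μ m : ℕ} (hC : 0 < C) (hN : 0 ≤ N)
    (ha : 0 < a) (hax : a ≤ x) (hxb : x ≤ b) (hbK : b ^ 2 < K) 
    (hr : 0 < N * r₁ + 2 * (N + 1) * Q) (h1 : r₁ < ρ) (h2 : ρ < r₂)
    (hμ : C * (4 * Q - x ^ 2) = 2 * μ * (K - x ^ 2) * (N * ρ + 2 * (N + 1) * Q))
    (hlow : 2 * m * (K - a ^ 2) * (N * r₂ + 2 * (N + 1) * Q) < C * (4 * Q - b ^ 2))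
    (hup : C * (4 * Q - a ^ 2) < 2 * (m + 1) * (K - b ^ 2) * (N * r₁ + 2 * (N + 1) * Q)) :
    False := by
  have hx2 : a ^ 2 ≤ x ^ 2 := pow_le_pow_left₀ ha.le hax 2
  have hx3 : x ^ 2 ≤ b ^ 2 := pow_le_pow_left₀ (by linarith) hxb 2
  have t1 : N * r₁ ≤ N * ρ := mul_le_mul_of_nonneg_left h1.le hN
  have t2 : N * ρ ≤ N * r₂ := mul_le_mul_of_nonneg_left h2.le hN
  rcases le_or_gt μ m with hm | hm
  · have hm' : (μ : ℝ) ≤ m := by exact_mod_cast hm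
    have e1 : 2 * μ * (K - x ^ 2) * (N * ρ + 2 * (N + 1) * Q) ≤
        2 * m * (K - a ^ 2) * (N * r₂ + 2 * (N + 1) * Q) := by
      apply mul_le_mul _ (by linarith) (by linarith)
      · have : 0 ≤ K - a ^ 2 := by linarith
        positivity
      · apply mul_le_mul (by linarith) (by linarith) (by linarith) (by positivity)
    have e2 : C * (4 * Q - b ^ 2) ≤ C * (4 * Q - x ^ 2) :=
      mul_le_mul_of_nonneg_left (by linarith) hC.le
    linarith
  · have hm' : (m : ℝ) + 1 ≤ μ := by exact_mod_cast hm
    have e1 : 2 * (m + 1) * (K - b ^ 2) * (N * r₁ + 2 * (N + 1) * Q) ≤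
        2 * μ * (K - x ^ 2) * (N * ρ + 2 * (N + 1) * Q) := by
      apply mul_le_mul _ (by linarith) hr.le
      · have : 0 ≤ K - x ^ 2 := by linarith
        positivity
      · apply mul_le_mul (by linarith) (by linarith) (by linarith) (by positivity)
    have e2 : C * (4 * Q - x ^ 2) ≤ C * (4 * Q - a ^ 2) :=
      mul_le_mul_of_nonneg_left (by linarith) hC.le
    linarith

/-- A numerical certificate for infeasibility: `G_N + ε` has a root between `a` and `b`, and
rational bounds show that neither choice of the ratio gives an integral multiplicity. -/
theorem not_feasible_of_bounds {n q N : ℕ} (hn : 0 < n) (hq : 2 ≤ q) (hN : 1 ≤ N) (ε : ℤ)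
    (a b r₁ r₂ s₁ s₂ : ℚ) (m₁ m₂ : ℕ) (hε : ε = 1 ∨ ε = -1)
    (hbounds : 0 < a ∧ a ≤ b ∧ b ^ 2 < (q + 1) ^ 2 ∧ 0 < r₁ ∧ 0 < r₂ ∧ 0 < s₂ ∧ s₁ < q)
    (hroot : (kgPoly q a N + ε) * (kgPoly q b N + ε) ≤ 0)
    (hratio : ((q : ℚ) ^ N - 1) * r₁ ^ 2 < a ^ 2 * (q + r₁) ∧
      b ^ 2 * (q + r₂) < ((q : ℚ) ^ N - 1) * r₂ ^ 2 ∧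
      ((q : ℚ) ^ N - 1) * s₁ ^ 2 < a ^ 2 * (q - s₁) ∧
      b ^ 2 * (q - s₂) < ((q : ℚ) ^ N - 1) * s₂ ^ 2)
    (hpos : 0 < (N : ℚ) * r₁ + 2 * (N + 1) * q ∧
      2 * m₁ * ((q + 1) ^ 2 - a ^ 2) * (N * r₂ + 2 * (N + 1) * q) <
        (n * ((q + 1) * q) : ℚ) * (4 * q - b ^ 2) ∧
      (n * ((q + 1) * q) : ℚ) * (4 * q - a ^ 2) <
        2 * (m₁ + 1) * ((q + 1) ^ 2 - b ^ 2) * (N * r₁ + 2 * (N + 1) * q))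
    (hneg : 0 < (N : ℚ) * -s₂ + 2 * (N + 1) * q ∧
      2 * m₂ * ((q + 1) ^ 2 - a ^ 2) * (N * -s₁ + 2 * (N + 1) * q) <
        (n * ((q + 1) * q) : ℚ) * (4 * q - b ^ 2) ∧
      (n * ((q + 1) * q) : ℚ) * (4 * q - a ^ 2) <
        2 * (m₂ + 1) * ((q + 1) ^ 2 - b ^ 2) * (N * -s₂ + 2 * (N + 1) * q)) :
    ¬KGFeasible n q N := by
  intro h
  obtain ⟨ha, hab, hb, hr₁, hr₂, hs₂, hs₁⟩ := hbounds
  obtain ⟨q1, q2, q3, q4⟩ := hratio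
  obtain ⟨p1, p2, p3⟩ := hpos
  obtain ⟨n1, n2, n3⟩ := hneg
  rw [← Rat.cast_lt (K := ℝ)] at ha hb hr₁ hr₂ hs₂ hs₁ q1 q2 q3 q4 p1 p2 p3 n1 n2 n3
  rw [← Rat.cast_le (K := ℝ)] at hab hroot
  push_cast at ha hb hr₁ hr₂ hs₂ hs₁ q1 q2 q3 q4 p1 p2 p3 n1 n2 n3 hab hroot
  have hmap : ∀ y : ℚ, ((kgPoly q y N : ℚ) : ℝ) = kgPoly q (y : ℝ) N := fun y =>
    map_kgPoly q (Rat.castHom ℝ) y N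
  rw [hmap, hmap] at hroot
  have hq' : (2 : ℝ) ≤ q := by exact_mod_cast hq
  have hn' : (0 : ℝ) < n := by exact_mod_cast hn
  have hD : (0 : ℝ) < (q : ℝ) ^ N - 1 := by
    have : (1 : ℝ) < (q : ℝ) ^ N := one_lt_pow₀ (by linarith) (by omega)
    linarith
  obtain ⟨x, ⟨hax, hxb⟩, hx⟩ : ∃ x : ℝ, ((a : ℝ) ≤ x ∧ x ≤ b) ∧ kgPoly q x N = -ε := by
    have hcont : ContinuousOn (fun x : ℝ => kgPoly q x N + ε) (Set.Icc (a : ℝ) b) :=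
      ((continuous_kgPoly q N).add continuous_const).continuousOn
    have hmem : (0 : ℝ) ∈ (fun x : ℝ => kgPoly q x N + ε) '' Set.Icc (a : ℝ) b := by
      rcases mul_nonpos_iff.1 hroot with h1 | h1
      · exact intermediate_value_Icc' hab hcont ⟨h1.2, h1.1⟩
      · exact intermediate_value_Icc hab hcont ⟨h1.1, h1.2⟩
    obtain ⟨x, hx, hx0⟩ := hmem
    exact ⟨x, hx, by linarith [hx0]⟩
  obtain ⟨μ, -, hμ⟩ := h.exists_real hε hx
  obtain ⟨ρ, h1, h2⟩ := exists_ratio hq hN hε hx hμ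
  have hC : (0 : ℝ) < n * ((q + 1) * q) := by positivity
  -- The quadratic equation for `ρ` has one root of each sign and the certificate treats both; `ρ =
  -- 0` would force `x = 0`.
  rcases lt_trichotomy ρ 0 with h0 | h0 | h0
  · obtain ⟨e1, e2⟩ := ratio_mem_Ioo_of_neg (s := -ρ) hD ha hax hxb
      (by rw [neg_sq, h1, sub_neg_eq_add]) (by linarith) hs₂ hs₁ q3 q4
    exact not_natCast_of_bounds hC (Nat.cast_nonneg N) ha hax hxb hb n1 (by linarith)
      (by linarith) h2 n2 n3
  · rw [h0] at h1
    have : 0 < x := by linarith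
    have : 0 < x ^ 2 * (q + 0) := by positivity
    linarith
  · obtain ⟨e1, e2⟩ := ratio_mem_Ioo_of_pos (by linarith) hD ha hax hxb h1 h0 hr₁ hr₂ q1 q2
    exact not_natCast_of_bounds hC (Nat.cast_nonneg N) ha hax hxb hb p1 e1 e2 h2 p2 p3

end

/-- In each certificate the data are `ε`, an interval around a root of `G_N + ε`, an interval for
`ρ` if positive, one for `-ρ` if `ρ` is negative, and the integer part of the multiplicity in either
case. The order is `n = 2(1 + q + ⋯ + q^N) + 2`. -/
theorem not_feasible_2_5 : ¬KGFeasible 128 2 5 := by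
  apply not_feasible_of_bounds (by norm_num) (by norm_num) (by norm_num) (1) (147/100) (37/25) (2/5) (43/100) (33/100) (9/25) 12 14 <;>
    norm_num [kgPoly]

theorem not_feasible_2_6 : ¬KGFeasible 256 2 6 := by
  apply not_feasible_of_bounds (by norm_num) (by norm_num) (by norm_num) (1) (29/50) (59/100) (9/100) (3/25) (9/100) (3/25) 23 24 <;>
    norm_num [kgPoly]

theorem not_feasible_2_7 : ¬KGFeasible 512 2 7 := by
  apply not_feasible_of_bounds (by norm_num) (by norm_num) (by norm_num) (1) (403/200) (252/125) (1/4) (7/25) (11/50) (1/4) 36 40 <;>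
    norm_num [kgPoly]

theorem not_feasible_2_8 : ¬KGFeasible 1024 2 8 := by
  apply not_feasible_of_bounds (by norm_num) (by norm_num) (by norm_num) (1) (51/100) (13/25) (11/250) (47/1000) (43/1000) (23/500) 74 76 <;>
    norm_num [kgPoly]

theorem not_feasible_2_9 : ¬KGFeasible 2048 2 9 := by
  apply not_feasible_of_bounds (by norm_num) (by norm_num) (by norm_num) (-1) (43/50) (87/100) (53/1000) (7/125) (13/250) (11/200) 133 136 <;>
    norm_num [kgPoly]

theorem not_feasible_2_10 : ¬KGFeasible 4096 2 10 := by
  apply not_feasible_of_bounds (by norm_num) (by norm_num) (by norm_num) (1) (197/500) (79/200) (2/125) (19/1000) (2/125) (19/1000) 246 248 <;>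
    norm_num [kgPoly]

theorem not_feasible_2_11 : ¬KGFeasible 8192 2 11 := by
  apply not_feasible_of_bounds (by norm_num) (by norm_num) (by norm_num) (-1) (141/100) (1411/1000) (43/1000) (23/500) (21/500) (9/200) 434 443 <;>
    norm_num [kgPoly]

theorem not_feasible_2_12 : ¬KGFeasible 16384 2 12 := by
  apply not_feasible_of_bounds (by norm_num) (by norm_num) (by norm_num) (1) (43/125) (69/200) (3/400) (39/5000) (37/5000) (77/10000) 837 840 <;>
    norm_num [kgPoly]

theorem not_feasible_2_13 : ¬KGFeasible 32768 2 13 := by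
  apply not_feasible_of_bounds (by norm_num) (by norm_num) (by norm_num) (1) (1263/2000) (1579/2500) (97/10000) (1/100) (97/10000) (1/100) 1547 1554 <;>
    norm_num [kgPoly]

theorem not_feasible_2_14 : ¬KGFeasible 65536 2 14 := by
  apply not_feasible_of_bounds (by norm_num) (by norm_num) (by norm_num) (1) (8753/10000) (4377/5000) (19/2000) (49/5000) (19/2000) (49/5000) 2872 2885 <;>
    norm_num [kgPoly]

theorem not_feasible_3_5 : ¬KGFeasible 730 3 5 := by
  apply not_feasible_of_bounds (by norm_num) (by norm_num) (by norm_num) (-1) (3/100) (1/25) (3/1000) (3/500) (3/1000) (3/500) 91 91 <;>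
    norm_num [kgPoly]

theorem not_feasible_3_6 : ¬KGFeasible 2188 3 6 := by
  apply not_feasible_of_bounds (by norm_num) (by norm_num) (by norm_num) (1) (217/100) (2171/1000) (141/1000) (18/125) (27/200) (69/500) 197 205 <;>
    norm_num [kgPoly]

theorem not_feasible_3_7 : ¬KGFeasible 6562 3 7 := by
  apply not_feasible_of_bounds (by norm_num) (by norm_num) (by norm_num) (-1) (611/250) (489/200) (9/100) (93/1000) (11/125) (91/1000) 486 499 <;>
    norm_num [kgPoly]

theorem not_feasible_3_8 : ¬KGFeasible 19684 3 8 := by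
  apply not_feasible_of_bounds (by norm_num) (by norm_num) (by norm_num) (1) (303/500) (607/1000) (8/625) (131/10000) (8/625) (131/10000) 1624 1630 <;>
    norm_num [kgPoly]

theorem not_feasible_4_5 : ¬KGFeasible 2732 4 5 := by
  apply not_feasible_of_bounds (by norm_num) (by norm_num) (by norm_num) (1) (403/200) (252/125) (127/1000) (13/100) (123/1000) (63/500) 320 328 <;>
    norm_num [kgPoly]

theorem not_feasible_4_6 : ¬KGFeasible 10924 4 6 := by
  apply not_feasible_of_bounds (by norm_num) (by norm_num) (by norm_num) (1) (881/1000) (441/500) (13/500) (29/1000) (13/500) (29/1000) 1222 1229 <;>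
    norm_num [kgPoly]

theorem not_feasible_5_5 : ¬KGFeasible 7814 5 5 := by
  apply not_feasible_of_bounds (by norm_num) (by norm_num) (by norm_num) (-1) (1113/500) (2227/1000) (11/125) (91/1000) (87/1000) (9/100) 939 953 <;>
    norm_num [kgPoly]

theorem not_feasible_6_5 : ¬KGFeasible 18664 6 5 := by
  apply not_feasible_of_bounds (by norm_num) (by norm_num) (by norm_num) (-1) (9/1000) (1/100) (1/10000) (1/2500) (1/10000) (1/2500) 2666 2666 <;>
    norm_num [kgPoly]

/-! ### The cases `N = 3` and `N = 4`, and reduction to `q = 2`, `N = 4`. -/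

section

open Polynomial

namespace KGFeasible

variable {n q N : ℕ}

/-- A root `z` of `G_3 + 1 = x³ - 2qx + 1` has degree 3, since a rational root would be `±1`.
Reduced modulo this cubic, the multiplicity formula is an equation of degree at most 2 for `z` whose
linear coefficient `-6μ` does not vanish. -/
theorem not_three (hq : 2 ≤ q) : ¬KGFeasible n q 3 := by
  intro h
  have hdeg : (C (1 : ℚ) * X ^ 3 + C 0 * X ^ 2 + C (-2 * q : ℚ) * X + C 1).natDegree = 3 :=
    natDegree_cubic one_ne_zero
  have hmon : (C (1 : ℚ) * X ^ 3 + C 0 * X ^ 2 + C (-2 * q : ℚ) * X + C 1).Monic := by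
    rw [Monic, leadingCoeff_cubic one_ne_zero]
  set P : ℚ[X] := C 1 * X ^ 3 + C 0 * X ^ 2 + C (-2 * q : ℚ) * X + C 1 with hP
  have hirr : Irreducible P := by
    rw [hmon.irreducible_iff_roots_eq_zero_of_degree_le_three (by omega) (by omega)]
    rw [Multiset.eq_zero_iff_forall_notMem]
    intro r hr
    rw [mem_roots hmon.ne_zero, IsRoot, hP] at hr
    simp only [eval_add, eval_mul, eval_pow, eval_C, eval_X] at hr
    have hint : IsIntegral ℤ r := by
      refine ⟨C 1 * X ^ 3 + C 0 * X ^ 2 + C (-2 * q : ℤ) * X + C 1, ?_, ?_⟩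
      · rw [Monic, leadingCoeff_cubic one_ne_zero]
      · simp only [eval₂_add, eval₂_mul, eval₂_pow, eval₂_C, eval₂_X]
        simpa using hr
    obtain ⟨m, hm⟩ := IsIntegrallyClosed.isIntegral_iff.1 hint
    rw [← hm] at hr
    simp only [eq_intCast] at hr
    have h1 : m ^ 3 - 2 * q * m + 1 = 0 := by
      have : ((m ^ 3 - 2 * q * m + 1 : ℤ) : ℚ) = 0 := by
        push_cast; linear_combination hr
      exact_mod_cast this
    have h2 : m * (2 * q - m ^ 2) = 1 := by linear_combination -h1
    rcases Int.eq_one_or_neg_one_of_mul_eq_one h2 with h3 | h3 <;> rw [h3] at h2 <;>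
      norm_num at h2 <;> omega
  obtain ⟨z, hz⟩ : ∃ z : ℂ, aeval z P = 0 :=
    IsAlgClosed.exists_aeval_eq_zero ℂ P (by rw [degree_eq_natDegree hmon.ne_zero, hdeg]; norm_num)
  have hz' : z ^ 3 - 2 * q * z + 1 = 0 := by
    rw [hP] at hz
    simp at hz
    linear_combination hz
  have hmin : minpoly ℚ z = P := (minpoly.eq_of_irreducible_of_monic hirr hz hmon).symm
  obtain ⟨-, μ, hμ, h1⟩ := h 1 (Or.inl rfl) z (by
    simp only [kgPoly]; push_cast; linear_combination hz')
  simp only [kgPoly, kgDiff, Finset.sum_range_succ, Finset.sum_range_zero, smul_eq_mul,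
    Nat.add_one_sub_one, Nat.reduceSub] at h1
  set c : ℚ := n * ((q + 1) * q) with hc
  have h2 : aeval z (C (c - 2 * μ * (3 * (q + 1) ^ 2 - 4 * q)) * X ^ 2 + C (-6 * μ : ℚ) * X +
      C (-q * c + 4 * μ * q * (q + 1) ^ 2)) = 0 := by
    simp only [map_add, map_mul, map_pow, aeval_X, aeval_C, eq_ratCast, hc]
    push_cast
    linear_combination h1 - (6 * μ * z) * hz'
  have hb : (-6 * μ : ℚ) ≠ 0 := by
    have : (μ : ℚ) ≠ 0 := by exact_mod_cast hμ.ne'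
    simpa using this
  rcases eq_or_ne (C (c - 2 * μ * (3 * (q + 1) ^ 2 - 4 * q)) * X ^ 2 + C (-6 * μ : ℚ) * X +
      C (-q * c + 4 * μ * q * (q + 1) ^ 2)) 0 with h0 | h0
  swap
  · have h3 := natDegree_le_natDegree (minpoly.degree_le_of_ne_zero ℚ z h0 h2)
    rw [hmin, hdeg] at h3
    have := h3.trans natDegree_quadratic_le
    omega
  · have := congrArg (fun p => coeff p 1) h0
    rw [coeff_add, coeff_add, coeff_C_mul, coeff_C_mul, coeff_X_pow, coeff_X_one,
      coeff_C_of_ne_zero one_ne_zero] at this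
    simp only [coeff_zero] at this
    norm_num at this
    omega

/-- With `y = z²` the equation is `y² - 3qy + q² + ε = 0`, of discriminant `5q² - 4ε`, while the
multiplicity formula, divided by `z` and reduced, becomes linear in `y`. So `y` is rational and the
discriminant is a square. -/
theorem exists_int_sq_of_four (h : KGFeasible n q 4) (hq : 3 ≤ q) {ε : ℤ} (hε : ε = 1 ∨ ε = -1) :
    ∃ t : ℤ, t ^ 2 = 5 * q ^ 2 - 4 * ε := by
  obtain ⟨z, hz⟩ : ∃ z : ℂ, kgPoly q z 4 = -ε := by
    obtain ⟨hm, hd⟩ := monic_kgPoly_add_C (R := ℂ) q (by norm_num : 1 ≤ 4) (ε : ℂ)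
    obtain ⟨z, hz⟩ := IsAlgClosed.exists_root _
      (by rw [degree_eq_natDegree hm.ne_zero, hd]; norm_num :
        (kgPoly q (X : ℂ[X]) 4 + C (ε : ℂ)).degree ≠ 0)
    rw [IsRoot, eval_add, eval_kgPoly_X, eval_C, add_eq_zero_iff_eq_neg] at hz
    exact ⟨z, hz⟩
  obtain ⟨-, μ, hμ, h1⟩ := h ε hε z hz
  simp only [kgPoly, kgDiff, Finset.sum_range_succ, Finset.sum_range_zero, smul_eq_mul,
    Nat.add_one_sub_one, Nat.reduceSub] at h1 hz
  have hq2 : 2 ≤ (q : ℤ) ^ 2 - 1 := by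
    have : (3 : ℤ) ≤ q := by exact_mod_cast hq
    nlinarith
  have hz0 : z ≠ 0 := by
    rintro rfl
    have h2 : (((q : ℤ) ^ 2 + ε : ℤ) : ℂ) = 0 := by
      push_cast
      linear_combination hz
    have h3 : (q : ℤ) ^ 2 + ε = 0 := by exact_mod_cast h2
    rcases hε with rfl | rfl <;> omega
  have hy : (z ^ 2) ^ 2 - 3 * q * z ^ 2 + q ^ 2 + ε = 0 := by linear_combination hz
  set a : ℚ := n * ((q + 1) * q) - 2 * μ * (4 * q ^ 2 + 2 * q + 4) with ha
  set b : ℚ := 2 * q * (n * ((q + 1) * q)) + 2 * μ * (-6 * q * (q + 1) ^ 2 + 4 * q ^ 2 + 4 * ε)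
    with hb
  have hlin : (a : ℂ) * z ^ 2 = b := by
    apply mul_left_cancel₀ hz0
    rw [ha, hb]
    push_cast
    linear_combination h1 - 8 * μ * z * hy
  -- The linear relation is trivial only if `2q(q-1)² + 4ε = 0`. This happens for `q = 2`, `ε = -1`,
  -- which is how that parameter escapes.
  have ha0 : a ≠ 0 := by
    intro h0
    rw [h0, Rat.cast_zero, zero_mul] at hlin
    have hb0 : b = 0 := by exact_mod_cast hlin.symm
    have h2 : (2 * μ : ℚ) * (2 * q * (q - 1) ^ 2 + 4 * ε) = 0 := by
      rw [ha] at h0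
      rw [hb] at hb0
      linear_combination hb0 - 2 * q * h0
    have hq' : (3 : ℚ) ≤ q := by exact_mod_cast hq
    have h3 : (4 : ℚ) ≤ (q - 1) ^ 2 := by nlinarith
    have hμ' : (0 : ℚ) < 2 * μ := by
      have : (0 : ℚ) < μ := by exact_mod_cast hμ
      linarith
    have h4 : (-1 : ℚ) ≤ ε := by
      rcases hε with rfl | rfl <;> norm_num
    rcases mul_eq_zero.1 h2 with h5 | h5
    · exact hμ'.ne' h5
    · nlinarith
  set r : ℚ := 2 * (b / a) - 3 * q with hr
  have hzr : z ^ 2 = ((b / a : ℚ) : ℂ) := by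
    push_cast
    rw [eq_div_iff (by exact_mod_cast ha0)]
    linear_combination hlin
  have hr2 : r ^ 2 = ((5 * q ^ 2 - 4 * ε : ℤ) : ℚ) := by
    have : ((r ^ 2 : ℚ) : ℂ) = ((5 * q ^ 2 - 4 * ε : ℤ) : ℂ) := by
      rw [hzr] at hy
      rw [hr]
      push_cast at hy ⊢
      linear_combination 4 * hy
    exact_mod_cast this
  have hint : IsIntegral ℤ r := by
    apply IsIntegral.of_pow (n := 2) (by norm_num)
    rw [hr2]
    exact isIntegral_algebraMap (R := ℤ) (A := ℚ) (x := 5 * (q : ℤ) ^ 2 - 4 * ε)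
  obtain ⟨t, ht⟩ := IsIntegrallyClosed.isIntegral_iff.1 hint
  refine ⟨t, ?_⟩
  rw [← ht, eq_intCast] at hr2
  exact_mod_cast hr2

/-- `5q² - 4` and `5q² + 4` would be squares differing by 8, but distinct squares from 16 on differ
by at least 9. -/
theorem not_four (hq : 3 ≤ q) : ¬KGFeasible n q 4 := by
  intro h
  obtain ⟨s, hs⟩ := h.exists_int_sq_of_four hq (Or.inl rfl)
  obtain ⟨t, ht⟩ := h.exists_int_sq_of_four hq (Or.inr rfl)
  have hq' : (3 : ℤ) ≤ q := by exact_mod_cast hq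
  rw [← sq_abs] at hs ht
  have hs0 := abs_nonneg s
  have ht0 := abs_nonneg t
  generalize |s| = s at *
  generalize |t| = t at *
  have h1 : 4 ≤ s := by nlinarith
  have h2 : s < t := by nlinarith
  nlinarith

theorem bound_of_le {a b : ℕ} (ha : 2 ≤ a) (hab : b ≤ N)
    (h : 76 * (a + 1) ^ 4 * a ^ 2 + (a - 1) ^ 4 < (a - 1) ^ 4 * a ^ b) :
    76 * ((a : ℝ) + 1) ^ 4 * a ^ 2 < (a - 1) ^ 4 * ((a : ℝ) ^ N - 1) := by
  have h1 : a ^ b ≤ a ^ N := Nat.pow_le_pow_right (by omega) hab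
  have h2 : 76 * (a + 1) ^ 4 * a ^ 2 + (a - 1) ^ 4 < (a - 1) ^ 4 * a ^ N :=
    h.trans_le (Nat.mul_le_mul_left _ h1)
  have h3 : ((76 * (a + 1) ^ 4 * a ^ 2 + (a - 1) ^ 4 : ℕ) : ℝ) < (((a - 1) ^ 4 * a ^ N : ℕ) : ℝ) :=
    by exact_mod_cast h2
  push_cast [Nat.cast_sub (by omega : 1 ≤ a)] at h3
  linarith

theorem eq_two_and_eq_four (h : KGFeasible (2 * ∑ i ∈ Finset.range (N + 1), q ^ i + 2) q N)
    (hq : 2 ≤ q) (hN : 3 ≤ N) : q = 2 ∧ N = 4 := by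
  have hbig : ∀ b, 5 ≤ b → b ≤ N →
      76 * (q + 1) ^ 4 * q ^ 2 + (q - 1) ^ 4 < (q - 1) ^ 4 * q ^ b → False := fun b hb hbN hlt =>
    h.not_of_big (by omega) hq (hb.trans hbN) (bound_of_le hq hbN hlt)
  by_contra hne
  rcases eq_or_ne N 3 with rfl | h3
  · exact not_three hq h
  rcases eq_or_ne N 4 with rfl | h4
  · exact not_four (by omega) h
  have hN5 : 5 ≤ N := by omega
  rcases le_or_gt 7 q with h7 | h7
  -- At `N = 5` the inequality first holds for `q = 7`; written in `t = q - 7`, it follows from the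
  -- nonnegativity of the powers of `t`.
  · apply hbig 5 le_rfl hN5
    obtain ⟨t, rfl⟩ : ∃ t, q = t + 7 := ⟨q - 7, by omega⟩
    rw [show t + 7 - 1 = t + 6 by omega]
    ring_nf
    linarith [Nat.zero_le t, Nat.zero_le (t ^ 2), Nat.zero_le (t ^ 3), Nat.zero_le (t ^ 4),
      Nat.zero_le (t ^ 5), Nat.zero_le (t ^ 6), Nat.zero_le (t ^ 7), Nat.zero_le (t ^ 8),
      Nat.zero_le (t ^ 9)]
  interval_cases q
  · rcases le_or_gt 15 N with h15 | h15
    · exact hbig 15 (by norm_num) h15 (by norm_num)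
    interval_cases N <;> simp only [Finset.sum_range_succ, Finset.sum_range_zero] at h <;>
      norm_num at h
    · exact not_feasible_2_5 h
    · exact not_feasible_2_6 h
    · exact not_feasible_2_7 h
    · exact not_feasible_2_8 h
    · exact not_feasible_2_9 h
    · exact not_feasible_2_10 h
    · exact not_feasible_2_11 h
    · exact not_feasible_2_12 h
    · exact not_feasible_2_13 h
    · exact not_feasible_2_14 h
  · rcases le_or_gt 9 N with h15 | h15
    · exact hbig 9 (by norm_num) h15 (by norm_num)
    interval_cases N <;> simp only [Finset.sum_range_succ, Finset.sum_range_zero] at h <;>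
      norm_num at h
    · exact not_feasible_3_5 h
    · exact not_feasible_3_6 h
    · exact not_feasible_3_7 h
    · exact not_feasible_3_8 h
  · rcases le_or_gt 7 N with h15 | h15
    · exact hbig 7 (by norm_num) h15 (by norm_num)
    interval_cases N <;> simp only [Finset.sum_range_succ, Finset.sum_range_zero] at h <;>
      norm_num at h
    · exact not_feasible_4_5 h
    · exact not_feasible_4_6 h
  · rcases le_or_gt 6 N with h15 | h15
    · exact hbig 6 (by norm_num) h15 (by norm_num)
    interval_cases N
    simp only [Finset.sum_range_succ, Finset.sum_range_zero] at h
    norm_num at h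
    exact not_feasible_5_5 h
  · rcases le_or_gt 6 N with h15 | h15
    · exact hbig 6 (by norm_num) h15 (by norm_num)
    interval_cases N
    simp only [Finset.sum_range_succ, Finset.sum_range_zero] at h
    norm_num at h
    exact not_feasible_6_5 h

end KGFeasible

end

/-! ### The cubic case of girth ten -/

namespace SimpleGraph

section Walks

variable {V : Type*} {G : SimpleGraph V}

/-- A walk without backtracking keeps moving away from its origin, since the neighbour one step
closer is unique and is the one just left. -/
theorem edist_succ_of_adj {m i : ℕ} (hg : ((2 * m : ℕ) : ℕ∞) ≤ G.egirth) (hi : i + 2 < m + 1)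
    {a b c d : V} (hbc : G.Adj b c) (hcd : G.Adj c d) (hbd : b ≠ d) (hb : G.edist b a = i)
    (hc : G.edist c a = (i + 1 : ℕ)) : G.edist d a = (i + 2 : ℕ) := by
  rcases edist_adj_cases hg hcd (by omega) hc with h | ⟨i', h1, h2⟩
  · exact h
  · obtain rfl : i' = i := by omega
    exact absurd (eq_of_adj_of_edist_eq hg hbc.symm hcd (by omega) hc hb h2) hbd

theorem edist_four {a b c d e : V} (hg : ((10 : ℕ) : ℕ∞) ≤ G.egirth) (hab : G.Adj a b)
    (hbc : G.Adj b c) (hcd : G.Adj c d) (hde : G.Adj d e) (hac : a ≠ c) (hbd : b ≠ d)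
    (hce : c ≠ e) : G.edist b a = (1 : ℕ) ∧ G.edist c a = (2 : ℕ) ∧ G.edist d a = (3 : ℕ) ∧
      G.edist e a = (4 : ℕ) := by
  have hg' : ((2 * 5 : ℕ) : ℕ∞) ≤ G.egirth := hg
  have h1 : G.edist b a = (1 : ℕ) := by
    rw [edist_eq_one_iff_adj.2 hab.symm, Nat.cast_one]
  have h0 : G.edist a a = (0 : ℕ) := by rw [edist_self, Nat.cast_zero]
  have h2 := edist_succ_of_adj hg' (by norm_num) hab hbc hac h0 h1
  have h3 := edist_succ_of_adj hg' (by norm_num) hbc hcd hbd h1 h2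
  have h4 := edist_succ_of_adj hg' (by norm_num) hcd hde hce h2 h3
  exact ⟨h1, h2, h3, h4⟩

/-- Two walks of length four without backtracking and with the same ends agree. -/
theorem four_walk_unique {a b c d b' c' d' e : V} (hg : ((10 : ℕ) : ℕ∞) ≤ G.egirth)
    (hab : G.Adj a b) (hbc : G.Adj b c) (hcd : G.Adj c d) (hde : G.Adj d e) (hac : a ≠ c)
    (hbd : b ≠ d) (hce : c ≠ e) (hab' : G.Adj a b') (hbc' : G.Adj b' c') (hcd' : G.Adj c' d')
    (hde' : G.Adj d' e) (hac' : a ≠ c') (hbd' : b' ≠ d') (hce' : c' ≠ e) :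
    b = b' ∧ c = c' ∧ d = d' := by
  have hg' : ((2 * 5 : ℕ) : ℕ∞) ≤ G.egirth := hg
  obtain ⟨h1, h2, h3, h4⟩ := edist_four hg hab hbc hcd hde hac hbd hce
  obtain ⟨h1', h2', h3', -⟩ := edist_four hg hab' hbc' hcd' hde' hac' hbd' hce'
  have e3 : d = d' := eq_of_adj_of_edist_eq hg' hde.symm hde'.symm (by norm_num) h4 h3 h3'
  subst e3
  have e2 : c = c' := eq_of_adj_of_edist_eq hg' hcd.symm hcd'.symm (by norm_num) h3 h2 h2'
  subst e2
  exact ⟨eq_of_adj_of_edist_eq hg' hbc.symm hbc'.symm (by norm_num) h2 h1 h1', rfl, rfl⟩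

theorem three_walk_unique {a b c b' c' d : V} (hg : ((10 : ℕ) : ℕ∞) ≤ G.egirth)
    (hab : G.Adj a b) (hbc : G.Adj b c) (hcd : G.Adj c d) (hac : a ≠ c) (hbd : b ≠ d)
    (hab' : G.Adj a b') (hbc' : G.Adj b' c') (hcd' : G.Adj c' d) (hac' : a ≠ c') (hbd' : b' ≠ d) :
    b = b' ∧ c = c' := by
  by_contra hne
  have key : ∀ {b c b' c' : V}, G.Adj a b → G.Adj b c → G.Adj c d → a ≠ c → b ≠ d →
      G.edist b a = (1 : ℕ) ∧ G.edist c a = (2 : ℕ) ∧ G.edist d a = (3 : ℕ) := by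
    intro b c _ _ hab hbc hcd hac hbd
    have hg' : ((2 * 5 : ℕ) : ℕ∞) ≤ G.egirth := hg
    have h1 : G.edist b a = (1 : ℕ) := by
      rw [edist_eq_one_iff_adj.2 hab.symm, Nat.cast_one]
    have h0 : G.edist a a = (0 : ℕ) := by rw [edist_self, Nat.cast_zero]
    have h2 := edist_succ_of_adj hg' (by norm_num) hab hbc hac h0 h1
    exact ⟨h1, h2, edist_succ_of_adj hg' (by norm_num) hbc hcd hbd h1 h2⟩
  have hg' : ((2 * 5 : ℕ) : ℕ∞) ≤ G.egirth := hg
  obtain ⟨h1, h2, h3⟩ := key (b' := b) (c' := c) hab hbc hcd hac hbd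
  obtain ⟨h1', h2', -⟩ := key (b' := b) (c' := c) hab' hbc' hcd' hac' hbd'
  have e2 : c = c' := eq_of_adj_of_edist_eq hg' hcd.symm hcd'.symm (by norm_num) h3 h2 h2'
  subst e2
  exact hne ⟨eq_of_adj_of_edist_eq hg' hbc.symm hbc'.symm (by norm_num) h2 h1 h1', rfl⟩

end Walks

/-- A path of length three. -/
structure IsThreePath {V : Type*} (G : SimpleGraph V) (x u v w : V) : Prop where
  adj₁ : G.Adj x u
  adj₂ : G.Adj u v
  adj₃ : G.Adj v w
  ne₁ : x ≠ v
  ne₂ : u ≠ w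

/-- A path of length three that lies on a common face: its last vertex is as near as possible to
the antipode of its first vertex. -/
structure IsFace {V : Type*} (G : SimpleGraph V) (σ : V → V) (x u v w : V) : Prop extends
    G.IsThreePath x u v w where
  near : G.Near 3 w (σ x)

/-- A path of length three that does not lie on a common face. -/
structure IsZigzag {V : Type*} (G : SimpleGraph V) (σ : V → V) (x u v w : V) : Prop extends
    G.IsThreePath x u v w where
  not_near : ¬G.Near 3 w (σ x)

theorem near_map_of_adj {V : Type*} {G : SimpleGraph V} {σ : V → V}
    (hσ : ∀ u v, G.Adj u v → G.Adj (σ u) (σ v)) (hinv : ∀ u, σ (σ u) = u) {j : ℕ} {u x : V}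
    (h : G.Near j u x) : G.Near j (σ u) (σ x) := by
  have key : ∀ a b, G.edist (σ a) (σ b) ≤ G.edist a b := by
    intro a b
    rcases eq_or_ne (G.edist a b) ⊤ with ht | ht
    · rw [ht]; exact le_top
    · obtain ⟨p, hp⟩ := exists_walk_of_edist_ne_top ht
      have := edist_le (p.map ⟨σ, fun {a b} hab => hσ a b hab⟩)
      rw [Walk.length_map, hp] at this
      exact this
  obtain ⟨i, l, h1, h2⟩ := h
  refine ⟨i, l, h1, ?_⟩
  rw [← h2]
  apply le_antisymm (key u x)
  have := key (σ u) (σ x)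
  rwa [hinv, hinv] at this

theorem IsZigzag.ne_of_isFace {V : Type*} {G : SimpleGraph V} {σ : V → V} {x u v w w' : V}
    (h1 : G.IsZigzag σ x u v w) (h2 : G.IsFace σ x u v w') : w ≠ w' := by
  rintro rfl
  exact h1.not_near h2.near

theorem IsThreePath.isFace_or_isZigzag {V : Type*} {G : SimpleGraph V} {σ : V → V} {x u v w : V} (h : G.IsThreePath x u v w) :
    G.IsFace σ x u v w ∨ G.IsZigzag σ x u v w := by
  by_cases hn : G.Near 3 w (σ x)
  · exact Or.inl ⟨h, hn⟩
  · exact Or.inr ⟨h, hn⟩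

theorem IsThreePath.symm {V : Type*} {G : SimpleGraph V} {x u v w : V}
    (h : G.IsThreePath x u v w) : G.IsThreePath w v u x :=
  ⟨h.adj₃.symm, h.adj₂.symm, h.adj₁.symm, h.ne₂.symm, h.ne₁.symm⟩

namespace IsAntipodal

variable {V : Type*} [Fintype V] {G : SimpleGraph V} [DecidableRel G.Adj] {χ : V → ℤ} {σ : V → V}

theorem near_map (h : G.IsAntipodal 4 2 χ σ) {j : ℕ} {u x : V} (hn : G.Near j u x) :
    G.Near j (σ u) (σ x) := by
  classical
  exact near_map_of_adj (fun u v huv => h.adj_antipode huv) h.involutive hn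

/-- Applying the involutive automorphism `σ` exchanges nearness of `w` to `σ x` with nearness of `σ
w` to `x`. -/
theorem isFace_symm (h : G.IsAntipodal 4 2 χ σ) {x u v w : V} (hf : G.IsFace σ x u v w) :
    G.IsFace σ w v u x := by
  refine ⟨hf.toIsThreePath.symm, ?_⟩
  have := h.near_map hf.near
  rw [h.involutive] at this
  exact this.symm

theorem isZigzag_symm (h : G.IsAntipodal 4 2 χ σ) {x u v w : V} (hf : G.IsZigzag σ x u v w) :
    G.IsZigzag σ w v u x :=
  ⟨hf.toIsThreePath.symm, fun hn =>
    hf.not_near (h.isFace_symm ⟨hf.toIsThreePath.symm, hn⟩).near⟩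

theorem isThreePath_map (h : G.IsAntipodal 4 2 χ σ) {x u v w : V} (hf : G.IsThreePath x u v w) :
    G.IsThreePath (σ x) (σ u) (σ v) (σ w) := by
  classical
  have hinj : Function.Injective σ := fun a b hab => by
    rw [← h.involutive a, hab, h.involutive]
  exact ⟨h.adj_antipode hf.adj₁, h.adj_antipode hf.adj₂, h.adj_antipode hf.adj₃,
    hinj.ne hf.ne₁, hinj.ne hf.ne₂⟩

theorem eq_or_of_adj (h : G.IsAntipodal 4 2 χ σ) {v a b c d : V} (ha : G.Adj v a)
    (hb : G.Adj v b) (hc : G.Adj v c) (hab : a ≠ b) (hac : a ≠ c) (hbc : b ≠ c)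
    (hd : G.Adj v d) : d = a ∨ d = b ∨ d = c := by
  classical
  have h1 : ({a, b, c} : Finset V) ⊆ G.neighborFinset v := by
    intro x hx
    simp only [Finset.mem_insert, Finset.mem_singleton] at hx
    rw [mem_neighborFinset]
    rcases hx with rfl | rfl | rfl <;> assumption
  have h2 : ({a, b, c} : Finset V).card = 3 := Finset.card_eq_three.2 ⟨a, b, c, hab, hac, hbc, rfl⟩
  have h3 := Finset.eq_of_subset_of_card_le h1 (by
    rw [card_neighborFinset_eq_degree, h.regular v, h2])
  rw [← mem_neighborFinset, ← h3] at hd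
  simpa using hd

theorem exists_third (h : G.IsAntipodal 4 2 χ σ) (v a b : V) :
    ∃ c, G.Adj v c ∧ c ≠ a ∧ c ≠ b := by
  classical
  have h1 : ({a, b} : Finset V).card < (G.neighborFinset v).card := by
    rw [card_neighborFinset_eq_degree, h.regular v]
    exact Finset.card_le_two.trans_lt (by norm_num)
  obtain ⟨c, hc, hc'⟩ := Finset.exists_mem_notMem_of_card_lt_card h1
  rw [mem_neighborFinset] at hc
  simp only [Finset.mem_insert, Finset.mem_singleton, not_or] at hc'
  exact ⟨c, hc, hc'.1, hc'.2⟩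

theorem near_four_antipode (h : G.IsAntipodal 4 2 χ σ) {u v x : V} (hxu : G.Adj x u)
    (huv : G.Adj u v) (hxv : x ≠ v) : G.Near 4 v (σ x) := by
  have h1 : χ v * χ (σ x) = (-1) ^ 4 := by
    have h2 := ((h.eq_iff x (σ x)).1 rfl).1
    rw [h.sign_adj u v huv, h.sign_adj x u hxu, neg_neg]
    exact h2
  rcases h.near_or_eq h1 with h2 | h2
  · exact h2
  · exact absurd (by rw [← h.involutive x, h2, h.involutive]) hxv

theorem near_succ (h : G.IsAntipodal 4 2 χ σ) {j : ℕ} (hj : j < 5) {u v x : V} (huv : G.Adj u v)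
    (hv : G.Near j v x) : G.Near (j + 1) u x :=
  near_succ_of_adj_of_near (m := 5) h.girth hj huv hv

/-- The antipode `σ x` is not near `x` up to level 5, which keeps `v` at distance exactly 4 from `σ
x`; the unique neighbour of `v` one step closer continues the face. -/
theorem isFace_existsUnique (h : G.IsAntipodal 4 2 χ σ) {x u v : V} (hxu : G.Adj x u)
    (huv : G.Adj u v) (hxv : x ≠ v) : ∃! w, G.IsFace σ x u v w := by
  have h1 : ¬G.Near 2 v (σ x) := fun h2 =>
    h.not_near (by norm_num) x
      (h.near_succ (by norm_num) hxu (h.near_succ (by norm_num) huv h2))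
  obtain ⟨w, ⟨hw, hwn⟩, huniq⟩ := existsUnique_adj_near (m := 5) (j := 3) h.girth (by norm_num)
    (h.near_four_antipode hxu huv hxv) (by rintro j' h2; obtain rfl : j' = 2 := by omega
                                           exact h1)
  refine ⟨w, ⟨⟨hxu, huv, hw, hxv, ?_⟩, hwn⟩, fun w' hw' => huniq w' ⟨hw'.adj₃, hw'.near⟩⟩
  rintro rfl
  exact h.not_near (by norm_num) x (h.near_succ (by norm_num) hxu hwn)

theorem isFace_unique (h : G.IsAntipodal 4 2 χ σ) {x u v w w' : V} (h1 : G.IsFace σ x u v w)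
    (h2 : G.IsFace σ x u v w') : w = w' :=
  (h.isFace_existsUnique h1.adj₁ h1.adj₂ h1.ne₁).unique h1 h2

theorem isFace_unique_left (h : G.IsAntipodal 4 2 χ σ) {x x' u v w : V} (h1 : G.IsFace σ x u v w)
    (h2 : G.IsFace σ x' u v w) : x = x' :=
  h.isFace_unique (h.isFace_symm h1) (h.isFace_symm h2)

theorem isZigzag_unique (h : G.IsAntipodal 4 2 χ σ) {x u v w w' : V}
    (h1 : G.IsZigzag σ x u v w) (h2 : G.IsZigzag σ x u v w') : w = w' := by
  obtain ⟨w₀, h0, -⟩ := h.isFace_existsUnique h1.adj₁ h1.adj₂ h1.ne₁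
  have n1 : w ≠ w₀ := by rintro rfl; exact h1.not_near h0.near
  have n2 : w' ≠ w₀ := by rintro rfl; exact h2.not_near h0.near
  rcases h.eq_or_of_adj h1.adj₂.symm h0.adj₃ h1.adj₃ h0.ne₂ h1.ne₂ n1.symm h2.adj₃ with h3 | h3 | h3
  · exact absurd h3.symm h2.ne₂
  · exact absurd h3 n2
  · exact h3.symm

/-- Replacing the first vertex of a path exchanges faces and zigzags. -/
theorem isZigzag_of_isFace_left (h : G.IsAntipodal 4 2 χ σ) {x x' u v w : V}
    (hf : G.IsFace σ x u v w) (hx' : G.Adj u x') (hne : x' ≠ x) (hne' : x' ≠ v) :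
    G.IsZigzag σ x' u v w :=
  ⟨⟨hx'.symm, hf.adj₂, hf.adj₃, hne', hf.ne₂⟩, fun hn => hne (h.isFace_unique_left
    ⟨⟨hx'.symm, hf.adj₂, hf.adj₃, hne', hf.ne₂⟩, hn⟩ hf)⟩

/-- The two choices of first vertex at `u` have different face continuations by
`isFace_unique_left`, and only two continuations exist at `v`. -/
theorem isFace_of_isZigzag_left (h : G.IsAntipodal 4 2 χ σ) {x x' u v w : V}
    (hf : G.IsZigzag σ x u v w) (hx' : G.Adj u x') (hne : x' ≠ x) (hne' : x' ≠ v) :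
    G.IsFace σ x' u v w := by
  obtain ⟨w₁, h1, -⟩ := h.isFace_existsUnique hf.adj₁ hf.adj₂ hf.ne₁
  obtain ⟨w₂, h2, -⟩ := h.isFace_existsUnique hx'.symm hf.adj₂ hne'
  have h3 : w₁ ≠ w₂ := by
    rintro rfl
    exact hne (h.isFace_unique_left h2 h1)
  have h4 : w ≠ w₁ := by rintro rfl; exact hf.not_near h1.near
  rcases h.eq_or_of_adj h1.adj₂.symm h1.adj₃ h2.adj₃ h1.ne₂ h2.ne₂ h3 hf.adj₃ with h5 | h5 | h5
  · exact absurd h5.symm hf.ne₂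
  · exact absurd h5 h4
  · rw [h5]; exact h2

/-- The geodesic of length 3 from `s₃` to `σ s₀` satisfies the face condition at each step, so by
uniqueness it is `s₃ s₄ s₅ s₆`. Face walks thus close up after twelve steps. -/
theorem hexagon (h : G.IsAntipodal 4 2 χ σ) {s₀ s₁ s₂ s₃ s₄ s₅ s₆ : V}
    (h0 : G.IsFace σ s₀ s₁ s₂ s₃) (h1 : G.IsFace σ s₁ s₂ s₃ s₄) (h2 : G.IsFace σ s₂ s₃ s₄ s₅)
    (h3 : G.IsFace σ s₃ s₄ s₅ s₆) : s₆ = σ s₀ := by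
  classical
  have a1 := h.adj_antipode h0.adj₁
  have a2 := h.adj_antipode h0.adj₂
  have a3 := h.adj_antipode h0.adj₃
  have n2 : ¬G.Near 2 s₂ (σ s₀) := fun hn =>
    h.not_near (by norm_num) s₀
      (h.near_succ (by norm_num) h0.adj₁ (h.near_succ (by norm_num) h0.adj₂ hn))
  have n1 : ¬G.Near 1 s₃ (σ s₀) := fun hn => n2 (h.near_succ (by norm_num) h0.adj₃ hn)
  have step : ∀ {j a x y}, j < 5 → G.Adj x y → G.Near j a x → G.Near (j + 1) a y := by
    intro j a x y hj hxy hn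
    exact (h.near_succ hj hxy.symm hn.symm).symm
  obtain ⟨t, ⟨ht, htn⟩, -⟩ := existsUnique_adj_near (m := 5) (j := 2) h.girth (by norm_num)
    h0.near (by rintro j' hj; obtain rfl : j' = 1 := by omega
                exact n1)
  have e4 : t = s₄ := by
    apply h.isFace_unique ⟨⟨h0.adj₂, h0.adj₃, ht, h0.ne₂, ?_⟩, step (by norm_num) a1 htn⟩ h1
    rintro rfl
    exact n2 htn
  subst e4
  have n0 : ¬G.Near 0 t (σ s₀) := fun hn => n1 (h.near_succ (by norm_num) ht hn)
  obtain ⟨r, ⟨hr, hrn⟩, -⟩ := existsUnique_adj_near (m := 5) (j := 1) h.girth (by norm_num)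
    htn (by rintro j' hj; obtain rfl : j' = 0 := by omega
            exact n0)
  have e5 : r = s₅ := by
    apply h.isFace_unique ⟨⟨h0.adj₃, ht, hr, h1.ne₂, ?_⟩,
      step (by norm_num) a2 (step (by norm_num) a1 hrn)⟩ h2
    rintro rfl
    exact n1 hrn
  subst e5
  rw [near_one_iff] at hrn
  symm
  apply h.isFace_unique ⟨⟨ht, hr, hrn, h2.ne₂, ?_⟩, ?_⟩ h3
  · rintro rfl
    exact n0 (near_zero_iff.2 rfl)
  · exact step (by norm_num) a3 (step (by norm_num) a2 (step (by norm_num) a1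
      (near_zero_iff.2 rfl)))

end IsAntipodal

end SimpleGraph

/-! ### Zigzags reach the antipode after eight steps. -/

namespace SimpleGraph.IsAntipodal

variable {V : Type*} [Fintype V] {G : SimpleGraph V} [DecidableRel G.Adj] {χ : V → ℤ} {σ : V → V}

theorem girth_ten (h : G.IsAntipodal 4 2 χ σ) : ((10 : ℕ) : ℕ∞) ≤ G.egirth := h.girth

/-- Two zigzags that leave `u` through the same edge do not have antipodal ends. -/
theorem not_antipodal_of_acute (h : G.IsAntipodal 4 2 χ σ) {u t₁ t₂ t₃ t₄ y₂ y₃ y₄ : V}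
    (ht : G.IsZigzag σ u t₁ t₂ t₃) (ht' : G.IsZigzag σ t₁ t₂ t₃ t₄)
    (hy : G.IsZigzag σ u t₁ y₂ y₃) (hy' : G.IsZigzag σ t₁ y₂ y₃ y₄) (hne : y₂ ≠ t₂) :
    y₄ ≠ σ t₄ := by
  classical
  intro he
  have f1 : G.IsFace σ t₂ t₁ y₂ y₃ :=
    h.isFace_of_isZigzag_left hy ht.adj₂ ht.ne₁.symm hne.symm
  have f0 : G.IsFace σ y₂ t₁ t₂ t₃ :=
    h.isFace_of_isZigzag_left ht hy.adj₂ hy.ne₁.symm hne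
  obtain ⟨a, f2, -⟩ := h.isFace_existsUnique f1.adj₂ f1.adj₃ f1.ne₂
  obtain ⟨b, f3, -⟩ := h.isFace_existsUnique f2.adj₂ f2.adj₃ f2.ne₂
  -- Here `t₃ t₂ t₁ y₂ y₃ a b` is a face walk, so `y₄` and `a` give two paths of length three from
  -- `y₂` to `σ t₃`, against the girth.
  have hb : b = σ t₃ := h.hexagon (h.isFace_symm f0) f1 f2 f3
  have hadj : G.Adj y₄ (σ t₃) := by
    rw [he]; exact h.adj_antipode ht'.adj₃.symm
  have hay : y₄ ≠ a := hy'.ne_of_isFace f2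
  have hsq := three_walk_unique h.girth_ten f3.adj₁ hy'.adj₃ hadj hy'.ne₂ (hb ▸ f3.ne₂) f3.adj₁
    f3.adj₂ (hb ▸ f3.adj₃) f3.ne₁ (hb ▸ f3.ne₂)
  exact hay hsq.2

/-- Two zigzags that leave `u` along the same face do not have antipodal ends. -/
theorem not_antipodal_of_face_face (h : G.IsAntipodal 4 2 χ σ) {u t₁ t₂ t₃ t₄ y₁ y₂ y₃ y₄ : V}
    (ht : G.IsZigzag σ u t₁ t₂ t₃) (ht' : G.IsZigzag σ t₁ t₂ t₃ t₄)
    (hy : G.IsZigzag σ u y₁ y₂ y₃) (hy' : G.IsZigzag σ y₁ y₂ y₃ y₄)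
    (f1 : G.IsFace σ y₂ y₁ u t₁) (f2 : G.IsFace σ y₁ u t₁ t₂) : y₄ ≠ σ t₄ := by
  classical
  intro he
  obtain ⟨a, f3, -⟩ := h.isFace_existsUnique f2.adj₂ f2.adj₃ f2.ne₂
  obtain ⟨b, f4, -⟩ := h.isFace_existsUnique f3.adj₂ f3.adj₃ f3.ne₂
  obtain ⟨g, f0, -⟩ := h.isFace_existsUnique f1.adj₂.symm f1.adj₁.symm f1.ne₁.symm
  have hb : b = σ y₂ := h.hexagon f1 f2 f3 f4
  have ha : a = σ g := h.hexagon (h.isFace_symm f0) f1 f2 f3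
  have hta : t₃ ≠ a := ht.ne_of_isFace f3
  have hyg : y₃ ≠ g := hy.ne_of_isFace f0
  have hinj : Function.Injective σ := fun a b hab => by
    rw [← h.involutive a, hab, h.involutive]
  have e4 : σ y₄ = t₄ := by rw [he, h.involutive]
  have m := h.isThreePath_map hy'.toIsThreePath
  rw [e4] at m
  -- Two paths of length three from `a` to `t₄` are compared: through `t₂ t₃`, and through the
  -- images of `y₂ y₃` under `σ`.
  have := three_walk_unique h.girth_ten f3.adj₃.symm ht.adj₃ ht'.adj₃ hta.symm ht'.ne₂
    (hb ▸ f4.adj₃) m.adj₂ m.adj₃ (ha ▸ hinj.ne hyg.symm) m.ne₂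
  exact f4.ne₂ (this.1.trans hb.symm)

/-- Two zigzags at `u` whose union turns onto a face once do not have antipodal ends. -/
theorem not_antipodal_of_obtuse (h : G.IsAntipodal 4 2 χ σ) {u t₁ t₂ t₃ t₄ y₁ y₂ y₃ y₄ : V}
    (ht' : G.IsZigzag σ t₁ t₂ t₃ t₄)
    (hy : G.IsZigzag σ u y₁ y₂ y₃) (hy' : G.IsZigzag σ y₁ y₂ y₃ y₄)
    (f1 : G.IsFace σ t₁ u y₁ y₂) (z : G.IsZigzag σ y₁ u t₁ t₂) : y₄ ≠ σ t₄ := by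
  classical
  intro he
  obtain ⟨a, f2, -⟩ := h.isFace_existsUnique f1.adj₂ f1.adj₃ f1.ne₂
  obtain ⟨b, f3, -⟩ := h.isFace_existsUnique f2.adj₂ f2.adj₃ f2.ne₂
  obtain ⟨c, f4, -⟩ := h.isFace_existsUnique f3.adj₂ f3.adj₃ f3.ne₂
  obtain ⟨e, f0, -⟩ := h.isFace_existsUnique f1.adj₂.symm f1.adj₁.symm f1.ne₁.symm
  have hc : c = σ t₁ := h.hexagon f1 f2 f3 f4
  have hb : b = σ e := h.hexagon (h.isFace_symm f0) f1 f2 f3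
  have hinj : Function.Injective σ := fun a b hab => by
    rw [← h.involutive a, hab, h.involutive]
  have m := h.isThreePath_map ht'.toIsThreePath
  rw [← he] at m
  -- Two paths of length four from `b` to `y₄` are compared: through `a y₂ y₃`, and through the
  -- images of `t₁ t₂ t₃` under `σ`.
  have := four_walk_unique h.girth_ten f3.adj₃.symm f3.adj₂.symm hy.adj₃ hy'.adj₃ f3.ne₂.symm
    (hy.ne_of_isFace f2).symm hy'.ne₂ (hc ▸ f4.adj₃) m.adj₁ m.adj₂ m.adj₃
    (hb ▸ hinj.ne (z.ne_of_isFace f0).symm) m.ne₁ m.ne₂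
  exact f4.ne₂ (this.1.trans hc.symm)

/-- A walk of length four from `u` to the antipode of the end of a zigzag is itself a zigzag. -/
theorem isZigzag_of_antipodal (h : G.IsAntipodal 4 2 χ σ) {u t₁ t₂ t₃ t₄ y₁ y₂ y₃ y₄ : V}
    (ht : G.IsZigzag σ u t₁ t₂ t₃) (ht' : G.IsZigzag σ t₁ t₂ t₃ t₄)
    (hy : G.IsThreePath u y₁ y₂ y₃) (hy' : G.IsThreePath y₁ y₂ y₃ y₄) (he : y₄ = σ t₄) :
    G.IsZigzag σ u y₁ y₂ y₃ ∧ G.IsZigzag σ y₁ y₂ y₃ y₄ := by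
  classical
  have e4 : σ y₄ = t₄ := by rw [he, h.involutive]
  obtain ⟨b1, g1, -⟩ := h.isFace_existsUnique hy.adj₂.symm hy.adj₁.symm hy.ne₁.symm
  obtain ⟨b2, g2, -⟩ := h.isFace_existsUnique g1.adj₂ g1.adj₃ g1.ne₂
  obtain ⟨b3, g3, -⟩ := h.isFace_existsUnique g2.adj₂ g2.adj₃ g2.ne₂
  have d4 : G.edist t₄ u = (4 : ℕ) := (edist_four h.girth_ten ht.adj₁ ht.adj₂ ht.adj₃ ht'.adj₃
    ht.ne₁ ht.ne₂ ht'.ne₂).2.2.2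
  have dist2 : ∀ {a b}, G.Adj u a → G.Adj a b → b ≠ t₄ := by
    rintro a b hua hab rfl
    have h1 := edist_le_edist_add_one hab.symm u
    rw [edist_eq_one_iff_adj.2 hua.symm, d4] at h1
    exact absurd h1 (by decide)
  have first : G.IsZigzag σ u y₁ y₂ y₃ := by
    rcases hy.isFace_or_isZigzag (σ := σ) with f | z
    -- If `u y₁ y₂ y₃` were on a face, its continuation `b1 b2 b3` beyond `u` would end next to
    -- `t₄`, and uniqueness of paths of length four would put the zigzag on a face.
    · exfalso
      have e3 : y₃ = σ b3 :=
        h.hexagon (h.isFace_symm g3) (h.isFace_symm g2) (h.isFace_symm g1) f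
      have a3 : G.Adj b3 t₄ := by
        have := h.adj_antipode hy'.adj₃
        rwa [e4, e3, h.involutive] at this
      obtain ⟨rfl, rfl, rfl⟩ := four_walk_unique h.girth_ten ht.adj₁ ht.adj₂ ht.adj₃ ht'.adj₃
        ht.ne₁ ht.ne₂ ht'.ne₂ g1.adj₃ g2.adj₃ g3.adj₃ a3 g2.ne₂ g3.ne₂ (dist2 g1.adj₃ g2.adj₃)
      exact ht.not_near g3.near
    · exact z
  refine ⟨first, ?_⟩
  rcases hy'.isFace_or_isZigzag (σ := σ) with f | z
  -- If `y₁ y₂ y₃ y₄` were on a face, that face continued backwards past `y₁` would reach `t₄`; the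
  -- resulting path of length four from `u` would again be the given zigzag.
  · exfalso
    obtain ⟨c1, k1, -⟩ := h.isFace_existsUnique hy.adj₃.symm hy.adj₂.symm hy.ne₂.symm
    obtain ⟨c2, k2, -⟩ := h.isFace_existsUnique k1.adj₂ k1.adj₃ k1.ne₂
    obtain ⟨c3, k3, -⟩ := h.isFace_existsUnique k2.adj₂ k2.adj₃ k2.ne₂
    have e5 : y₄ = σ c3 :=
      h.hexagon (h.isFace_symm k3) (h.isFace_symm k2) (h.isFace_symm k1) f
    have e6 : c3 = t₄ := by rw [← e4, e5, h.involutive]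
    have hu : u ≠ c1 := by
      rintro rfl
      exact first.not_near (h.isFace_symm k1).near
    subst e6
    obtain ⟨rfl, rfl, rfl⟩ := four_walk_unique h.girth_ten ht.adj₁ ht.adj₂ ht.adj₃ ht'.adj₃
      ht.ne₁ ht.ne₂ ht'.ne₂ hy.adj₁ k1.adj₃ k2.adj₃ k3.adj₃ hu k2.ne₂ k3.ne₂
    exact ht'.not_near k3.near
  · exact z

/-- By colour and nearness `σ t₄` is at distance 0, 2 or 4 from `u`. Distance 0 fails because `t₄`
is near `u`. At distance 2, the face walk from `σ t₄` through `u` would reach `t₄` four steps after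
`u` and hence coincide with the zigzag. -/
theorem exists_four_walk_antipode (h : G.IsAntipodal 4 2 χ σ) {u t₁ t₂ t₃ t₄ : V}
    (ht : G.IsZigzag σ u t₁ t₂ t₃) (ht' : G.IsZigzag σ t₁ t₂ t₃ t₄) :
    ∃ y₁ y₂ y₃, G.IsThreePath u y₁ y₂ y₃ ∧ G.IsThreePath y₁ y₂ y₃ (σ t₄) := by
  classical
  have hd : G.edist t₄ u = (4 : ℕ) := (edist_four h.girth_ten ht.adj₁ ht.adj₂ ht.adj₃ ht'.adj₃
    ht.ne₁ ht.ne₂ ht'.ne₂).2.2.2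
  have hnear : G.Near 4 u t₄ := ⟨4, 0, rfl, by rw [edist_comm, hd]⟩
  have hsign : χ u * χ (σ t₄) = (-1) ^ 4 := by
    have h1 := sign_mul_of_near h.sign h.sign_adj hnear
    have h2 := ((h.eq_iff t₄ (σ t₄)).1 rfl).1
    have h3 : χ t₄ * χ t₄ = 1 := by
      rcases h.sign t₄ with e | e <;> rw [e] <;> norm_num
    linear_combination (χ t₄ * χ (σ t₄)) * h1 + h2 - χ u * χ (σ t₄) * h3
  rcases h.near_or_eq hsign with ⟨i, l, hil, hi⟩ | h1
  swap
  · exact absurd hd (by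
      have : t₄ = u := by rw [← h.involutive t₄, h1, h.involutive]
      rw [this, edist_self]
      exact_mod_cast (by norm_num : (0 : ℕ) ≠ 4))
  have hi' : i = 0 ∨ i = 2 ∨ i = 4 := by omega
  rcases hi' with rfl | rfl | rfl
  · have h1 : u = σ t₄ := edist_eq_zero_iff.1 (hi.trans Nat.cast_zero)
    exact absurd hnear.symm (h1 ▸ h.not_near (by norm_num) t₄)
  · obtain ⟨y, hy, hy1⟩ := exists_adj_edist_eq hi
    have hy2 : G.Adj y (σ t₄) := by
      rw [← edist_eq_one_iff_adj, hy1, Nat.cast_one]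
    have hne : u ≠ σ t₄ := by
      intro h0
      rw [h0, edist_self] at hi
      exact absurd hi (by exact_mod_cast (by norm_num : (0 : ℕ) ≠ 2))
    obtain ⟨b1, g1, -⟩ := h.isFace_existsUnique hy2.symm hy.symm hne.symm
    obtain ⟨b2, g2, -⟩ := h.isFace_existsUnique g1.adj₂ g1.adj₃ g1.ne₂
    obtain ⟨b3, g3, -⟩ := h.isFace_existsUnique g2.adj₂ g2.adj₃ g2.ne₂
    obtain ⟨b4, g4, -⟩ := h.isFace_existsUnique g3.adj₂ g3.adj₃ g3.ne₂
    have e4 : b4 = t₄ := (h.hexagon g1 g2 g3 g4).trans (h.involutive t₄)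
    subst e4
    obtain ⟨rfl, rfl, rfl⟩ := four_walk_unique h.girth_ten ht.adj₁ ht.adj₂ ht.adj₃ ht'.adj₃
      ht.ne₁ ht.ne₂ ht'.ne₂ g1.adj₃ g2.adj₃ g3.adj₃ g4.adj₃ g2.ne₂ g3.ne₂ g4.ne₂
    exact absurd g3.near ht.not_near
  · obtain ⟨y₁, a1, d3⟩ := exists_adj_edist_eq hi
    obtain ⟨y₂, a2, d2⟩ := exists_adj_edist_eq d3
    obtain ⟨y₃, a3, d1⟩ := exists_adj_edist_eq d2
    have a4 : G.Adj y₃ (σ t₄) := by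
      rw [← edist_eq_one_iff_adj, d1, Nat.cast_one]
    have hne : ∀ {a b : V} {i j : ℕ}, G.edist a (σ t₄) = i → G.edist b (σ t₄) = j → i ≠ j →
        a ≠ b := by
      rintro a b i j ha hb hij rfl
      rw [ha] at hb
      exact hij (by exact_mod_cast hb)
    have d0 : G.edist (σ t₄) (σ t₄) = (0 : ℕ) := by rw [edist_self, Nat.cast_zero]
    exact ⟨y₁, y₂, y₃, ⟨a1, a2, a3, hne hi d2 (by norm_num), hne d3 d1 (by norm_num)⟩,
      ⟨a2, a3, a4, hne d3 d1 (by norm_num), hne d2 d0 (by norm_num)⟩⟩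

/-- Eight steps along a zigzag lead to the antipode. -/
theorem eq_antipode_of_isZigzag (h : G.IsAntipodal 4 2 χ σ) {z : ℕ → V}
    (hz : ∀ i, G.IsZigzag σ (z i) (z (i + 1)) (z (i + 2)) (z (i + 3))) (i : ℕ) :
    z (i + 8) = σ (z i) := by
  classical
  -- From the midpoint `z (i + 4)` some zigzag of length four ends at the antipode of `z (i + 8)`.
  -- Every way for it to leave the midpoint is excluded except retracing `z` backwards, which ends
  -- at `z i`.
  obtain ⟨y₁, y₂, y₃, hy, hy'⟩ := h.exists_four_walk_antipode (hz (i + 4)) (hz (i + 5))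
  obtain ⟨w, w'⟩ := h.isZigzag_of_antipodal (hz (i + 4)) (hz (i + 5)) hy hy' rfl
  have he : ∀ {y}, y = σ (z (i + 8)) → z (i + 8) = σ y := by
    rintro y rfl
    exact (h.involutive _).symm
  rcases eq_or_ne y₁ (z (i + 5)) with rfl | h1
  · exfalso
    rcases eq_or_ne y₂ (z (i + 6)) with rfl | h2
    · obtain rfl := h.isZigzag_unique w (hz (i + 4))
      have := h.isZigzag_unique w' (hz (i + 5))
      exact h.not_near (j := 0) (by norm_num) (z (i + 8)) (near_zero_iff.2 this.symm)
    · exact h.not_antipodal_of_acute (hz (i + 4)) (hz (i + 5)) w w' h2 rfl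
  have p1 : G.IsThreePath (z (i + 6)) (z (i + 5)) (z (i + 4)) y₁ :=
    ⟨(hz (i + 4)).adj₂.symm, (hz (i + 4)).adj₁.symm, w.adj₁, (hz (i + 4)).ne₁.symm, h1.symm⟩
  have p2 : G.IsThreePath (z (i + 5)) (z (i + 4)) y₁ y₂ :=
    ⟨(hz (i + 4)).adj₁.symm, w.adj₁, w.adj₂, h1.symm, w.ne₁⟩
  rcases p1.isFace_or_isZigzag (σ := σ) with f1 | z1 <;>
    rcases p2.isFace_or_isZigzag (σ := σ) with f2 | z2
  · exact absurd rfl (h.not_antipodal_of_face_face (hz (i + 4)) (hz (i + 5)) w w'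
      (h.isFace_symm f2) (h.isFace_symm f1))
  · exact absurd (he rfl) (h.not_antipodal_of_obtuse w' (hz (i + 4)) (hz (i + 5))
      (h.isFace_symm f1) z2)
  · exact absurd rfl (h.not_antipodal_of_obtuse (hz (i + 5)) w w' f2 (h.isZigzag_symm z1))
  · have e1 := h.isZigzag_unique z1 (h.isZigzag_symm (hz (i + 3)))
    subst e1
    have e2 := h.isZigzag_unique z2 (h.isZigzag_symm (hz (i + 2)))
    subst e2
    have e3 := h.isZigzag_unique w (h.isZigzag_symm (hz (i + 1)))
    subst e3
    have e4 := h.isZigzag_unique w' (h.isZigzag_symm (hz i))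
    exact he e4.symm

end SimpleGraph.IsAntipodal

/-! ### The group-theoretic contradiction. -/

/-- In a group generated by involutions `r₀, r₁, r₂` like the automorphisms of a map of type
`{6, 3}`, up to the central element `s = (r₁ r₀)⁶`, the zigzag relation `(r₁ r₀ r₂)⁸ = s` forces
`s` to be trivial. -/
theorem pow_six_eq_one_of_relations {Γ : Type*} [Group Γ] {r₀ r₁ r₂ : Γ} (h0 : r₀ * r₀ = 1)
    (h1 : r₁ * r₁ = 1) (h2 : r₂ * r₂ = 1) (h12 : (r₁ * r₂) ^ 3 = 1) (h02 : r₀ * r₂ = r₂ * r₀)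
    (hs : (r₁ * r₀) ^ 6 * (r₁ * r₀) ^ 6 = 1) (hz : (r₁ * r₀ * r₂) ^ 8 = (r₁ * r₀) ^ 6) :
    (r₁ * r₀) ^ 6 = 1 := by
  have i0 : r₀⁻¹ = r₀ := inv_eq_of_mul_eq_one_left h0
  have i1 : r₁⁻¹ = r₁ := inv_eq_of_mul_eq_one_left h1
  have i2 : r₂⁻¹ = r₂ := inv_eq_of_mul_eq_one_left h2
  have c0 : ∀ x, r₀ * (r₀ * x) = x := fun x => by rw [← mul_assoc, h0, one_mul]
  have c1 : ∀ x, r₁ * (r₁ * x) = x := fun x => by rw [← mul_assoc, h1, one_mul]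
  have c2 : ∀ x, r₂ * (r₂ * x) = x := fun x => by rw [← mul_assoc, h2, one_mul]
  have c02 : ∀ x, r₀ * (r₂ * x) = r₂ * (r₀ * x) := fun x => by
    rw [← mul_assoc, h02, mul_assoc]
  have braid : r₂ * (r₁ * r₂) = r₁ * (r₂ * r₁) := by
    have h3 : r₁ * (r₂ * (r₁ * (r₂ * (r₁ * r₂)))) = 1 := by
      rw [← h12]; simp only [pow_succ, pow_zero, one_mul, mul_assoc]
    calc r₂ * (r₁ * r₂) = r₁ * (r₂ * (r₁ * (r₁ * (r₂ * (r₁ * (r₂ * (r₁ * r₂))))))) := by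
          rw [c1, c2, c1]
      _ = r₁ * (r₂ * (r₁ * 1)) := by rw [h3]
      _ = r₁ * (r₂ * r₁) := by rw [mul_one]
  obtain ⟨s, hsdef⟩ : ∃ s, s = (r₁ * r₀) ^ 6 := ⟨_, rfl⟩
  obtain ⟨Z, hZ⟩ : ∃ Z, Z = r₁ * r₀ * r₂ := ⟨_, rfl⟩
  obtain ⟨R, hR⟩ : ∃ R, R = r₁ * r₂ := ⟨_, rfl⟩
  rw [← hsdef] at hs hz ⊢
  rw [← hZ] at hz
  rw [← hR] at h12
  have is : s⁻¹ = s := inv_eq_of_mul_eq_one_left hs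
  -- Conjugation by `r₁` inverts `r₁ r₀`, and `s` is its own inverse.
  have s1 : Commute s r₁ := by
    have h3 : r₁ * s * r₁⁻¹ = s⁻¹ := by
      rw [hsdef, ← conj_pow, ← inv_pow, mul_inv_rev, i0, i1]
      simp only [c1]
    rw [is, mul_inv_eq_iff_eq_mul] at h3
    exact h3.symm
  -- `r₂ = (r₁ r₀)⁻¹ Z`, and `s` is a power of both factors' bases.
  have s2 : Commute s r₂ := by
    have h3 : Commute s (r₁ * r₀) := by
      rw [hsdef]; exact (Commute.refl (r₁ * r₀)).pow_left 6
    have h4 : Commute s Z := by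
      rw [← hz]; exact (Commute.refl Z).pow_left 8
    have h5 := h3.inv_right.mul_right h4
    rwa [hZ, inv_mul_cancel_left] at h5
  have sR : Commute s R := by
    rw [hR]; exact s1.mul_right s2
  obtain ⟨a, ha⟩ : ∃ a, a = Z ^ 2 := ⟨_, rfl⟩
  have a4 : a ^ 4 = s := by rw [ha, ← pow_mul, hz]
  have sa : Commute s a := by rw [← a4]; exact (Commute.refl a).pow_left 4
  have iR : R⁻¹ = r₂ * r₁ := by rw [hR, mul_inv_rev, i1, i2]
  have RR : R * R = R⁻¹ := by
    apply eq_inv_of_mul_eq_one_left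
    rw [← h12, pow_succ, pow_two]
  have RR' : R⁻¹ * R⁻¹ = R := by rw [← mul_inv_rev, RR, inv_inv]
  obtain ⟨b, hb⟩ : ∃ b, b = R⁻¹ * a * R := ⟨_, rfl⟩
  obtain ⟨c, hc⟩ : ∃ c, c = R * a * R⁻¹ := ⟨_, rfl⟩
  have b4 : b ^ 4 = s := by
    have h3 := conj_pow (i := 4) (a := R⁻¹) (b := a)
    rw [inv_inv, a4] at h3
    rw [hb, h3, mul_assoc, sR.eq, inv_mul_cancel_left]
  have c4 : c ^ 4 = s := by
    rw [hc, conj_pow, a4, ← sR.eq, mul_inv_cancel_right]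
  have sb : Commute s b := by
    rw [hb]; exact (sR.inv_right.mul_right sa).mul_right sR
  -- `a = Z²` and its conjugates `b`, `c` under the rotation `R` of order 3 all have fourth power
  -- `s`. Their products in the two cyclic orders are cubes of `a R⁻¹` and `a R`, which are
  -- conjugate to `R⁻¹` and to `(r₁ r₀)⁻²`.
  have abc : a * b * c = 1 := by
    have h3 : a * R⁻¹ = (r₁ * r₀) * R⁻¹ * (r₁ * r₀)⁻¹ := by
      rw [iR, ha, hZ, mul_inv_rev, i0, i1, pow_two]
      simp only [mul_assoc, c2]
    have h4 : a * b * c = (a * R⁻¹) ^ 3 := by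
      calc a * b * c = a * R⁻¹ * (a * (R * R)) * (a * R⁻¹) := by rw [hb, hc]; simp only [mul_assoc]
        _ = (a * R⁻¹) ^ 3 := by rw [RR, pow_succ, pow_two]
    rw [h4, h3, conj_pow, inv_pow, h12, inv_one, mul_one, mul_inv_cancel]
  have acb : a * c * b = s := by
    have h3 : a * R = R * ((r₁ * r₀)⁻¹) ^ 2 * R⁻¹ := by
      rw [iR, ha, hZ, hR, mul_inv_rev, i0, i1, pow_two, pow_two]
      simp only [mul_assoc, braid, c02]
    have h4 : a * c * b = (a * R) ^ 3 := by
      calc a * c * b = a * R * (a * (R⁻¹ * R⁻¹)) * (a * R) := by rw [hb, hc]; simp only [mul_assoc]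
        _ = (a * R) ^ 3 := by rw [RR', pow_succ, pow_two]
    rw [h4, h3, conj_pow, ← pow_mul, inv_pow, ← hsdef, is, ← sR.eq, mul_inv_cancel_right]
  have hc' : c = (a * b)⁻¹ := eq_inv_of_mul_eq_one_right abc
  -- So `a` and `b` commute up to `s`, which commutes with both and squares to 1. Then `(ab)⁴ = a⁴
  -- b⁴ = s² = 1`, whereas `c = (ab)⁻¹` has fourth power `s`.
  have hba : b * a = s * (a * b) := by
    have h3 : a * b⁻¹ * a⁻¹ * b = s := by
      rw [← acb, hc', mul_inv_rev]; simp only [mul_assoc]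
    have h4 : a * b⁻¹ * a⁻¹ = s * b⁻¹ := eq_mul_inv_of_mul_eq h3
    have h5 : a * (b * a⁻¹) = b * s := by
      simpa [mul_assoc, is] using congrArg (fun g => g⁻¹) h4
    have h6 : a * b = s * (b * a) := by
      rw [← mul_assoc, sb.eq, ← h5, mul_assoc, mul_assoc, inv_mul_cancel, mul_one]
    rw [h6, ← mul_assoc, hs, one_mul]
  have hb2a : b ^ 2 * a = a * b ^ 2 := by
    calc b ^ 2 * a = b * (b * a) := by rw [pow_two, mul_assoc]
      _ = b * (s * (a * b)) := by rw [hba]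
      _ = s * (b * (a * b)) := by rw [← mul_assoc, ← sb.eq, mul_assoc]
      _ = s * (b * a) * b := by simp only [mul_assoc]
      _ = s * s * (a * b ^ 2) := by rw [hba, pow_two]; simp only [mul_assoc]
      _ = a * b ^ 2 := by rw [hs, one_mul]
  have hab2 : (a * b) ^ 2 = s * (a ^ 2 * b ^ 2) := by
    calc (a * b) ^ 2 = a * (b * a) * b := by rw [pow_two]; simp only [mul_assoc]
      _ = s * a * a * b * b := by rw [hba, sa.eq]; simp only [mul_assoc]
      _ = s * (a ^ 2 * b ^ 2) := by rw [pow_two, pow_two]; simp only [mul_assoc]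
  have hcomm : Commute (b ^ 2) (a ^ 2) := Commute.pow_right hb2a 2
  have sab : Commute s (a ^ 2 * b ^ 2) := (sa.pow_right 2).mul_right (sb.pow_right 2)
  have hab4 : (a * b) ^ 4 = 1 := by
    calc (a * b) ^ 4 = ((a * b) ^ 2) ^ 2 := by rw [← pow_mul]
      _ = s ^ 2 * (a ^ 2 * b ^ 2) ^ 2 := by rw [hab2, sab.mul_pow]
      _ = (a ^ 2) ^ 2 * (b ^ 2) ^ 2 := by rw [pow_two s, hs, one_mul, hcomm.symm.mul_pow]
      _ = 1 := by rw [← pow_mul, ← pow_mul, a4, b4, hs]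
  rw [← c4, hc', inv_pow, hab4, inv_one]

/-! ### The action of the flag reflections on paths of length two. -/

namespace SimpleGraph

/-- A path of length two. -/
@[ext] structure TwoPath {V : Type*} (G : SimpleGraph V) where
  (a b c : V)
  adj₁ : G.Adj a b
  adj₂ : G.Adj b c
  ne : a ≠ c

namespace IsAntipodal

variable {V : Type*} [Fintype V] {G : SimpleGraph V} [DecidableRel G.Adj] {χ : V → ℤ} {σ : V → V}

/-- A path `a b c` is the flag of the vertex `b`, the edge `bc` and the face through `a b c`. The
involutions `f₀`, `f₁`, `f₂` change only the vertex, the edge or the face; `r₁ r₀` is one step along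
a face and `r₁ r₀ r₂` one step along a zigzag. -/
theorem false_of_two_four [Nonempty V] (h : G.IsAntipodal 4 2 χ σ) : False := by
  classical
  have hex₂ : ∀ Φ : G.TwoPath, ∃ Ψ : G.TwoPath, Ψ.b = Φ.b ∧ Ψ.c = Φ.c ∧ Ψ.a ≠ Φ.a := by
    intro Φ
    obtain ⟨d, h1, h2, h3⟩ := h.exists_third Φ.b Φ.a Φ.c
    exact ⟨⟨d, Φ.b, Φ.c, h1.symm, Φ.adj₂, h3⟩, rfl, rfl, h2⟩
  have hex₀ : ∀ Φ : G.TwoPath, ∃ Ψ : G.TwoPath, Ψ.b = Φ.c ∧ Ψ.c = Φ.b ∧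
      G.IsFace σ Φ.a Φ.b Φ.c Ψ.a := by
    intro Φ
    obtain ⟨w, hw, -⟩ := h.isFace_existsUnique Φ.adj₁ Φ.adj₂ Φ.ne
    exact ⟨⟨w, Φ.c, Φ.b, hw.adj₃.symm, Φ.adj₂.symm, hw.ne₂.symm⟩, rfl, rfl, hw⟩
  choose f₂ hb₂ hc₂ ha₂ using hex₂
  choose f₀ hb₀ hc₀ ha₀ using hex₀
  have uniq₂ : ∀ Φ Ψ : G.TwoPath, Ψ.b = Φ.b → Ψ.c = Φ.c → Ψ.a ≠ Φ.a → f₂ Φ = Ψ := by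
    intro Φ Ψ e1 e2 e3
    refine TwoPath.ext ?_ ((hb₂ Φ).trans e1.symm) ((hc₂ Φ).trans e2.symm)
    have m1 : G.Adj Φ.b Ψ.a := e1 ▸ Ψ.adj₁.symm
    have m2 : G.Adj Φ.b (f₂ Φ).a := hb₂ Φ ▸ (f₂ Φ).adj₁.symm
    have n1 : Φ.c ≠ Ψ.a := e2 ▸ Ψ.ne.symm
    rcases h.eq_or_of_adj Φ.adj₁.symm Φ.adj₂ m1 Φ.ne e3.symm n1 m2 with h1 | h1 | h1
    · exact absurd h1 (ha₂ Φ)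
    · exact absurd (h1.trans (hc₂ Φ).symm) (f₂ Φ).ne
    · exact h1
  have uniq₀ : ∀ Φ Ψ : G.TwoPath, Ψ.b = Φ.c → Ψ.c = Φ.b → G.IsFace σ Φ.a Φ.b Φ.c Ψ.a →
      f₀ Φ = Ψ := fun Φ Ψ e1 e2 e3 =>
    TwoPath.ext (h.isFace_unique (ha₀ Φ) e3) ((hb₀ Φ).trans e1.symm) ((hc₀ Φ).trans e2.symm)
  let f₁ : G.TwoPath → G.TwoPath := fun Φ => ⟨Φ.c, Φ.b, Φ.a, Φ.adj₂.symm, Φ.adj₁.symm, Φ.ne.symm⟩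
  have inv₁ : Function.Involutive f₁ := fun Φ => rfl
  have inv₂ : Function.Involutive f₂ := fun Φ =>
    uniq₂ _ _ (hb₂ Φ).symm (hc₂ Φ).symm (ha₂ Φ).symm
  have inv₀ : Function.Involutive f₀ := fun Φ => by
    refine uniq₀ _ _ (hc₀ Φ).symm (hb₀ Φ).symm ?_
    rw [hb₀, hc₀]
    exact h.isFace_symm (ha₀ Φ)
  let r₀ : Equiv.Perm G.TwoPath := inv₀.toPerm
  let r₁ : Equiv.Perm G.TwoPath := inv₁.toPerm
  let r₂ : Equiv.Perm G.TwoPath := inv₂.toPerm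
  have h0 : r₀ * r₀ = 1 := Equiv.ext inv₀
  have h1 : r₁ * r₁ = 1 := Equiv.ext inv₁
  have h2 : r₂ * r₂ = 1 := Equiv.ext inv₂
  have h12 : (r₁ * r₂) ^ 3 = 1 := by
    ext1 Φ
    change f₁ (f₂ (f₁ (f₂ (f₁ (f₂ Φ))))) = Φ
    obtain ⟨d, hd, hda, hdc⟩ := h.exists_third Φ.b Φ.a Φ.c
    have e1 : f₂ Φ = ⟨d, Φ.b, Φ.c, hd.symm, Φ.adj₂, hdc⟩ := uniq₂ _ _ rfl rfl hda
    have e2 : f₂ ⟨Φ.c, Φ.b, d, Φ.adj₂.symm, hd, hdc.symm⟩ =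
        ⟨Φ.a, Φ.b, d, Φ.adj₁, hd, hda.symm⟩ := uniq₂ _ _ rfl rfl Φ.ne
    have e3 : f₂ ⟨d, Φ.b, Φ.a, hd.symm, Φ.adj₁.symm, hda⟩ =
        ⟨Φ.c, Φ.b, Φ.a, Φ.adj₂.symm, Φ.adj₁.symm, Φ.ne.symm⟩ := uniq₂ _ _ rfl rfl hdc.symm
    rw [e1]
    change f₁ (f₂ (f₁ (f₂ ⟨Φ.c, Φ.b, d, _, _, _⟩))) = Φ
    rw [e2]
    change f₁ (f₂ ⟨d, Φ.b, Φ.a, _, _, _⟩) = Φ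
    rw [e3]
  have h02 : r₀ * r₂ = r₂ * r₀ := by
    ext1 Φ
    change f₀ (f₂ Φ) = f₂ (f₀ Φ)
    symm
    refine uniq₂ _ _ ?_ ?_ ?_
    · rw [hb₀, hb₀, hc₂]
    · rw [hc₀, hc₀, hb₂]
    · intro he
      have h3 := ha₀ (f₂ Φ)
      rw [hb₂, hc₂, he] at h3
      exact ha₂ Φ (h.isFace_unique_left h3 (ha₀ Φ))
  have iterate : ∀ {F : Equiv.Perm G.TwoPath}, (∀ Φ, (F Φ).a = Φ.b ∧ (F Φ).b = Φ.c) → ∀ Φ i,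
      ((F ^ i) Φ).b = ((F ^ (i + 1)) Φ).a ∧ ((F ^ i) Φ).c = ((F ^ (i + 2)) Φ).a := by
    intro F hF Φ i
    have h3 : ∀ i, (F ^ (i + 1)) Φ = F ((F ^ i) Φ) := fun i => by
      rw [pow_succ', Equiv.Perm.mul_apply]
    rw [h3 (i + 1), (hF _).1, h3 i, (hF _).1, (hF _).2]
    exact ⟨rfl, rfl⟩
  have hF : ∀ Φ, ((r₁ * r₀) Φ).a = Φ.b ∧ ((r₁ * r₀) Φ).b = Φ.c := fun Φ => ⟨hc₀ Φ, hb₀ Φ⟩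
  have hFface : ∀ Φ, G.IsFace σ Φ.a Φ.b Φ.c ((r₁ * r₀) Φ).c := ha₀
  have hZ : ∀ Φ, ((r₁ * r₀ * r₂) Φ).a = Φ.b ∧ ((r₁ * r₀ * r₂) Φ).b = Φ.c := fun Φ =>
    ⟨(hc₀ (f₂ Φ)).trans (hb₂ Φ), (hb₀ (f₂ Φ)).trans (hc₂ Φ)⟩
  have hZzig : ∀ Φ, G.IsZigzag σ Φ.a Φ.b Φ.c ((r₁ * r₀ * r₂) Φ).c := by
    intro Φ
    have h3 := ha₀ (f₂ Φ)
    rw [hb₂, hc₂] at h3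
    exact h.isZigzag_of_isFace_left h3 Φ.adj₁.symm (ha₂ Φ).symm Φ.ne
  have hF6 : ∀ Φ, (((r₁ * r₀) ^ 6) Φ).a = σ Φ.a ∧ (((r₁ * r₀) ^ 6) Φ).b = σ Φ.b ∧
      (((r₁ * r₀) ^ 6) Φ).c = σ Φ.c := by
    intro Φ
    set z : ℕ → V := fun i => (((r₁ * r₀) ^ i) Φ).a with hz
    have hface : ∀ i, G.IsFace σ (z i) (z (i + 1)) (z (i + 2)) (z (i + 3)) := by
      intro i
      have h3 := hFface (((r₁ * r₀) ^ i) Φ)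
      rw [← Equiv.Perm.mul_apply, ← pow_succ', (iterate hF Φ i).1, (iterate hF Φ i).2,
        (iterate hF Φ (i + 1)).2] at h3
      exact h3
    have h6 : ∀ i, z (i + 6) = σ (z i) := fun i =>
      h.hexagon (hface i) (hface (i + 1)) (hface (i + 2)) (hface (i + 3))
    have e := iterate hF Φ 0
    exact ⟨h6 0, ((iterate hF Φ 6).1.trans (h6 1)).trans (congrArg σ e.1.symm),
      ((iterate hF Φ 6).2.trans (h6 2)).trans (congrArg σ e.2.symm)⟩
  have hZ8 : (r₁ * r₀ * r₂) ^ 8 = (r₁ * r₀) ^ 6 := by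
    ext1 Φ
    set z : ℕ → V := fun i => (((r₁ * r₀ * r₂) ^ i) Φ).a with hz
    have hzig : ∀ i, G.IsZigzag σ (z i) (z (i + 1)) (z (i + 2)) (z (i + 3)) := by
      intro i
      have h3 := hZzig (((r₁ * r₀ * r₂) ^ i) Φ)
      rw [← Equiv.Perm.mul_apply, ← pow_succ', (iterate hZ Φ i).1, (iterate hZ Φ i).2,
        (iterate hZ Φ (i + 1)).2] at h3
      exact h3
    have h8 := h.eq_antipode_of_isZigzag hzig
    have e := iterate hZ Φ 0
    obtain ⟨e1, e2, e3⟩ := hF6 Φ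
    exact TwoPath.ext ((h8 0).trans e1.symm)
      (((iterate hZ Φ 8).1.trans (h8 1)).trans ((congrArg σ e.1.symm).trans e2.symm))
      (((iterate hZ Φ 8).2.trans (h8 2)).trans ((congrArg σ e.2.symm).trans e3.symm))
  have hs : (r₁ * r₀) ^ 6 * (r₁ * r₀) ^ 6 = 1 := by
    ext1 Φ
    rw [Equiv.Perm.mul_apply, Equiv.Perm.one_apply]
    obtain ⟨e1, e2, e3⟩ := hF6 Φ
    obtain ⟨e1', e2', e3'⟩ := hF6 (((r₁ * r₀) ^ 6) Φ)
    rw [e1, h.involutive] at e1'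
    rw [e2, h.involutive] at e2'
    rw [e3, h.involutive] at e3'
    exact TwoPath.ext e1' e2' e3'
  -- Six face steps act as `σ` on each coordinate, so triviality of this power would make some
  -- vertex its own antipode.
  have hone := pow_six_eq_one_of_relations h0 h1 h2 h12 h02 hs hZ8
  obtain ⟨v⟩ := ‹Nonempty V›
  obtain ⟨a, ha, -, -⟩ := h.exists_third v v v
  obtain ⟨c, hc, hca, -⟩ := h.exists_third v a a
  have h3 := (hF6 ⟨a, v, c, ha.symm, hc, hca.symm⟩).1
  rw [hone] at h3
  exact h.not_near (j := 0) (by norm_num) a (near_zero_iff.2 h3)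

end IsAntipodal

end SimpleGraph

/-! ### Assembly of the two statements. -/

theorem mooreBound_two_mul (q m : ℕ) :
    mooreBound (q + 1) (2 * m) = 2 * ∑ i ∈ Finset.range m, q ^ i := by
  rw [mooreBound, if_pos (even_two_mul m), Nat.mul_div_cancel_left m two_pos, Nat.add_sub_cancel]

theorem IsKGGraph.nonempty {V : Type*} [Fintype V] {G : SimpleGraph V} [DecidableRel G.Adj]
    {k g : ℕ} (h : IsKGGraph G k g) : Nonempty V := by
  by_contra hV
  rw [not_nonempty_iff] at hV
  have h1 : G.egirth = ⊤ := SimpleGraph.egirth_eq_top.2 fun v => (hV.false v).elim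
  rw [h.2] at h1
  exact ENat.natCast_ne_top g h1

/-- The near sets of the ends of an edge are disjoint. This makes the integer `excess` nonnegative,
so negative odd values need no separate argument. -/
theorem IsKGGraph.mooreBound_le {V : Type*} [Fintype V] {G : SimpleGraph V} [DecidableRel G.Adj]
    {q m : ℕ} (h : IsKGGraph G (q + 1) (2 * (m + 1))) :
    2 * ∑ i ∈ Finset.range (m + 1), q ^ i ≤ Fintype.card V := by
  classical
  obtain ⟨u⟩ := h.nonempty
  obtain ⟨v, huv⟩ : ∃ v, G.Adj u v := by
    rw [← SimpleGraph.degree_pos_iff_exists_adj, h.1 u]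
    omega
  have h1 := SimpleGraph.card_near h.2.ge h.1 m (Nat.lt_succ_self m) u
  have h2 := SimpleGraph.card_near h.2.ge h.1 m (Nat.lt_succ_self m) v
  have h3 : Disjoint (Finset.univ.filter fun x => G.Near m u x)
      (Finset.univ.filter fun x => G.Near m v x) := by
    rw [Finset.disjoint_filter]
    exact fun x _ hx => SimpleGraph.not_near_of_adj h.2.ge (Nat.lt_succ_self m) huv hx
  have h4 := Finset.card_le_univ ((Finset.univ.filter fun x => G.Near m u x) ∪
    (Finset.univ.filter fun x => G.Near m v x))
  rw [Finset.card_union_of_disjoint h3, h1, h2] at h4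
  omega

theorem IsKGGraph.not_odd_excess {V : Type*} [Fintype V] {G : SimpleGraph V} [DecidableRel G.Adj]
    {q m : ℕ} (h : IsKGGraph G (q + 1) (2 * (m + 1))) (hm : 2 ≤ m) :
    ¬(Odd (excess V (q + 1) (2 * (m + 1))) ∧
      excess V (q + 1) (2 * (m + 1)) ≤ ((q + 1 : ℕ) : ℤ) - 2) := by
  rintro ⟨hodd, hle⟩
  obtain ⟨e, he⟩ := Nat.exists_eq_add_of_le h.mooreBound_le
  rw [excess, mooreBound_two_mul, he] at hodd hle
  rw [Nat.cast_add, add_sub_cancel_left] at hodd hle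
  obtain ⟨χ, h1, hχ⟩ :=
    (SimpleGraph.isNearRel_near hm h.2.ge h.1 he).exists_sign (Or.inl (by omega))
  have h2 := SimpleGraph.even_card_of_sign (Nat.succ_pos q) h.1 h1 hχ
  rw [he, Nat.even_add] at h2
  have h3 : Even e := h2.1 (even_two_mul _)
  rw [Int.odd_coe_nat, ← Nat.not_even_iff_odd] at hodd
  exact hodd h3

theorem IsKGGraph.excess_ne_two {V : Type*} [Fintype V] {G : SimpleGraph V} [DecidableRel G.Adj]
    {q m : ℕ} (h : IsKGGraph G (q + 1) (2 * (m + 1))) (hm : 3 ≤ m) (hq : 2 ≤ q) :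
    excess V (q + 1) (2 * (m + 1)) ≠ 2 := by
  intro he
  rw [excess, mooreBound_two_mul] at he
  have hn : Fintype.card V = 2 * ∑ i ∈ Finset.range (m + 1), q ^ i + 2 := by omega
  obtain ⟨χ, h1, hχ⟩ :=
    -- Excess 2 falls under `e + 2 ≤ k` when `q ≥ 3`, and under the special cubic count when `q =
    -- 2`.
    (SimpleGraph.isNearRel_near (by omega) h.2.ge h.1 hn).exists_sign (by omega)
  obtain ⟨σ, hσ⟩ := SimpleGraph.exists_isAntipodal h.2.ge h.1 h1 hχ hn
  have := h.nonempty
  have hfeas : KGFeasible (2 * ∑ i ∈ Finset.range (m + 1), q ^ i + 2) q m := by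
    intro ε hε z hz
    rw [← hn]
    exact hσ.exists_multiplicity (by omega) hq hε hz
  obtain ⟨rfl, rfl⟩ := hfeas.eq_two_and_eq_four hq hm
  exact hσ.false_of_two_four

theorem corollary4 (k g : ℕ) (hk : 3 ≤ k) (hg : Even g) :
    (6 ≤ g → ∀ (V : Type*) [Fintype V] (G : SimpleGraph V) [DecidableRel G.Adj],
      IsKGGraph G k g → ¬ (Odd (excess V k g) ∧ excess V k g ≤ (k : ℤ) - 2)) ∧
    (8 ≤ g → ∀ (V : Type*) [Fintype V] (G : SimpleGraph V) [DecidableRel G.Adj],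
      IsKGGraph G k g → excess V k g ≠ 2) := by
  obtain ⟨q, rfl⟩ : ∃ q, k = q + 1 := ⟨k - 1, by omega⟩
  obtain ⟨m, rfl⟩ := even_iff_exists_two_mul.1 hg
  constructor
  · intro hg6 V _ G _ h
    obtain ⟨m, rfl⟩ : ∃ r, m = r + 1 := ⟨m - 1, by omega⟩
    exact h.not_odd_excess (by omega)
  · intro hg8 V _ G _ h
    obtain ⟨m, rfl⟩ : ∃ r, m = r + 1 := ⟨m - 1, by omega⟩
    exact h.excess_ne_two (by omega) (by omega)
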